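/- Let $\mathsf k$ be a field, $M$ a lattice (a finitely generated free abelian group), $M_{\mathbb R}=\mathbb R\otimes M$, and let $C\subset M_{\mathbb R}$ be a rational polyhedral cone that is full dimensional and pointed (contains no line). Let $R=\mathsf k[C\cap M]$ be the toric algebra, spanned by the monomials $x^m$ with $m\in C\cap M$ in the Laurent ring $\mathsf k[M]$. For $v\in M_{\mathbb R}$ the conic module $A_v$ is the $M$-graded $R$-submodule of $\mathsf k[M]$ spanned by the $x^m$ with $m\in M\cap(C+v)$, and the chamber of constancy of $v$ is $\Delta=\{w\in M_{\mathbb R}: A_w=A_v\}$; one writes $A_\Delta=A_v$. Let $\Sigma_1\subset \mathrm{Hom}_{\mathbb Z}(M,\mathbb Z)$ be the set of primitive inward-pointing normals to the facets of $C$ (the primitive generators of the extremal rays of the dual cone of $C$). For a chamber $\Delta\ni v$ put $d_n=\lceil\langle v,n\rangle\rceil$ for $n\in\Sigma_1$. The cells of $\Delta$ are the non-empty sets among $$\tau_\Omega=\{x\in M_{\mathbb R}: d_n-1<\langle x,n\rangle<d_n\ \text{for } n\in\Omega,\quad \langle x,n\rangle=d_n\ \text{for } n\in\Sigma_1\setminus\Omega\},\qquad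 \Omega\subseteq\Sigma_1,$$ and the codimension of a cell is the codimension of its affine span in $M_{\mathbb R}$. Let $\mathbb A=\bigoplus_{i=1}^s A_{\Delta_i}^{d_i}$ be a complete sum of conic modules: the $d_i$ are positive integers and every conic module is isomorphic as an $R$-module to exactly one of the $A_{\Delta_i}$. For a chamber $\Delta$ let $P_\Delta=\mathrm{Hom}_R(\mathbb A,A_\Delta)$, an $M$-graded right $\mathrm{End}_R(\mathbb A)$-module by precomposition, and let $S_\Delta$ be its unique graded simple quotient, that is, the quotient of $P_\Delta$ by its unique maximal proper graded submodule. Then, for every chamber of constancy $\Delta$, the projective dimension of the right $\mathrm{End}_R(\mathbb A)$-module $S_\Delta$ equals the maximum of the codimensions of the cells of $\Delta$. In particular $\mathrm{pdim}(S_\Delta)\le \mathrm{rank}(M)$, with equality when $A_\Delta$ is a free $R$-module. -/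

import Mathlib

open scoped TensorProduct

noncomputable section

namespace ConicModules

universe u v

/-- The real vector space `M_ℝ = ℝ ⊗ M` of a lattice `M`. -/
abbrev RealSpace (M : Type v) [AddCommGroup M] : Type v := ℝ ⊗[ℤ] M

section Cones

variable {M : Type v} [AddCommGroup M]

/-- The inclusion `M → M_ℝ`, `m ↦ 1 ⊗ m`. -/
def latticePoint (m : M) : RealSpace M := (1 : ℝ) ⊗ₜ[ℤ] m

/-- A rational polyhedral cone: all non-negative real combinations of a finite set of lattice
vectors. -/
def IsRationalPolyhedral (C : PointedCone ℝ (RealSpace M)) : Prop :=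
  ∃ T : Finset M, C = PointedCone.hull ℝ (latticePoint '' (T : Set M))

/-- `C` is full dimensional: it spans `M_ℝ`. -/
def IsFullDimensional (C : PointedCone ℝ (RealSpace M)) : Prop :=
  Submodule.span ℝ (C : Set (RealSpace M)) = ⊤

/-- `C` is pointed (strongly convex): it contains no line. -/
def IsStronglyConvex (C : PointedCone ℝ (RealSpace M)) : Prop :=
  ∀ x ∈ C, -x ∈ C → x = 0

/-- The real linear functional `⟨·, n⟩` on `M_ℝ` given by `n` in the dual lattice
`N = Hom(M, ℤ)`. -/
def realFunctional (n : Module.Dual ℤ M) : Module.Dual ℝ (RealSpace M) :=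
  n.baseChange ℝ

/-- The dual cone `σ` of `C` in `N_ℝ`, as a set of linear functionals on `M_ℝ`. -/
def dualCone (C : PointedCone ℝ (RealSpace M)) : Set (Module.Dual ℝ (RealSpace M)) :=
  {w | ∀ x ∈ C, 0 ≤ w x}

/-- The set `Σ₁` of primitive inward-pointing normals to the facets of a full-dimensional
cone `C`: the primitive vectors `n` of the dual lattice that span the extremal rays of the
dual cone of `C`. -/
def primitiveNormals (C : PointedCone ℝ (RealSpace M)) : Set (Module.Dual ℤ M) :=
  {n | realFunctional n ∈ dualCone C ∧
    (∀ a ∈ dualCone C, ∀ b ∈ dualCone C, a + b = realFunctional n →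
      ∃ t : ℝ, 0 ≤ t ∧ a = t • realFunctional n) ∧
    ∀ ε : ℝ, 0 < ε → ε < 1 →
      ¬ ∃ n' : Module.Dual ℤ M, realFunctional n' = ε • realFunctional n}

/-- The lattice points `M ∩ (C + x)` of the translated cone `C + x`. -/
def translatePoints (C : PointedCone ℝ (RealSpace M)) (x : RealSpace M) : Set M :=
  {m | latticePoint m - x ∈ C}

end Cones

section Modules

variable (k : Type u) [Field k] {M : Type v} [AddCommGroup M]

/-- The toric algebra `k[C ∩ M]`: the subalgebra of the Laurent ring `k[M]` spanned by the
monomials with exponents in `C`. -/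
def toricAlgebra (C : PointedCone ℝ (RealSpace M)) : Subalgebra k (AddMonoidAlgebra k M) :=
  (AddMonoidAlgebra.supported k k (translatePoints C 0)).toSubalgebra
    (by
      rw [AddMonoidAlgebra.mem_supported']
      intro m hm
      have h0 : m ≠ 0 := by
        rintro rfl
        exact hm (by simp [translatePoints, latticePoint])
      rw [AddMonoidAlgebra.one_def, AddMonoidAlgebra.coeff_single]
      exact Finsupp.single_eq_of_ne h0)
    (by
      classical
      intro f g hf hg
      rw [AddMonoidAlgebra.mem_supported'] at *
      intro m hm
      rw [AddMonoidAlgebra.coeff_mul, Finsupp.sum]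
      refine Finset.sum_eq_zero fun a _ => ?_
      rw [Finsupp.sum]
      refine Finset.sum_eq_zero fun b _ => ?_
      split_ifs with h
      · by_cases ha : a ∈ translatePoints C 0
        · by_cases hb : b ∈ translatePoints C 0
          · refine absurd ?_ hm
            subst h
            simp only [translatePoints, latticePoint, sub_zero, Set.mem_ofPred_eq,
              TensorProduct.tmul_add] at *
            exact C.add_mem ha hb
          · simp [hg b hb]
        · simp [hf a ha]
      · rfl)

/-- The conic module `A_x`: the submodule over the toric algebra of the Laurent ring `k[M]`
spanned by the monomials with exponents in `C + x`. -/
def conicModule (C : PointedCone ℝ (RealSpace M)) (x : RealSpace M) :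
    Submodule (toricAlgebra k C) (AddMonoidAlgebra k M) where
  carrier := AddMonoidAlgebra.supported k k (translatePoints C x)
  add_mem' := fun hf hg => Submodule.add_mem _ hf hg
  zero_mem' := Submodule.zero_mem _
  smul_mem' := by
    classical
    rintro ⟨f, hf⟩ g hg
    change f * g ∈ AddMonoidAlgebra.supported k k (translatePoints C x)
    replace hf : f ∈ AddMonoidAlgebra.supported k k (translatePoints C 0) := hf
    replace hg : g ∈ AddMonoidAlgebra.supported k k (translatePoints C x) := hg
    rw [AddMonoidAlgebra.mem_supported'] at *
    intro m hm
    rw [AddMonoidAlgebra.coeff_mul, Finsupp.sum]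
    refine Finset.sum_eq_zero fun a _ => ?_
    rw [Finsupp.sum]
    refine Finset.sum_eq_zero fun b _ => ?_
    split_ifs with h
    · by_cases ha : a ∈ translatePoints C 0
      · by_cases hb : b ∈ translatePoints C x
        · refine absurd ?_ hm
          subst h
          simp only [translatePoints, latticePoint, sub_zero, Set.mem_ofPred_eq,
            TensorProduct.tmul_add, add_sub_assoc] at *
          exact C.add_mem ha hb
        · simp [hg b hb]
      · simp [hf a ha]
    · rfl

/-- The conic module `A_x` as a type of its own. -/
def ConicModule (C : PointedCone ℝ (RealSpace M)) (x : RealSpace M) : Type (max u v) :=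
  conicModule k C x

instance (C : PointedCone ℝ (RealSpace M)) (x : RealSpace M) :
    AddCommGroup (ConicModule k C x) :=
  (conicModule k C x).addCommGroup

instance (C : PointedCone ℝ (RealSpace M)) (x : RealSpace M) :
    Module (toricAlgebra k C) (ConicModule k C x) :=
  (conicModule k C x).module

/-- The inclusion of `A_x` in the Laurent ring `k[M]`. -/
def toLaurent {C : PointedCone ℝ (RealSpace M)} {x : RealSpace M} (f : ConicModule k C x) :
    AddMonoidAlgebra k M :=
  Subtype.val (p := (· ∈ conicModule k C x)) f

/-- The chamber of constancy containing `x`: all `y` with `A_y = A_x`. -/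
def chamber (C : PointedCone ℝ (RealSpace M)) (x : RealSpace M) : Set (RealSpace M) :=
  {y | conicModule k C y = conicModule k C x}

end Modules

section Cells

variable {M : Type v} [AddCommGroup M]

/-- For the numbers `d_n = ⌈⟨x, n⟩⌉`, `n ∈ Σ₁`, and a subset `Ω` of `Σ₁`, the set of all `y`
with `d_n - 1 < ⟨y, n⟩ < d_n` for `n ∈ Ω` and `⟨y, n⟩ = d_n` for `n ∈ Σ₁ \ Ω`. -/
def openCell (C : PointedCone ℝ (RealSpace M)) (x : RealSpace M)
    (Ω : Set (Module.Dual ℤ M)) : Set (RealSpace M) :=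
  {y | (∀ n ∈ Ω, (⌈realFunctional n x⌉ : ℝ) - 1 < realFunctional n y ∧
        realFunctional n y < ⌈realFunctional n x⌉) ∧
    ∀ n ∈ primitiveNormals C \ Ω, realFunctional n y = ⌈realFunctional n x⌉}

/-- The (non-empty) open cells of a chamber of constancy `Δ`. -/
def cells (C : PointedCone ℝ (RealSpace M)) (Δ : Set (RealSpace M)) :
    Set (Set (RealSpace M)) :=
  {τ | τ.Nonempty ∧ ∃ x ∈ Δ, ∃ Ω ⊆ primitiveNormals C, τ = openCell C x Ω}

/-- The codimension in `M_ℝ` of (the affine span of) a subset of `M_ℝ`. -/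
def codim (τ : Set (RealSpace M)) : ℕ :=
  Module.finrank ℝ (RealSpace M ⧸ (affineSpan ℝ τ).direction)

end Cells

section Endomorphisms

variable (k : Type u) [Field k] {M : Type v} [AddCommGroup M]
  (C : PointedCone ℝ (RealSpace M)) {s : ℕ} (c : Fin s → RealSpace M) (d : Fin s → ℕ)

/-- The direct sum `𝔸 = ⨁ i, A_{c i} ^ {d i}`. -/
abbrev ConicSum : Type (max u v) :=
  (p : Σ i : Fin s, Fin (d i)) → ConicModule k C (c p.1)

/-- `𝔸` is a complete sum of conic modules: all multiplicities are positive and every conic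
module is isomorphic to exactly one of the `A_{c i}`. -/
def IsCompleteSum : Prop :=
  (∀ i, 0 < d i) ∧
    ∀ x : RealSpace M, ∃! i, Nonempty (ConicModule k C x ≃ₗ[toricAlgebra k C]
      ConicModule k C (c i))

/-- The ring `End_R(𝔸)` of `R`-linear endomorphisms of `𝔸` (product: composition). -/
abbrev EndRing : Type (max u v) :=
  Module.End (toricAlgebra k C) (ConicSum k C c d)

/-- `P_Δ = Hom_R(𝔸, A_Δ)` for the chamber `Δ` of `x`. -/
def ProjectiveOf (x : RealSpace M) : Type (max u v) :=
  ConicSum k C c d →ₗ[toricAlgebra k C] ConicModule k C x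

instance (x : RealSpace M) : AddCommGroup (ProjectiveOf k C c d x) :=
  LinearMap.addCommGroup

/-- An element of `P_Δ` as a linear map. -/
def toHom {x : RealSpace M} (f : ProjectiveOf k C c d x) :
    ConicSum k C c d →ₗ[toricAlgebra k C] ConicModule k C x := f

/-- `P_Δ` is a right `End_R(𝔸)`-module by precomposition, `f · a = f ∘ a`; a right module is
a left module over the opposite ring. -/
instance (x : RealSpace M) : Module (EndRing k C c d)ᵐᵒᵖ (ProjectiveOf k C c d x) where
  smul a f := LinearMap.comp (toHom k C c d f) a.unop
  one_smul f := LinearMap.comp_id (toHom k C c d f)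
  mul_smul a b f := (LinearMap.comp_assoc a.unop b.unop (toHom k C c d f)).symm
  smul_zero a := LinearMap.zero_comp a.unop
  smul_add a f g := LinearMap.add_comp a.unop (toHom k C c d g) (toHom k C c d f)
  add_smul a b f := LinearMap.comp_add a.unop b.unop (toHom k C c d f)
  zero_smul f := LinearMap.comp_zero (toHom k C c d f)

/-- `f : 𝔸 → A_x` is homogeneous of degree `m` for the `M`-gradings: it maps elements of degree
`a` to elements of degree `a + m`. -/
def IsHomogeneousHom {x : RealSpace M} (m : M) (f : ProjectiveOf k C c d x) : Prop :=
  ∀ (a : M) (y : ConicSum k C c d),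
    (∀ p, toLaurent k (y p) ∈ AddMonoidAlgebra.grade k a) →
    toLaurent k (toHom k C c d f y) ∈ AddMonoidAlgebra.grade k (a + m)

/-- A right submodule `Q` of `P_Δ` is graded if each of its elements is a finite sum of
homogeneous elements of `Q`. -/
def IsGradedSubmodule {x : RealSpace M}
    (Q : Submodule (EndRing k C c d)ᵐᵒᵖ (ProjectiveOf k C c d x)) : Prop :=
  ∀ f ∈ Q, f ∈ AddSubmonoid.closure {g | g ∈ Q ∧ ∃ m : M, IsHomogeneousHom k C c d m g}

/-- The largest proper graded submodule of `P_Δ`, as the sum of all the proper graded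
submodules. (This sum is a graded submodule; it is the unique maximal one exactly if it is
proper, that is, if the quotient below is non-zero.) -/
def gradedRadical (x : RealSpace M) :
    Submodule (EndRing k C c d)ᵐᵒᵖ (ProjectiveOf k C c d x) :=
  sSup {Q | IsGradedSubmodule k C c d Q ∧ Q ≠ ⊤}

/-- The graded simple quotient `S_Δ` of `P_Δ`. -/
abbrev GradedSimple (x : RealSpace M) : Type (max u v) :=
  ProjectiveOf k C c d x ⧸ gradedRadical k C c d x

/-- The projective dimension of the right `End_R(𝔸)`-module `S_Δ`, an element of
`{-∞} ∪ ℕ ∪ {∞}` (and `-∞` only for the zero module). -/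
def pdimSimple (x : RealSpace M) : WithBot ℕ∞ :=
  CategoryTheory.projectiveDimension
    (ModuleCat.of (EndRing k C c d)ᵐᵒᵖ (GradedSimple k C c d x))

end Endomorphisms

end ConicModules

end

/-!
The module `P_Δ` is projective, and the cells of `Δ` index its resolution. For each cell `τ`, let
`y_τ` be a point just beyond the walls which contain `τ`. If a cell `τ'` has `τ` in its closure,
then `A_{y_τ} ⊆ A_{y_τ'}`, and the inclusions between neighbouring cells, with the incidence numbers
of the cellular complex as signs, form a complex whose `n`-th term is the sum of the
`Hom(𝔸, A_{y_τ})` over the cells `τ` of codimension `n`.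

In a given multidegree, this complex is the cellular complex of those cells which are visible from
one point. Removing the walls which separate this point from `Δ`, beginning with the last ones that
a segment from a generic point of a cell crosses, shows that it is acyclic, unless no wall separates
the point from `Δ`; then a single copy of the field is left. So the complex resolves `S_Δ`. As its
differential consists of proper inclusions it is minimal, hence the projective dimension is the
largest `n` for which its `n`-th term is non-zero.
-/

noncomputable section

namespace ConicModules

/-! ### Extremal rays and facet normals -/

section Extremal

variable {K V ι : Type*} [Field K] [LinearOrder K] [IsStrictOrderedRing K]
  [AddCommGroup V] [Module K V]

theorem hull_image_sub_smul_le [DecidableEq ι] {s : Finset ι} {a : ι → V} (j : ι) {r : ι → K}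
    (hr : ∀ i ∈ s, r i ≤ 0) :
    PointedCone.hull K ((fun i => a i - r i • a j) '' s) ≤
      PointedCone.hull K (a '' ↑(insert j s)) := by
  have hmem (i : ι) (hi : i ∈ insert j s) : a i ∈ PointedCone.hull K (a '' ↑(insert j s)) :=
    PointedCone.subset_hull (Set.mem_image_of_mem a hi)
  refine Submodule.span_le.2 ?_
  rintro _ ⟨i, hi, rfl⟩
  simp only [SetLike.mem_coe, sub_eq_add_neg, ← neg_smul]
  exact add_mem (hmem i (Finset.mem_insert_of_mem hi))
    (PointedCone.smul_mem _ (neg_nonneg.2 (hr i hi)) (hmem j (Finset.mem_insert_self j s)))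

theorem mem_hull_image_of_forall_dual (s : Finset ι) (a : ι → V) (b : V)
    (h : ∀ w : Module.Dual K V, (∀ i ∈ s, 0 ≤ w (a i)) → 0 ≤ w b) :
    b ∈ PointedCone.hull K (a '' s) := by
  classical
  induction s using Finset.induction_on generalizing a b with
  | empty =>
    have hb : b = 0 := (Module.forall_dual_apply_eq_zero_iff K b).1 fun w =>
      le_antisymm (by simpa using h (-w) (by simp)) (h w (by simp))
    exact hb ▸ zero_mem _
  | insert j s _ ih =>
    have hmono : PointedCone.hull K (a '' s) ≤ PointedCone.hull K (a '' ↑(insert j s)) :=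
      Submodule.span_mono (Set.image_mono (by simp))
    have hmem : a j ∈ PointedCone.hull K (a '' ↑(insert j s)) :=
      PointedCone.subset_hull (Set.mem_image_of_mem a (by simp))
    by_cases hs : ∀ w : Module.Dual K V, (∀ i ∈ s, 0 ≤ w (a i)) → 0 ≤ w b
    · exact hmono (ih a b hs)
    push Not at hs
    obtain ⟨w₀, hw₀, hb₀⟩ := hs
    have hj₀ : w₀ (a j) < 0 := by
      by_contra! hcon
      exact hb₀.not_ge (h w₀ (Finset.forall_mem_insert _ _ _ |>.2 ⟨hcon, hw₀⟩))
    -- Project along `a j` onto the kernel of `w₀`.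
    let π : V → V := fun x => x - (w₀ x / w₀ (a j)) • a j
    have hπ : π b ∈ PointedCone.hull K ((fun i => π (a i)) '' s) := by
      refine ih _ _ fun w hw => ?_
      have := h (w - (w (a j) / w₀ (a j)) • w₀) <| Finset.forall_mem_insert _ _ _ |>.2
        ⟨by simp [div_mul_cancel₀ _ hj₀.ne], fun i hi => ?_⟩
      · convert this using 1
        simp [π]; ring
      · convert hw i hi using 1
        simp [π]; ring
    rw [← sub_add_cancel b ((w₀ b / w₀ (a j)) • a j)]
    exact add_mem
      (hull_image_sub_smul_le j
        (fun i hi => div_nonpos_of_nonneg_of_nonpos (hw₀ i hi) hj₀.le) hπ)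
      (PointedCone.smul_mem _ (div_pos_of_neg_of_neg hb₀ hj₀).le hmem)

theorem mem_hull_iff_forall_dual {T : Set V} (hT : T.Finite) {x : V} :
    x ∈ PointedCone.hull K T ↔ ∀ w : Module.Dual K V, (∀ t ∈ T, 0 ≤ w t) → 0 ≤ w x := by
  refine ⟨fun hx w hw => ?_, fun h => ?_⟩
  · have : T ⊆ (PointedCone.positive K K).comap w := hw
    exact Submodule.span_le.2 this hx
  · simpa using mem_hull_image_of_forall_dual hT.toFinset id x fun w hw =>
      h w fun t ht => hw t (hT.mem_toFinset.2 ht)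

/-- A functional is determined, up to scale, by its zeros on `T`. Among the functionals that are
non-negative on `T`, these are the generators of the extremal rays. -/
def IsDetermined (T : Set V) (w : Module.Dual K V) : Prop :=
  ∀ w' : Module.Dual K V, (∀ t ∈ T, w t = 0 → w' t = 0) → ∃ r : K, w' = r • w

/-- A functional `u` lies on a proper face of the smallest face containing `w` of the cone of
functionals that are non-negative on `T`: it is non-negative on `T`, it vanishes where `w` does,
and at some further point of `T`. -/
structure IsDegeneration (T : Set V) (w u : Module.Dual K V) : Prop where
  nonneg : ∀ t ∈ T, 0 ≤ u t
  eq_zero : ∀ t ∈ T, w t = 0 → u t = 0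
  exists_eq_zero : ∃ t ∈ T, w t ≠ 0 ∧ u t = 0

variable {T : Set V} {w w' : Module.Dual K V}

theorem exists_isDegeneration_smul_sub (hT : T.Finite) (hw : ∀ t ∈ T, 0 ≤ w t)
    (hne : ∃ t ∈ T, w t ≠ 0) (hw' : ∀ t ∈ T, w t = 0 → w' t = 0) :
    ∃ r : K, IsDegeneration T w (r • w - w') := by
  obtain ⟨t₀, ⟨ht₀, hwt₀⟩, hmax⟩ := Set.exists_max_image {t ∈ T | w t ≠ 0}
    (fun t => w' t / w t) (hT.subset (Set.sep_subset _ _)) hne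
  refine ⟨w' t₀ / w t₀, fun t ht => ?_, fun t ht h0 => by simp [h0, hw' t ht h0],
    t₀, ht₀, hwt₀, by simp [div_mul_cancel₀ _ hwt₀]⟩
  by_cases h0 : w t = 0
  · simp [h0, hw' t ht h0]
  · have hpos := lt_of_le_of_ne (hw t ht) (Ne.symm h0)
    simpa [div_le_iff₀ hpos] using hmax t ⟨ht, h0⟩

theorem exists_isDegeneration_add (hT : T.Finite) (hspan : Submodule.span K T = ⊤)
    (hw : ∀ t ∈ T, 0 ≤ w t) (hdet : ¬ IsDetermined T w) :
    ∃ u₁ u₂ : Module.Dual K V, IsDegeneration T w u₁ ∧ IsDegeneration T w u₂ ∧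
      ∃ r : K, 0 < r ∧ u₁ + u₂ = r • w := by
  obtain ⟨w', hw', hne⟩ : ∃ w' : Module.Dual K V, (∀ t ∈ T, w t = 0 → w' t = 0) ∧
      ∀ r : K, w' ≠ r • w := by
    simpa [IsDetermined] using hdet
  have hw0 : ∃ t ∈ T, w t ≠ 0 := by
    by_contra! hcon
    exact hne 0 (LinearMap.ext_on hspan fun t ht => by simp [hw' t ht (hcon t ht)])
  obtain ⟨r, hr⟩ := exists_isDegeneration_smul_sub hT hw hw0 hw'
  obtain ⟨s, hs⟩ := exists_isDegeneration_smul_sub (w' := -w') hT hw hw0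
    fun t ht h0 => by simp [hw' t ht h0]
  have hsum : (r • w - w') + (s • w - -w') = (r + s) • w := by module
  refine ⟨_, _, hr, hs, r + s, ?_, hsum⟩
  by_contra! hneg
  -- Otherwise both summands vanish on `T`.
  refine hne r (sub_eq_zero.1 <| LinearMap.ext_on hspan fun t ht => ?_).symm
  have h := LinearMap.congr_fun hsum t
  rw [LinearMap.add_apply, LinearMap.smul_apply, smul_eq_mul] at h
  have hs₀ := hs.nonneg t ht
  exact le_antisymm (by linarith [mul_nonpos_of_nonpos_of_nonneg hneg (hw t ht)] :
    (r • w - w') t ≤ 0) (hr.nonneg t ht)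

theorem mem_hull_isDetermined (hT : T.Finite) (hspan : Submodule.span K T = ⊤)
    (hw : ∀ t ∈ T, 0 ≤ w t) :
    w ∈ PointedCone.hull K {u : Module.Dual K V | (∀ t ∈ T, 0 ≤ u t) ∧ IsDetermined T u} := by
  induction hk : {t ∈ T | w t ≠ 0}.ncard using Nat.strong_induction_on generalizing w with
  | _ k ih =>
  by_cases hdet : IsDetermined T w
  · exact PointedCone.subset_hull ⟨hw, hdet⟩
  obtain ⟨u₁, u₂, h₁, h₂, r, hr, hsum⟩ := exists_isDegeneration_add hT hspan hw hdet
  have hmem {u : Module.Dual K V} (hu : IsDegeneration T w u) :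
      u ∈ PointedCone.hull K {u : Module.Dual K V | (∀ t ∈ T, 0 ≤ u t) ∧ IsDetermined T u} := by
    obtain ⟨t, ht, hwt, hut⟩ := hu.exists_eq_zero
    refine ih _ (hk ▸ Set.ncard_lt_ncard ⟨fun t' ht' => ⟨ht'.1, fun h0 => ht'.2
      (hu.eq_zero t' ht'.1 h0)⟩, fun h => (h ⟨ht, hwt⟩).2 hut⟩ (hT.subset (Set.sep_subset _ _)))
      hu.nonneg rfl
  rw [show w = r⁻¹ • (u₁ + u₂) by rw [hsum, inv_smul_smul₀ hr.ne']]
  exact PointedCone.smul_mem _ (inv_nonneg.2 hr.le) (add_mem (hmem h₁) (hmem h₂))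

theorem isDetermined_iff_extremal (hT : T.Finite) (hspan : Submodule.span K T = ⊤)
    (hw : ∀ t ∈ T, 0 ≤ w t) :
    IsDetermined T w ↔ ∀ a : Module.Dual K V, (∀ t ∈ T, 0 ≤ a t) →
      ∀ b : Module.Dual K V, (∀ t ∈ T, 0 ≤ b t) → a + b = w → ∃ r : K, 0 ≤ r ∧ a = r • w := by
  refine ⟨fun hdet a ha b hb hab => ?_, fun hext => ?_⟩
  · obtain ⟨r, rfl⟩ := hdet a fun t ht h0 => by
      have := LinearMap.congr_fun hab t
      rw [LinearMap.add_apply] at this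
      linarith [ha t ht, hb t ht]
    by_cases hr : 0 ≤ r
    · exact ⟨r, hr, rfl⟩
    · have hw0 : w = 0 := LinearMap.ext_on hspan fun t ht =>
        le_antisymm (nonpos_of_mul_nonneg_right (ha t ht) (not_le.1 hr)) (hw t ht)
      exact ⟨0, le_rfl, by simp [hw0]⟩
  · by_contra hdet
    obtain ⟨u₁, u₂, h₁, h₂, r, hr, hsum⟩ := exists_isDegeneration_add hT hspan hw hdet
    have hnonneg {u : Module.Dual K V} (hu : IsDegeneration T w u) (t : V) (ht : t ∈ T) :
        0 ≤ (r⁻¹ • u) t := mul_nonneg (inv_nonneg.2 hr.le) (hu.nonneg t ht)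
    obtain ⟨s, -, hs⟩ := hext _ (hnonneg h₁) _ (hnonneg h₂)
      (by rw [← smul_add, hsum, inv_smul_smul₀ hr.ne'])
    obtain ⟨t, -, hwt, ht₁⟩ := h₁.exists_eq_zero
    obtain rfl : s = 0 := by
      have := LinearMap.congr_fun hs t
      simpa [ht₁, hwt] using this.symm
    obtain rfl : u₁ = 0 := by simpa [hr.ne'] using hs
    obtain ⟨t', -, hwt', ht₂⟩ := h₂.exists_eq_zero
    have := LinearMap.congr_fun hsum t'
    simp [ht₂, hwt', hr.ne'] at this

end Extremal

section Normals

variable {M : Type*} [AddCommGroup M]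

@[simp]
theorem realFunctional_latticePoint (n : Module.Dual ℤ M) (m : M) :
    realFunctional n (latticePoint m) = n m := by
  simp [realFunctional, latticePoint]

theorem span_range_latticePoint :
    Submodule.span ℝ (Set.range (latticePoint : M → RealSpace M)) = ⊤ := by
  rw [← Submodule.baseChange_top, Submodule.baseChange_eq_span, Submodule.map_top]
  rfl

theorem dual_ext_latticePoint {w w' : Module.Dual ℝ (RealSpace M)}
    (h : ∀ m, w (latticePoint m) = w' (latticePoint m)) : w = w' :=
  LinearMap.ext_on_range span_range_latticePoint h

theorem realFunctional_smul (z : ℤ) (n : Module.Dual ℤ M) :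
    realFunctional (z • n) = (z : ℝ) • realFunctional n :=
  dual_ext_latticePoint fun m => by simp

theorem mem_dualCone_hull {X : Set (RealSpace M)} {w : Module.Dual ℝ (RealSpace M)} :
    w ∈ dualCone (PointedCone.hull ℝ X) ↔ ∀ x ∈ X, 0 ≤ w x :=
  SetLike.ext_iff.1 (PointedCone.dual_hull (p := Module.Dual.eval ℝ (RealSpace M)) X) w

theorem exists_eq_smul_of_ne_zero {n : Module.Dual ℤ M} (hn : n ≠ 0) :
    ∃ (γ : ℤ) (n₁ : Module.Dual ℤ M), 0 < γ ∧ n = γ • n₁ ∧ ∃ m, n₁ m = 1 := by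
  obtain ⟨γ, hγ⟩ := (inferInstance : (LinearMap.range n).IsPrincipal)
  have hγ0 : γ ≠ 0 := by
    rintro rfl
    exact hn (LinearMap.range_eq_bot.1 (by simpa using hγ))
  let e := LinearEquiv.toSpanNonzeroSingleton ℤ ℤ γ hγ0
  let n₁ : Module.Dual ℤ M := e.symm.toLinearMap ∘ₗ n.codRestrict (ℤ ∙ γ)
    fun m => hγ ▸ LinearMap.mem_range_self n m
  have hn₁ : n = γ • n₁ := LinearMap.ext fun m => by
    have : n m = e (n₁ m) := by simp [n₁]
    rw [this]
    exact mul_comm (n₁ m) γ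
  obtain ⟨m, hm⟩ : γ ∈ LinearMap.range n := hγ ▸ Submodule.mem_span_singleton_self γ
  have hm₁ : n₁ m = 1 := by
    rw [hn₁] at hm
    simpa [hγ0] using hm
  rcases hγ0.lt_or_gt with hneg | hpos
  · exact ⟨-γ, -n₁, neg_pos.2 hneg, by simpa using hn₁, -m, by simp [hm₁]⟩
  · exact ⟨γ, n₁, hpos, hn₁, m, hm₁⟩

theorem exists_eq_one_iff_primitive {n : Module.Dual ℤ M} :
    (∃ m, n m = 1) ↔ ∀ ε : ℝ, 0 < ε → ε < 1 →
      ¬ ∃ n' : Module.Dual ℤ M, realFunctional n' = ε • realFunctional n := by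
  constructor
  · rintro ⟨m, hm⟩ ε hε₀ hε₁ ⟨n', hn'⟩
    have hval : (n' m : ℝ) = ε := by simpa [hm] using LinearMap.congr_fun hn' (latticePoint m)
    have h₀ : 0 < n' m := by exact_mod_cast hval ▸ hε₀
    have h₁ : n' m < 1 := by exact_mod_cast hval ▸ hε₁
    exact h₀.not_ge (Int.le_of_lt_add_one h₁)
  · intro h
    have hn : n ≠ 0 := by
      rintro rfl
      exact h 2⁻¹ (by norm_num) (by norm_num) ⟨0, by simp [realFunctional]⟩
    obtain ⟨γ, n₁, hγ, rfl, hm⟩ := exists_eq_smul_of_ne_zero hn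
    obtain rfl | hγ₁ := (Int.add_one_le_of_lt hγ).eq_or_lt
    · simpa using hm
    · have hγ₁ : (1 : ℝ) < γ := by exact_mod_cast hγ₁
      refine absurd ⟨n₁, ?_⟩ (h (γ : ℝ)⁻¹ (by positivity) (inv_lt_one_of_one_lt₀ hγ₁))
      rw [realFunctional_smul, inv_smul_smul₀ (by positivity)]

theorem exists_integral_of_ne_zero [Module.Finite ℤ M] {w : Module.Dual ℝ (RealSpace M)}
    (hw : w ≠ 0) :
    ∃ n : Module.Dual ℤ M, n ≠ 0 ∧ ∀ m, w (latticePoint m) = 0 → n m = 0 := by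
  -- The group of values of `w` on the lattice is free, so it has a non-zero integral functional.
  let φ : M →ₗ[ℤ] ℝ := w.restrictScalars ℤ ∘ₗ TensorProduct.mk ℤ ℝ M 1
  obtain ⟨m₀, hm₀⟩ : ∃ m, φ m ≠ 0 := by
    by_contra! hcon
    exact hw (dual_ext_latticePoint hcon)
  have hm₀ : φ.rangeRestrict m₀ ≠ 0 := fun h => hm₀ (congrArg Subtype.val h)
  have : Module.Finite ℤ (LinearMap.range φ) := Module.Finite.range φ
  have : Module.Free ℤ (LinearMap.range φ) := inferInstance
  obtain ⟨g, hg⟩ : ∃ g : Module.Dual ℤ (LinearMap.range φ), g (φ.rangeRestrict m₀) ≠ 0 := by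
    simpa using (Module.forall_dual_apply_eq_zero_iff ℤ (φ.rangeRestrict m₀)).not.2 hm₀
  refine ⟨g ∘ₗ φ.rangeRestrict, fun h => hg (LinearMap.congr_fun h m₀), fun m hm => ?_⟩
  have : φ.rangeRestrict m = 0 := Subtype.ext hm
  simp [this]

theorem IsDetermined.exists_integral [Module.Finite ℤ M] {T : Set M}
    {w : Module.Dual ℝ (RealSpace M)} (hdet : IsDetermined (latticePoint '' T) w) (hw : w ≠ 0) :
    ∃ (n : Module.Dual ℤ M) (r : ℝ), 0 < r ∧ w = r • realFunctional n ∧ ∃ m, n m = 1 := by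
  obtain ⟨n₀, hn₀, hvanish⟩ := exists_integral_of_ne_zero hw
  obtain ⟨r, hr⟩ := hdet (realFunctional n₀) (by simpa using fun t _ h0 => hvanish t h0)
  obtain ⟨γ, n, hγ, rfl, m, hm⟩ := exists_eq_smul_of_ne_zero hn₀
  have hγ' : (0 : ℝ) < γ := by exact_mod_cast hγ
  rw [realFunctional_smul] at hr
  have hr0 : r ≠ 0 := by
    rintro rfl
    simpa [hm, hγ.ne'] using LinearMap.congr_fun hr (latticePoint m)
  have hw : w = (r⁻¹ * γ) • realFunctional n := by rw [mul_smul, hr, inv_smul_smul₀ hr0]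
  rcases hr0.lt_or_gt with hneg | hpos
  · refine ⟨-n, -(r⁻¹ * γ), neg_pos.2 (mul_neg_of_neg_of_pos (inv_neg''.2 hneg) hγ'), ?_, -m,
      by simpa using hm⟩
    rw [hw, ← neg_one_zsmul n, realFunctional_smul, smul_smul]
    simp
  · exact ⟨n, r⁻¹ * γ, by positivity, hw, m, hm⟩

end Normals

section Cones

variable {M : Type*} [AddCommGroup M]

/-- A full-dimensional rational polyhedral cone, not necessarily pointed. -/
structure IsFullRational (C : PointedCone ℝ (RealSpace M)) : Prop where
  rational : IsRationalPolyhedral C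
  full : IsFullDimensional C

variable {C : PointedCone ℝ (RealSpace M)} {n n' : Module.Dual ℤ M}

theorem exists_eq_one_of_mem_primitiveNormals (hn : n ∈ primitiveNormals C) : ∃ m, n m = 1 :=
  exists_eq_one_iff_primitive.2 hn.2.2

theorem apply_nonneg_of_mem_primitiveNormals_hull {X : Set M}
    (hn : n ∈ primitiveNormals (PointedCone.hull ℝ (latticePoint '' X))) {m : M} (hm : m ∈ X) :
    0 ≤ n m := by
  have := hn.1 _ (PointedCone.subset_hull (Set.mem_image_of_mem _ hm))
  rw [realFunctional_latticePoint] at this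
  exact_mod_cast this

theorem mem_primitiveNormals_hull {T : Finset M}
    (hspan : Submodule.span ℝ (latticePoint '' (T : Set M)) = ⊤) :
    n ∈ primitiveNormals (PointedCone.hull ℝ (latticePoint '' (T : Set M))) ↔
      realFunctional n ∈ dualCone (PointedCone.hull ℝ (latticePoint '' (T : Set M))) ∧
      IsDetermined (latticePoint '' (T : Set M)) (realFunctional n) ∧ ∃ m, n m = 1 := by
  refine and_congr_right fun hdual => and_congr ?_ exists_eq_one_iff_primitive.symm
  rw [isDetermined_iff_extremal (T.finite_toSet.image _) hspan (mem_dualCone_hull.1 hdual)]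
  simp only [mem_dualCone_hull]

theorem IsFullRational.exists_generators (hC : IsFullRational C) :
    ∃ T : Finset M, C = PointedCone.hull ℝ (latticePoint '' (T : Set M)) ∧
      Submodule.span ℝ (latticePoint '' (T : Set M)) = ⊤ := by
  obtain ⟨T, rfl⟩ := hC.rational
  exact ⟨T, rfl, (Submodule.span_span_of_tower _ _ _).symm.trans hC.full⟩

theorem exists_apply_ne_zero_of_mem_primitiveNormals {T : Set M}
    (hspan : Submodule.span ℝ (latticePoint '' T) = ⊤) (hn : n ∈ primitiveNormals C) :
    ∃ t ∈ T, n t ≠ 0 := by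
  by_contra! hcon
  obtain ⟨m, hm⟩ := exists_eq_one_of_mem_primitiveNormals hn
  have : realFunctional n = 0 := LinearMap.ext_on hspan (by simpa [Set.EqOn] using hcon)
  simpa [hm] using LinearMap.congr_fun this (latticePoint m)

theorem primitiveNormals_hull_eq_of_vanish {T : Finset M}
    (hspan : Submodule.span ℝ (latticePoint '' (T : Set M)) = ⊤)
    (hn : n ∈ primitiveNormals (PointedCone.hull ℝ (latticePoint '' (T : Set M))))
    (hn' : n' ∈ primitiveNormals (PointedCone.hull ℝ (latticePoint '' (T : Set M))))
    (h : ∀ t ∈ T, n t = 0 → n' t = 0) : n' = n := by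
  obtain ⟨r, hr⟩ := ((mem_primitiveNormals_hull hspan).1 hn).2.1 (realFunctional n')
    (by simpa using h)
  have hval (m : M) : (n' m : ℝ) = r * n m := by
    simpa using LinearMap.congr_fun hr (latticePoint m)
  obtain ⟨m, hm⟩ := exists_eq_one_of_mem_primitiveNormals hn
  obtain ⟨m', hm'⟩ := exists_eq_one_of_mem_primitiveNormals hn'
  -- Both `n` and `n'` take the value `1`, so `r` is an invertible integer.
  obtain rfl : (n' m : ℝ) = r := by simpa [hm] using hval m
  have hunit : n' m * n m' = 1 := by exact_mod_cast hm' ▸ (hval m').symm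
  obtain ⟨t, ht, hnt⟩ := exists_apply_ne_zero_of_mem_primitiveNormals hspan hn'
  have hpos : 0 < n' m := by
    by_contra! hneg
    have hnt' : n' t = n' m * n t := by exact_mod_cast hval t
    have := apply_nonneg_of_mem_primitiveNormals_hull hn ht
    have := (apply_nonneg_of_mem_primitiveNormals_hull hn' ht).lt_of_ne' hnt
    nlinarith
  have hone : n' m = 1 := Int.eq_one_of_mul_eq_one_right hpos.le hunit
  exact LinearMap.ext fun m₁ => by exact_mod_cast (by simpa [hone] using hval m₁)

namespace IsFullRational

theorem finite_primitiveNormals (hC : IsFullRational C) : (primitiveNormals C).Finite := by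
  obtain ⟨T, rfl, hspan⟩ := hC.exists_generators
  refine Set.Finite.of_finite_image (f := fun n : Module.Dual ℤ M => {t ∈ (T : Set M) | n t = 0})
    (T.finite_toSet.finite_subsets.subset ?_) fun n hn n' hn' h => ?_
  · rintro _ ⟨n, -, rfl⟩
    exact Set.sep_subset _ _
  · exact (primitiveNormals_hull_eq_of_vanish hspan hn hn' fun t ht h0 =>
      ((Set.ext_iff.1 h t).1 ⟨ht, h0⟩).2).symm

theorem dualCone_subset_hull [Module.Finite ℤ M] (hC : IsFullRational C) :
    dualCone C ⊆ PointedCone.hull ℝ (realFunctional '' primitiveNormals C) := by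
  obtain ⟨T, rfl, hspan⟩ := hC.exists_generators
  intro w hw
  refine Submodule.span_le.2 ?_
    (mem_hull_isDetermined (T.finite_toSet.image _) hspan (mem_dualCone_hull.1 hw))
  rintro u ⟨hu, hdet⟩
  obtain rfl | hu0 := eq_or_ne u 0
  · exact zero_mem _
  obtain ⟨n, r, hr, rfl, hn⟩ := hdet.exists_integral hu0
  refine PointedCone.smul_mem _ hr.le (PointedCone.subset_hull ⟨n, ?_, rfl⟩)
  refine (mem_primitiveNormals_hull hspan).2 ⟨mem_dualCone_hull.2 fun x hx =>
    nonneg_of_mul_nonneg_right (hu x hx) hr, fun w' hw' => ?_, hn⟩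
  obtain ⟨r', rfl⟩ := hdet w' fun x hx h0 => hw' x hx (by simpa [hr.ne'] using h0)
  exact ⟨r' * r, (mul_smul r' r _).symm⟩

theorem mem_iff [Module.Finite ℤ M] (hC : IsFullRational C) {x : RealSpace M} :
    x ∈ C ↔ ∀ n ∈ primitiveNormals C, 0 ≤ realFunctional n x := by
  refine ⟨fun hx n hn => hn.1 x hx, fun h => ?_⟩
  have hdual : ∀ w ∈ dualCone C, 0 ≤ w x := fun w hw =>
    (mem_hull_iff_forall_dual (hC.finite_primitiveNormals.image _)).1 (hC.dualCone_subset_hull hw)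
      (Module.Dual.eval ℝ _ x) (by simpa using h)
  obtain ⟨T, rfl⟩ := hC.rational
  exact (mem_hull_iff_forall_dual (T.finite_toSet.image _)).2 fun w hw =>
    hdual w (mem_dualCone_hull.2 hw)

theorem forall_realFunctional_eq_zero_iff [Module.Finite ℤ M] (hC : IsFullRational C)
    {x : RealSpace M} : (∀ n ∈ primitiveNormals C, realFunctional n x = 0) ↔ x ∈ C.lineal := by
  simp only [PointedCone.mem_lineal, hC.mem_iff, map_neg, neg_nonneg, ← forall₂_and,
    ← le_antisymm_iff, eq_comm]

theorem exists_facet_point (hC : IsFullRational C) (hn : n ∈ primitiveNormals C) :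
    ∃ m : M, n m = 0 ∧ ∀ n' ∈ primitiveNormals C, n' ≠ n → 0 < n' m := by
  obtain ⟨T, rfl, hspan⟩ := hC.exists_generators
  refine ⟨∑ t ∈ T with n t = 0, t, ?_, fun n' hn' hne => ?_⟩
  · rw [map_sum]
    exact Finset.sum_eq_zero fun t ht => (Finset.mem_filter.1 ht).2
  · have hnonneg : ∀ t ∈ {t ∈ T | n t = 0}, 0 ≤ n' t := fun t ht =>
      apply_nonneg_of_mem_primitiveNormals_hull hn' (Finset.mem_of_mem_filter t ht)
    obtain ⟨t, ht, ht₀⟩ : ∃ t ∈ {t ∈ T | n t = 0}, n' t ≠ 0 := by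
      by_contra! hcon
      exact hne (primitiveNormals_hull_eq_of_vanish hspan hn hn' fun t ht h0 =>
        hcon t (Finset.mem_filter.2 ⟨ht, h0⟩))
    rw [map_sum]
    exact Finset.sum_pos' hnonneg ⟨t, ht, (hnonneg t ht).lt_of_ne' ht₀⟩

theorem exists_interior_point (hC : IsFullRational C) :
    ∃ m : M, ∀ n ∈ primitiveNormals C, 0 < n m := by
  obtain ⟨T, rfl, hspan⟩ := hC.exists_generators
  refine ⟨∑ t ∈ T, t, fun n hn => ?_⟩
  have hnonneg : ∀ t ∈ T, 0 ≤ n t := fun t ht => apply_nonneg_of_mem_primitiveNormals_hull hn ht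
  obtain ⟨t, ht, ht₀⟩ := exists_apply_ne_zero_of_mem_primitiveNormals hspan hn
  rw [map_sum]
  exact Finset.sum_pos' hnonneg ⟨t, ht, (hnonneg t ht).lt_of_ne' ht₀⟩

end IsFullRational

end Cones

/-! ### Orientations and incidence numbers -/

section ExteriorProducts

variable {K U : Type*} [Field K] [AddCommGroup U] [Module K U]

theorem ιMulti_ne_zero_of_linearIndependent {n : ℕ} {v : Fin n → U}
    (hv : LinearIndependent K v) : ExteriorAlgebra.ιMulti K n v ≠ 0 := by
  intro h
  have hne := (exteriorPower.ιMulti_family_linearIndependent_field (n := n) hv).ne_zero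
    (Set.powersetCard.ofFinEmbEquiv (RelEmbedding.refl (α := Fin n) (· ≤ ·)))
  rw [exteriorPower.ιMulti_family, Equiv.symm_apply_apply] at hne
  exact hne (Subtype.ext h)

theorem exists_ιMulti_eq_smul {W : Submodule K U} [FiniteDimensional K W] {m n : ℕ}
    (hm : Module.finrank K W = m) (hn : Module.finrank K W = n) {e : Fin n → U}
    (he : LinearIndependent K e) (heW : ∀ j, e j ∈ W) {v : Fin m → U} (hvW : ∀ j, v j ∈ W) :
    ∃ c : K, ExteriorAlgebra.ιMulti K m v = c • ExteriorAlgebra.ιMulti K n e := by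
  obtain rfl := hm.symm.trans hn
  lift e to Fin m → W using heW
  lift v to Fin m → W using hvW
  have hdim : Module.finrank K (⋀[K]^m W) = 1 := by
    rw [exteriorPower.finrank_eq, hm, Nat.choose_self]
  have he₀ : exteriorPower.ιMulti K m e ≠ 0 := fun h =>
    ιMulti_ne_zero_of_linearIndependent (he.of_comp W.subtype) (congrArg Subtype.val h)
  obtain ⟨c, hc⟩ := (finrank_eq_one_iff_of_nonzero' _ he₀).1 hdim (exteriorPower.ιMulti K m v)
  have := congrArg (fun x => (exteriorPower.map m W.subtype x : ExteriorAlgebra K U)) hc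
  simp only [map_smul, exteriorPower.map_apply_ιMulti, Submodule.coe_smul,
    exteriorPower.ιMulti_apply_coe] at this
  exact ⟨c, this.symm⟩

theorem ιMulti_mul_ι {n : ℕ} (v : Fin n → U) (x : U) :
    ExteriorAlgebra.ιMulti K n v * ExteriorAlgebra.ι K x =
      ExteriorAlgebra.ιMulti K (n + 1) (Fin.snoc v x) := by
  have h : ExteriorAlgebra.ι K x = ExteriorAlgebra.ιMulti K 1 (fun _ => x) := by
    simp [ExteriorAlgebra.ιMulti_apply]
  rw [h, ExteriorAlgebra.ιMulti_mul_ιMulti]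
  congr 1
  rw [Fin.append_right_eq_snoc]

theorem span_range_coe_basis {W : Submodule K U} {α : Type*} (B : Module.Basis α K W) :
    Submodule.span K (Set.range fun j => (B j : U)) = W := by
  have := congrArg (Submodule.map W.subtype) B.span_eq
  rwa [Submodule.map_span, ← Set.range_comp, Submodule.map_top, Submodule.range_subtype] at this

theorem linearIndependent_coe_basis {W : Submodule K U} {α : Type*} (B : Module.Basis α K W) :
    LinearIndependent K fun j => (B j : U) :=
  B.linearIndependent.map' _ (Submodule.ker_subtype _)

/-- An orientation of the subspace `W`: the exterior product of a basis. -/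
def topForm (W : Submodule K U) [FiniteDimensional K W] : ExteriorAlgebra K U :=
  ExteriorAlgebra.ιMulti K (Module.finrank K W) fun j => (Module.finBasis K W j : U)

variable {W W' : Submodule K U} [FiniteDimensional K W] [FiniteDimensional K W']

variable (W) in
theorem topForm_ne_zero : topForm W ≠ 0 :=
  ιMulti_ne_zero_of_linearIndependent (linearIndependent_coe_basis _)

theorem topForm_mul_ι_eq_zero {z : U} (hz : z ∈ W) : topForm W * ExteriorAlgebra.ι K z = 0 := by
  rw [topForm, ιMulti_mul_ι]
  refine AlternatingMap.map_linearDependent _ _ fun hind => ?_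
  rw [linearIndependent_finSnoc, span_range_coe_basis] at hind
  exact hind.2 hz

theorem exists_topForm_mul_ι_eq_smul (h : W' ≤ W)
    (hrk : Module.finrank K W = Module.finrank K W' + 1) {x : U} (hx : x ∈ W) (hx' : x ∉ W') :
    ∃ c : K, c ≠ 0 ∧ topForm W' * ExteriorAlgebra.ι K x = c • topForm W := by
  let v : Fin (Module.finrank K W' + 1) → U := Fin.snoc (fun j => (Module.finBasis K W' j : U)) x
  have hv : LinearIndependent K v := by
    rw [linearIndependent_finSnoc, span_range_coe_basis]
    exact ⟨linearIndependent_coe_basis _, hx'⟩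
  have hvW (j) : v j ∈ W := by
    refine Fin.lastCases ?_ (fun j => ?_) j
    · simpa only [v, Fin.snoc_last] using hx
    · simpa only [v, Fin.snoc_castSucc] using h (Module.finBasis K W' j).2
  obtain ⟨c, hc⟩ := exists_ιMulti_eq_smul hrk rfl
    (linearIndependent_coe_basis (Module.finBasis K W)) (fun j => Subtype.prop _) hvW
  refine ⟨c, ?_, by rw [topForm, ιMulti_mul_ι, hc, topForm]⟩
  rintro rfl
  exact ιMulti_ne_zero_of_linearIndependent hv (by rw [hc, zero_smul])

end ExteriorProducts

section Arrangement

variable {V ι : Type*} [AddCommGroup V] [Module ℝ V]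
  (a : ι → V →ₗ[ℝ] ℝ) (b : ι → ℝ)

/-- The point `x` lies in the open cell labelled by `E`, the set of those `i` for which `a i`
attains at `x` the right end `b i` of the half-open strip `b i - 1 < a i x ≤ b i`. -/
def InCell (E : Finset ι) (x : V) : Prop :=
  (∀ i ∈ E, a i x = b i) ∧ ∀ i ∉ E, b i - 1 < a i x ∧ a i x < b i

/-- The cell labelled by `E` is non-empty. -/
def IsCell (E : Finset ι) : Prop := ∃ x, InCell a b E x

/-- The span of the functionals labelled by `E`. -/
def labelSpan (E : Finset ι) : Submodule ℝ (V →ₗ[ℝ] ℝ) :=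
  Submodule.span ℝ (a '' (E : Set ι))

/-- The rank of the functionals labelled by `E`, which is the codimension of the cell labelled by
`E` if that cell is non-empty. -/
def rk (E : Finset ι) : ℕ := Module.finrank ℝ (labelSpan a E)

/-- The vector `u` is the difference of a point of the cell labelled by `E'` and a point of its
face labelled by `E`, up to scaling. -/
structure PointsInto (E E' : Finset ι) (u : V) : Prop where
  eq_zero : ∀ i ∈ E', a i u = 0
  neg : ∀ i ∈ E, i ∉ E' → a i u < 0

theorem rk_empty : rk a ∅ = 0 := by
  rw [rk, labelSpan, Finset.coe_empty, Set.image_empty, Submodule.span_empty, finrank_bot]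

instance (E : Finset ι) : FiniteDimensional ℝ (labelSpan a E) :=
  FiniteDimensional.span_of_finite ℝ (E.finite_toSet.image a)

variable {a b} {E E' : Finset ι} {i : ι}

theorem mem_labelSpan (hi : i ∈ E) : a i ∈ labelSpan a E :=
  Submodule.subset_span ⟨i, hi, rfl⟩

theorem labelSpan_mono (h : E' ⊆ E) : labelSpan a E' ≤ labelSpan a E :=
  Submodule.span_mono (Set.image_mono (Finset.coe_subset.2 h))

theorem mem_dualCoannihilator_labelSpan {u : V} :
    u ∈ (labelSpan a E).dualCoannihilator ↔ ∀ i ∈ E, a i u = 0 := by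
  rw [← SetLike.mem_coe, labelSpan, Submodule.coe_dualCoannihilator_span]
  simp

theorem apply_eq_zero_of_mem_labelSpan {u : V} (hu : ∀ i ∈ E, a i u = 0)
    {z : V →ₗ[ℝ] ℝ} (hz : z ∈ labelSpan a E) : z u = 0 :=
  (Submodule.mem_dualCoannihilator _).1 (mem_dualCoannihilator_labelSpan.2 hu) z hz

theorem IsCell.exists_pointsInto (hE : IsCell a b E) (hE' : IsCell a b E') (h : E' ⊆ E) :
    ∃ u, PointsInto a E E' u := by
  obtain ⟨x, hx⟩ := hE
  obtain ⟨x', hx'⟩ := hE'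
  refine ⟨x' - x, fun i hi => ?_, fun i hi hi' => ?_⟩
  · rw [map_sub, hx.1 i (h hi), hx'.1 i hi, sub_self]
  · rw [map_sub, hx.1 i hi, sub_neg]
    exact (hx'.2 i hi').2

theorem exists_pos_forall_add_mul_lt {α : Type*} [Finite α] {p r : α → ℝ} (s : α → ℝ)
    (h : ∀ i, p i < r i) : ∃ ε > 0, ∀ i, p i + ε * s i < r i := by
  have hlim (i : α) : ∀ᶠ ε in nhdsWithin (0 : ℝ) (Set.Ioi 0), p i + ε * s i < r i := by
    have : Filter.Tendsto (fun ε : ℝ => p i + ε * s i) (nhds 0) (nhds (p i + 0 * s i)) :=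
      Continuous.tendsto (by fun_prop) 0
    exact (this.mono_left nhdsWithin_le_nhds).eventually (gt_mem_nhds (by simpa using h i))
  obtain ⟨ε, hε', hε⟩ := ((Filter.eventually_all.2 hlim).and self_mem_nhdsWithin).exists
  exact ⟨ε, hε, hε'⟩

theorem IsCell.of_pointsInto [Finite ι] (hE : IsCell a b E) {u : V} (hu : PointsInto a E E' u)
    (h : E' ⊆ E) : IsCell a b E' := by
  obtain ⟨x, hx⟩ := hE
  obtain ⟨ε, hε, hlt⟩ := exists_pos_forall_add_mul_lt (α := ι ⊕ {i // i ∉ E})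
    (p := Sum.elim (fun i => b i - 1) fun i => a i x) (r := Sum.elim (fun i => a i x) fun i => b i)
    (Sum.elim (fun i => -a i u) fun i => a i u) (by
      rintro (i | ⟨i, hi⟩)
      · by_cases hi : i ∈ E
        · simp [hx.1 i hi]
        · exact (hx.2 i hi).1
      · exact (hx.2 i hi).2)
  refine ⟨x + ε • u, fun i hi => ?_, fun i hi => ⟨?_, ?_⟩⟩ <;>
    rw [map_add, map_smul, smul_eq_mul]
  · rw [hu.eq_zero i hi, mul_zero, add_zero, hx.1 i (h hi)]
  · linarith [show b i - 1 + ε * -a i u < a i x from hlt (Sum.inl i)]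
  · by_cases hiE : i ∈ E
    · linarith [hx.1 i hiE, mul_neg_of_pos_of_neg hε (hu.neg i hiE hi)]
    · exact hlt (Sum.inr ⟨i, hiE⟩)

theorem IsCell.notMem_labelSpan (hE : IsCell a b E) (hE' : IsCell a b E') (h : E' ⊆ E)
    (hi : i ∈ E) (hi' : i ∉ E') : a i ∉ labelSpan a E' := fun hmem => by
  obtain ⟨u, hu⟩ := hE.exists_pointsInto hE' h
  exact (hu.neg i hi hi').ne (apply_eq_zero_of_mem_labelSpan hu.eq_zero hmem)

theorem rk_lt_of_notMem_labelSpan (h : E' ⊆ E) (hi : i ∈ E) (hi' : a i ∉ labelSpan a E') :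
    rk a E' < rk a E :=
  Submodule.finrank_lt_finrank_of_lt
    ((labelSpan_mono h).lt_of_ne fun heq => hi' (heq ▸ mem_labelSpan hi))

theorem IsCell.rk_lt (hE : IsCell a b E) (hE' : IsCell a b E') (h : E' ⊂ E) :
    rk a E' < rk a E := by
  obtain ⟨i, hi, hi'⟩ := Finset.exists_of_ssubset h
  exact rk_lt_of_notMem_labelSpan h.subset hi (hE.notMem_labelSpan hE' h.subset hi hi')

theorem exists_eq_smul_add (h : E' ⊆ E) (hrk : rk a E ≤ rk a E' + 1) (hi : i ∈ E)
    (hi' : a i ∉ labelSpan a E') {y : V →ₗ[ℝ] ℝ} (hy : y ∈ labelSpan a E) :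
    ∃ r : ℝ, ∃ z ∈ labelSpan a E', y = r • a i + z := by
  have hle : ℝ ∙ a i ⊔ labelSpan a E' ≤ labelSpan a E :=
    sup_le ((Submodule.span_singleton_le_iff_mem _ _).2 (mem_labelSpan hi)) (labelSpan_mono h)
  have hlt : labelSpan a E' < ℝ ∙ a i ⊔ labelSpan a E' :=
    right_lt_sup.2 fun hle' => hi' (hle' (Submodule.mem_span_singleton_self _))
  rw [← Submodule.eq_of_le_of_finrank_le hle
    (hrk.trans (Submodule.finrank_lt_finrank_of_lt hlt))] at hy
  obtain ⟨_, hy₁, z, hz, rfl⟩ := Submodule.mem_sup.1 hy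
  obtain ⟨r, rfl⟩ := Submodule.mem_span_singleton.1 hy₁
  exact ⟨r, z, hz, rfl⟩

variable (a b) in
/-- The cell labelled by `E` is a facet of the cell labelled by `E'`. -/
structure IsCover (E E' : Finset ι) : Prop where
  isCell_left : IsCell a b E
  isCell_right : IsCell a b E'
  subset : E' ⊆ E
  rk_eq : rk a E = rk a E' + 1

namespace IsCover

theorem ssubset (h : IsCover a b E E') : E' ⊂ E :=
  h.subset.ssubset_of_ne fun heq => by simpa [heq] using h.rk_eq

theorem exists_topForm_mul_ι (h : IsCover a b E E') (hi : i ∈ E) (hi' : i ∉ E') :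
    ∃ c : ℝ, c ≠ 0 ∧ topForm (labelSpan a E') * ExteriorAlgebra.ι ℝ (a i) =
      c • topForm (labelSpan a E) :=
  exists_topForm_mul_ι_eq_smul (labelSpan_mono h.subset) h.rk_eq (mem_labelSpan hi)
    (h.isCell_left.notMem_labelSpan h.isCell_right h.subset hi hi')

theorem exists_coefficient (h : IsCover a b E E') :
    ∃ c : ℝ, ∃ i ∈ E, i ∉ E' ∧ c ≠ 0 ∧
      topForm (labelSpan a E') * ExteriorAlgebra.ι ℝ (a i) = c • topForm (labelSpan a E) := by
  obtain ⟨i, hi, hi'⟩ := Finset.exists_of_ssubset h.ssubset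
  obtain ⟨c, hc⟩ := h.exists_topForm_mul_ι hi hi'
  exact ⟨c, i, hi, hi', hc⟩

end IsCover

variable (a b) in
/-- The incidence number of two cells: it compares the orientation of the smaller cell with the
one which the larger cell and its conormals induce, and it vanishes unless the first cell is a
facet of the second. -/
def inc (E E' : Finset ι) : ℤ :=
  open Classical in
  if h : IsCover a b E E' then SignType.sign h.exists_coefficient.choose else 0

theorem inc_of_not_isCover (h : ¬ IsCover a b E E') : inc a b E E' = 0 :=
  dif_neg h

namespace IsCover

theorem isUnit_inc (h : IsCover a b E E') : IsUnit (inc a b E E') := by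
  rw [inc, dif_pos h]
  obtain ⟨-, -, -, hc, -⟩ := h.exists_coefficient.choose_spec
  rcases hc.lt_or_gt with hc | hc <;> simp [hc]

/-- The incidence number can be computed from any of the conormals, because all of them take
negative values at a vector pointing into the larger cell. -/
theorem inc_eq (h : IsCover a b E E') (hi : i ∈ E) (hi' : i ∉ E') {c : ℝ}
    (hc : topForm (labelSpan a E') * ExteriorAlgebra.ι ℝ (a i) = c • topForm (labelSpan a E)) :
    inc a b E E' = SignType.sign c := by
  rw [inc, dif_pos h]
  obtain ⟨j, hj, hj', -, hc'⟩ := h.exists_coefficient.choose_spec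
  set c' := h.exists_coefficient.choose
  obtain ⟨r, z, hz, hr⟩ := exists_eq_smul_add h.subset h.rk_eq.le hj
    (h.isCell_left.notMem_labelSpan h.isCell_right h.subset hj hj') (mem_labelSpan hi)
  obtain ⟨u, hu⟩ := h.isCell_left.exists_pointsInto h.isCell_right h.subset
  have hru : a i u = r * a j u := by
    rw [hr, LinearMap.add_apply, apply_eq_zero_of_mem_labelSpan hu.eq_zero hz, add_zero,
      LinearMap.smul_apply, smul_eq_mul]
  have hr₀ : 0 < r := by
    have := hu.neg i hi hi'
    rw [hru] at this
    exact pos_of_mul_neg_left this (hu.neg j hj hj').le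
  have hcc : c = r * c' := by
    refine smul_left_injective ℝ (topForm_ne_zero (labelSpan a E)) ?_
    change c • topForm (labelSpan a E) = (r * c') • topForm (labelSpan a E)
    rw [← hc, hr, map_add, mul_add, topForm_mul_ι_eq_zero hz, add_zero, map_smul,
      mul_smul_comm, hc', smul_smul]
  rw [hcc, sign_mul, sign_pos hr₀, one_mul]

end IsCover

end Arrangement

/-! ### Pairs of cells of codimension two -/

section Coannihilators

variable {K V : Type*} [Field K] [AddCommGroup V] [Module K V] (W : Submodule K (Module.Dual K V))
  [FiniteDimensional K W]

instance : FiniteDimensional K (V ⧸ W.dualCoannihilator) :=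
  Subspace.finiteDimensional_quot_dualCoannihilator_iff.2 ‹_›

theorem finrank_quotient_dualCoannihilator :
    Module.finrank K (V ⧸ W.dualCoannihilator) = Module.finrank K W :=
  letI : AddCommGroup W := inferInstance
  (LinearEquiv.ofBijective _ (Subspace.quotDualCoannihilatorToDual_bijective W)).finrank_eq.trans
    Subspace.dual_finrank_eq

theorem finrank_map_mkQ_dualCoannihilator_add {W' : Submodule K (Module.Dual K V)}
    [FiniteDimensional K W'] (h : W' ≤ W) :
    Module.finrank K (W'.dualCoannihilator.map W.dualCoannihilator.mkQ) + Module.finrank K W' =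
      Module.finrank K W := by
  rw [← finrank_quotient_dualCoannihilator W, ← finrank_quotient_dualCoannihilator W', add_comm,
    ← (Submodule.quotientQuotientEquivQuotient _ _
      (Submodule.dualCoannihilator_anti h)).finrank_eq]
  exact Submodule.finrank_quotient_add_finrank _

end Coannihilators

section Diamond

variable {V ι : Type*} [AddCommGroup V] [Module ℝ V] {a : ι → V →ₗ[ℝ] ℝ} {b : ι → ℝ}
  {E E' G G' : Finset ι} {u v w : V}

variable (a) in
/-- The vectors on which the functionals labelled by `E'` vanish, modulo those on which the
functionals labelled by `E` vanish. -/
def relativeDirections (E E' : Finset ι) :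
    Submodule ℝ (V ⧸ (labelSpan a E).dualCoannihilator) :=
  (labelSpan a E').dualCoannihilator.map (Submodule.mkQ _)

theorem finrank_relativeDirections_add (h : E' ⊆ E) :
    Module.finrank ℝ (relativeDirections a E E') + rk a E' = rk a E :=
  finrank_map_mkQ_dualCoannihilator_add _ (labelSpan_mono h)

theorem mem_relativeDirections (hu : ∀ i ∈ E', a i u = 0) :
    Submodule.Quotient.mk u ∈ relativeDirections a E E' :=
  Submodule.mem_map_of_mem (mem_dualCoannihilator_labelSpan.2 hu)

theorem quotient_mk_eq_zero_iff (u : V) :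
    (Submodule.Quotient.mk u : V ⧸ (labelSpan a E).dualCoannihilator) = 0 ↔ ∀ i ∈ E, a i u = 0 :=
  (Submodule.Quotient.mk_eq_zero _).trans mem_dualCoannihilator_labelSpan

/-- Two independent elements of a two-dimensional space span it. -/
theorem exists_eq_smul_add_smul (h : E' ⊆ E) (hrk : rk a E ≤ rk a E' + 2)
    (hu : ∀ i ∈ E', a i u = 0) (hv : ∀ i ∈ E', a i v = 0) (hw : ∀ i ∈ E', a i w = 0)
    (huv : ∀ α β : ℝ, (∀ i ∈ E, a i (α • u + β • v) = 0) → α = 0 ∧ β = 0) :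
    ∃ α β : ℝ, ∀ i ∈ E, a i w = α * a i u + β * a i v := by
  have hle : Module.finrank ℝ (relativeDirections a E E') ≤ 2 := by
    have := finrank_relativeDirections_add (a := a) h
    omega
  let p : Fin 2 → relativeDirections a E E' :=
    ![⟨_, mem_relativeDirections hu⟩, ⟨_, mem_relativeDirections hv⟩]
  have hp : LinearIndependent ℝ p := by
    refine LinearIndependent.pair_iff.2 fun α β h0 => huv α β ?_
    exact (quotient_mk_eq_zero_iff _).1 (congrArg Subtype.val h0)
  have hspan : Submodule.span ℝ (Set.range p) = ⊤ :=
    hp.span_eq_top_of_card_eq_finrank' (by simpa using hp.fintype_card_le_finrank.antisymm hle)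
  have hmem : (⟨_, mem_relativeDirections hw⟩ : relativeDirections a E E') ∈
      Submodule.span ℝ (Set.range p) := hspan ▸ Submodule.mem_top
  rw [Matrix.range_cons, Matrix.range_cons, Matrix.range_empty, Set.union_empty,
    Set.singleton_union, Submodule.mem_span_pair] at hmem
  obtain ⟨α, β, hαβ⟩ := hmem
  have hwe := (quotient_mk_eq_zero_iff (α • u + β • v - w)).1
    (sub_eq_zero.2 (congrArg Subtype.val hαβ))
  refine ⟨α, β, fun i hi => ?_⟩
  rw [← sub_eq_zero, ← neg_eq_zero, ← hwe i hi]
  simp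

theorem exists_forall_ne_mul (h : E' ⊆ E) (hrk : rk a E' + 2 ≤ rk a E) (u : V) :
    ∃ v : V, (∀ i ∈ E', a i v = 0) ∧ ∀ r : ℝ, ∃ i ∈ E, a i v ≠ r * a i u := by
  by_contra! hcon
  have hle : relativeDirections a E E' ≤ ℝ ∙ Submodule.Quotient.mk u := by
    rintro _ ⟨v, hv, rfl⟩
    obtain ⟨r, hr⟩ := hcon v (mem_dualCoannihilator_labelSpan.1 hv)
    refine Submodule.mem_span_singleton.2 ⟨r, ?_⟩
    refine sub_eq_zero.1 ((quotient_mk_eq_zero_iff (r • u - v)).2 fun i hi => ?_)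
    rw [map_sub, map_smul, smul_eq_mul, hr i hi, sub_self]
  have := finrank_relativeDirections_add (a := a) h
  have := (Submodule.finrank_mono hle).trans (finrank_span_le_card _)
  simp only [Set.toFinset_singleton, Finset.card_singleton] at this
  omega

theorem IsCell.isCover_of_ssubset (hE : IsCell a b E) (hG : IsCell a b G) (hE' : IsCell a b E')
    (hrk : rk a E = rk a E' + 2) (hEG : G ⊂ E) (hGE' : E' ⊂ G) :
    IsCover a b E G ∧ IsCover a b G E' := by
  have := hE.rk_lt hG hEG
  have := hG.rk_lt hE' hGE'
  exact ⟨⟨hE, hG, hEG.subset, by omega⟩, ⟨hG, hE', hGE'.subset, by omega⟩⟩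

/-- The scalar is the smallest slope `a i v / a i u`. -/
theorem PointsInto.exists_sub_smul (hu : PointsInto a E E' u) (h : E' ⊆ E)
    (hv : ∀ i ∈ E', a i v = 0) (huv : ∀ r : ℝ, ∃ i ∈ E, a i v ≠ r * a i u) :
    ∃ (r : ℝ) (G : Finset ι), E' ⊂ G ∧ G ⊂ E ∧ PointsInto a E G (v - r • u) := by
  classical
  obtain ⟨i₀, hi₀, hne⟩ := huv 0
  have hi₀' : i₀ ∉ E' := fun hi => hne (by rw [hv i₀ hi, zero_mul])
  obtain ⟨j, hj, hmin⟩ := (E \ E').exists_min_image (fun i => a i v / a i u)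
    ⟨i₀, Finset.mem_sdiff.2 ⟨hi₀, hi₀'⟩⟩
  obtain ⟨hjE, hjE'⟩ := Finset.mem_sdiff.1 hj
  set r := a j v / a j u
  have hle : ∀ i ∈ E, a i (v - r • u) ≤ 0 := fun i hi => by
    rw [map_sub, map_smul, smul_eq_mul, sub_nonpos]
    by_cases hi' : i ∈ E'
    · simp [hv i hi', hu.eq_zero i hi']
    · exact (le_div_iff_of_neg (hu.neg i hi hi')).1 (hmin i (Finset.mem_sdiff.2 ⟨hi, hi'⟩))
  refine ⟨r, {i ∈ E | a i (v - r • u) = 0}, ?_, ?_, fun i hi => (Finset.mem_filter.1 hi).2,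
    fun i hi hi' => (hle i hi).lt_of_ne fun h0 => hi' (Finset.mem_filter.2 ⟨hi, h0⟩)⟩
  · refine (Finset.ssubset_iff_of_subset fun i hi => ?_).2 ⟨j, Finset.mem_filter.2 ⟨hjE, ?_⟩, hjE'⟩
    · simp [h hi, hv i hi, hu.eq_zero i hi]
    · rw [map_sub, map_smul, smul_eq_mul, div_mul_cancel₀ _ (hu.neg j hjE hjE').ne, sub_self]
  · obtain ⟨i, hi, hir⟩ := huv r
    exact Finset.filter_ssubset.2 ⟨i, hi, by simpa [sub_eq_zero] using hir⟩

theorem PointsInto.eq_of_eq_mul_add (hu : PointsInto a E E' u) (hv : PointsInto a E G v)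
    (hw : PointsInto a E G' w) (hG : E' ⊂ G) (hGE : G ⊆ E) (hG' : E' ⊂ G') (hGE' : G' ⊆ E)
    {α β : ℝ} (hβ : 0 < β) (h : ∀ i ∈ E, a i w = α * a i u + β * a i v) : G' = G := by
  have hv_nonpos : ∀ i ∈ E, a i v ≤ 0 := fun i hi => by
    by_cases hi' : i ∈ G
    · exact (hv.eq_zero i hi').le
    · exact (hv.neg i hi hi').le
  have hw_nonpos : ∀ i ∈ E, a i w ≤ 0 := fun i hi => by
    by_cases hi' : i ∈ G'
    · exact (hw.eq_zero i hi').le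
    · exact (hw.neg i hi hi').le
  obtain ⟨i, hi, hiE'⟩ := Finset.exists_of_ssubset hG
  obtain ⟨j, hj, hjE'⟩ := Finset.exists_of_ssubset hG'
  have hα : α = 0 := by
    have h₁ := h i (hGE hi)
    have h₂ := h j (hGE' hj)
    rw [hv.eq_zero i hi] at h₁
    rw [hw.eq_zero j hj] at h₂
    nlinarith [hu.neg i (hGE hi) hiE', hu.neg j (hGE' hj) hjE', hv_nonpos j (hGE' hj),
      hw_nonpos i (hGE hi)]
  have hmem (i : ι) (hi : i ∈ E) : i ∈ G' ↔ i ∈ G := by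
    have hi₁ : i ∈ G ↔ a i v = 0 := ⟨hv.eq_zero i, not_imp_not.1 fun hn => (hv.neg i hi hn).ne⟩
    have hi₂ : i ∈ G' ↔ a i w = 0 := ⟨hw.eq_zero i, not_imp_not.1 fun hn => (hw.neg i hi hn).ne⟩
    rw [hi₁, hi₂, h i hi, hα, zero_mul, zero_add, mul_eq_zero, or_iff_right hβ.ne']
  exact Finset.ext fun i => ⟨fun hi => (hmem i (hGE' hi)).1 hi, fun hi => (hmem i (hGE hi)).2 hi⟩

theorem PointsInto.mem_of_mem_of_mem {E₁ E₂ : Finset ι} (hu : PointsInto a E E' u) {r s : ℝ}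
    (h₁ : PointsInto a E E₁ (v - r • u)) (h₂ : PointsInto a E E₂ (-v - s • u)) (hE₁ : E₁ ⊂ E)
    {i : ι} (hi₁ : i ∈ E₁) (hi₂ : i ∈ E₂) : i ∈ E' := by
  by_contra hi
  have hs : s = -r := by
    have e₁ := h₁.eq_zero i hi₁
    have e₂ := h₂.eq_zero i hi₂
    simp only [map_sub, map_neg, map_smul, smul_eq_mul] at e₁ e₂
    exact mul_right_cancel₀ (hu.neg i (hE₁.subset hi₁) hi).ne (by linarith)
  have hv : -v - s • u = -(v - r • u) := by rw [hs]; module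
  obtain ⟨j, hj, hj₁⟩ := Finset.exists_of_ssubset hE₁
  have hneg := h₁.neg j hj hj₁
  rw [hv] at h₂
  by_cases hj₂ : j ∈ E₂
  · exact hneg.ne (neg_eq_zero.1 ((map_neg (a j) _).symm.trans (h₂.eq_zero j hj₂)))
  · have := h₂.neg j hj hj₂
    rw [map_neg] at this
    linarith

theorem PointsInto.eq_zero_of_smul_add_smul (hu : PointsInto a E E' u) (hE : E' ⊂ E)
    (huv : ∀ r : ℝ, ∃ i ∈ E, a i v ≠ r * a i u) {α β : ℝ}
    (h0 : ∀ i ∈ E, a i (α • u + β • v) = 0) : α = 0 ∧ β = 0 := by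
  simp only [map_add, map_smul, smul_eq_mul] at h0
  have hβ : β = 0 := by
    by_contra hβ
    obtain ⟨i, hi, hne⟩ := huv (-(α / β))
    refine hne (mul_left_cancel₀ hβ ?_)
    rw [← mul_assoc, mul_neg, mul_div_cancel₀ _ hβ]
    linarith [h0 i hi]
  obtain ⟨i, hi, hi'⟩ := Finset.exists_of_ssubset hE
  have := h0 i hi
  rw [hβ, zero_mul, add_zero] at this
  exact ⟨(mul_eq_zero.1 this).resolve_right (hu.neg i hi hi').ne, hβ⟩

/-- Between two cells whose codimensions differ by two there are exactly two cells: they belong to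
the smallest and to the largest slope `a i v / a i u`. -/
theorem IsCell.exists_diamond [Finite ι] (hE : IsCell a b E) (hE' : IsCell a b E') (h : E' ⊆ E)
    (hrk : rk a E = rk a E' + 2) :
    ∃ E₁ E₂ : Finset ι, IsCover a b E E₁ ∧ IsCover a b E₁ E' ∧ IsCover a b E E₂ ∧
      IsCover a b E₂ E' ∧ (∀ i ∈ E₁, i ∈ E₂ → i ∈ E') ∧
      ∀ G, IsCover a b E G → IsCover a b G E' → G = E₁ ∨ G = E₂ := by
  obtain ⟨u, hu⟩ := hE.exists_pointsInto hE' h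
  obtain ⟨v, hv, huv⟩ := exists_forall_ne_mul h hrk.ge u
  obtain ⟨r, E₁, hE₁, hE₁E, hv₁⟩ := hu.exists_sub_smul h hv huv
  obtain ⟨s, E₂, hE₂, hE₂E, hv₂⟩ := hu.exists_sub_smul (v := -v) h
    (fun i hi => by rw [map_neg, hv i hi, neg_zero]) fun r => by
      obtain ⟨i, hi, hne⟩ := huv (-r)
      exact ⟨i, hi, fun heq => hne (by rw [neg_mul, ← heq, map_neg, neg_neg])⟩
  obtain ⟨h₁, h₁'⟩ := hE.isCover_of_ssubset (hE.of_pointsInto hv₁ hE₁E.subset) hE' hrk hE₁E hE₁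
  obtain ⟨h₂, h₂'⟩ := hE.isCover_of_ssubset (hE.of_pointsInto hv₂ hE₂E.subset) hE' hrk hE₂E hE₂
  refine ⟨E₁, E₂, h₁, h₁', h₂, h₂', fun i => hu.mem_of_mem_of_mem hv₁ hv₂ hE₁E,
    fun G hG hG' => ?_⟩
  obtain ⟨w, hw⟩ := hG.isCell_left.exists_pointsInto hG.isCell_right hG.subset
  obtain ⟨α, β, hαβ⟩ := exists_eq_smul_add_smul h hrk.le hu.eq_zero hv
    (fun i hi => hw.eq_zero i (hG'.subset hi))
    fun α β => hu.eq_zero_of_smul_add_smul (hE₁.trans hE₁E) huv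
  rcases lt_trichotomy β 0 with hβ | hβ | hβ
  · refine .inr (hu.eq_of_eq_mul_add hv₂ hw hE₂ hE₂E.subset hG'.ssubset hG.subset
      (α := α - β * s) (neg_pos.2 hβ) fun i hi => ?_)
    rw [hαβ i hi, map_sub, map_neg, map_smul, smul_eq_mul]
    ring
  · simp only [hβ, zero_mul, add_zero] at hαβ
    obtain ⟨i, hi, hi'⟩ := Finset.exists_of_ssubset hG.ssubset
    obtain ⟨j, hj, hj'⟩ := Finset.exists_of_ssubset hG'.ssubset
    have hα : α = 0 := (mul_eq_zero.1 ((hαβ j (hG.subset hj)).symm.trans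
      (hw.eq_zero j hj))).resolve_right (hu.neg j (hG.subset hj) hj').ne
    exact absurd (hαβ i hi) (by rw [hα, zero_mul]; exact (hw.neg i hi hi').ne)
  · refine .inl (hu.eq_of_eq_mul_add hv₁ hw hE₁ hE₁E.subset hG'.ssubset hG.subset
      (α := α + β * r) hβ fun i hi => ?_)
    rw [hαβ i hi, map_sub, map_smul, smul_eq_mul]
    ring

theorem inc_mul_inc_add_eq_zero {E₁ E₂ : Finset ι} (h₁ : IsCover a b E E₁)
    (h₁' : IsCover a b E₁ E') (h₂ : IsCover a b E E₂) (h₂' : IsCover a b E₂ E')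
    (h : ∀ i ∈ E₁, i ∈ E₂ → i ∈ E') :
    inc a b E E₁ * inc a b E₁ E' + inc a b E E₂ * inc a b E₂ E' = 0 := by
  obtain ⟨i₁, hi₁, hi₁'⟩ := Finset.exists_of_ssubset h₁'.ssubset
  obtain ⟨i₂, hi₂, hi₂'⟩ := Finset.exists_of_ssubset h₂'.ssubset
  have hi₁₂ : i₁ ∉ E₂ := fun hi => hi₁' (h i₁ hi₁ hi)
  have hi₂₁ : i₂ ∉ E₁ := fun hi => hi₂' (h i₂ hi hi₂)
  obtain ⟨c₁, -, hc₁⟩ := h₁'.exists_topForm_mul_ι hi₁ hi₁'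
  obtain ⟨c₂, -, hc₂⟩ := h₁.exists_topForm_mul_ι (h₂.subset hi₂) hi₂₁
  obtain ⟨c₃, -, hc₃⟩ := h₂'.exists_topForm_mul_ι hi₂ hi₂'
  obtain ⟨c₄, -, hc₄⟩ := h₂.exists_topForm_mul_ι (h₁.subset hi₁) hi₁₂
  have hswap : (c₁ * c₂ + c₃ * c₄) • topForm (labelSpan a E) = 0 := by
    have := congrArg (topForm (labelSpan a E') * ·)
      (ExteriorAlgebra.ι_add_mul_swap (R := ℝ) (a i₁) (a i₂))
    simpa only [mul_add, mul_zero, ← mul_assoc, hc₁, hc₃, smul_mul_assoc, hc₂, hc₄, smul_smul,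
      ← add_smul] using this
  have hneg : c₂ * c₁ = -(c₄ * c₃) := by
    linarith [(smul_eq_zero.1 hswap).resolve_right (topForm_ne_zero _)]
  rw [h₁.inc_eq (h₂.subset hi₂) hi₂₁ hc₂, h₁'.inc_eq hi₁ hi₁' hc₁,
    h₂.inc_eq (h₁.subset hi₁) hi₁₂ hc₄, h₂'.inc_eq hi₂ hi₂' hc₃, ← SignType.coe_mul,
    ← SignType.coe_mul, ← sign_mul, ← sign_mul, hneg, Left.sign_neg, SignType.coe_neg,
    neg_add_cancel]

theorem sum_inc_mul_inc [Fintype ι] (E E' : Finset ι) :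
    ∑ G : Finset ι, inc a b E G * inc a b G E' = 0 := by
  classical
  have hzero (G : Finset ι) (hG : IsCover a b E G → ¬ IsCover a b G E') :
      inc a b E G * inc a b G E' = 0 := by
    by_cases hEG : IsCover a b E G
    · rw [inc_of_not_isCover (hG hEG), mul_zero]
    · rw [inc_of_not_isCover hEG, zero_mul]
  by_cases hex : ∃ G, IsCover a b E G ∧ IsCover a b G E'
  · obtain ⟨G, hG, hG'⟩ := hex
    obtain ⟨E₁, E₂, h₁, h₁', h₂, h₂', hdisj, huniq⟩ := hG.isCell_left.exists_diamond
      hG'.isCell_right (hG'.subset.trans hG.subset) (by rw [hG.rk_eq, hG'.rk_eq])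
    have hne : E₁ ≠ E₂ := by
      rintro rfl
      exact h₁'.ssubset.not_subset fun i hi => hdisj i hi hi
    rw [← Finset.sum_subset (Finset.subset_univ {E₁, E₂}), Finset.sum_pair hne]
    · exact inc_mul_inc_add_eq_zero h₁ h₁' h₂ h₂' hdisj
    · exact fun G _ hG => hzero G fun h h' => hG (by simpa using huniq G h h')
  · exact Finset.sum_eq_zero fun G _ => hzero G fun h h' => hex ⟨G, h, h'⟩

end Diamond

/-! ### Acyclicity of the visible cells -/

section AcyclicMatrices

variable {α k : Type*} [CommRing k]

/-- The square submatrix of `D` with index set `T` is exact as an endomorphism: every vector which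
it annihilates lies in its range. -/
def IsAcyclicOn (D : α → α → k) (T : Finset α) : Prop :=
  ∀ z : α → k, (∀ i ∈ T, ∑ j ∈ T, D i j * z j = 0) →
    ∃ y : α → k, ∀ i ∈ T, ∑ j ∈ T, D i j * y j = z i

variable {D : α → α → k}

theorem IsAcyclicOn.union [DecidableEq α] {T₁ T₂ : Finset α} (h₁ : IsAcyclicOn D T₁)
    (h₂ : IsAcyclicOn D T₂) (hdisj : Disjoint T₁ T₂) (hzero : ∀ i ∈ T₂, ∀ j ∈ T₁, D i j = 0)
    (hsq : ∀ i ∈ T₁, ∀ l ∈ T₂, ∑ j ∈ T₁ ∪ T₂, D i j * D j l = 0) :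
    IsAcyclicOn D (T₁ ∪ T₂) := by
  have hlower (z : α → k) {i : α} (hi : i ∈ T₂) : ∑ j ∈ T₁, D i j * z j = 0 :=
    Finset.sum_eq_zero fun j hj => by rw [hzero i hi j hj, zero_mul]
  simp only [IsAcyclicOn, Finset.sum_union hdisj] at hsq ⊢
  intro z hz
  obtain ⟨y₂, hy₂⟩ := h₂ z fun i hi => by
    simpa only [hlower z hi, zero_add] using hz i (Finset.mem_union_right _ hi)
  obtain ⟨y₁, hy₁⟩ := h₁ (fun j => z j - ∑ l ∈ T₂, D j l * y₂ l) fun i hi => by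
    have hcomm : ∑ j ∈ T₁, D i j * ∑ l ∈ T₂, D j l * y₂ l =
        -∑ j ∈ T₂, D i j * ∑ l ∈ T₂, D j l * y₂ l := by
      simp only [Finset.mul_sum, ← mul_assoc]
      rw [eq_neg_iff_add_eq_zero, Finset.sum_comm (s := T₁), Finset.sum_comm (s := T₂) (t := T₂),
        ← Finset.sum_add_distrib]
      refine Finset.sum_eq_zero fun l hl => ?_
      rw [← Finset.sum_mul, ← Finset.sum_mul, ← add_mul, hsq i hi l hl, zero_mul]
    simp only [mul_sub, Finset.sum_sub_distrib]
    rw [hcomm, sub_neg_eq_add, ← hz i (Finset.mem_union_left _ hi)]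
    exact congrArg (_ + ·) (Finset.sum_congr rfl fun j hj => by rw [hy₂ j hj])
  have hy₁_sum (i : α) : ∑ j ∈ T₁, D i j * T₁.piecewise y₁ y₂ j = ∑ j ∈ T₁, D i j * y₁ j :=
    Finset.sum_congr rfl fun j hj => by rw [Finset.piecewise_eq_of_mem _ _ _ hj]
  have hy₂_sum (i : α) : ∑ j ∈ T₂, D i j * T₁.piecewise y₁ y₂ j = ∑ j ∈ T₂, D i j * y₂ j :=
    Finset.sum_congr rfl fun j hj => by
      rw [Finset.piecewise_eq_of_notMem _ _ _ (Finset.disjoint_right.1 hdisj hj)]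
  refine ⟨T₁.piecewise y₁ y₂, fun i hi => ?_⟩
  rw [hy₁_sum, hy₂_sum]
  rcases Finset.mem_union.1 hi with hi | hi
  · rw [hy₁ i hi, sub_add_cancel]
  · rw [hlower y₁ hi, hy₂ i hi, zero_add]

theorem isAcyclicOn_pair [DecidableEq α] {i j : α} (hij : i ≠ j) (hii : D i i = 0) (hji : D j i = 0)
    (hjj : D j j = 0) (hunit : IsUnit (D i j)) : IsAcyclicOn D {i, j} := by
  obtain ⟨u, hu⟩ := hunit
  intro z hz
  have hzj : z j = 0 := by
    have := hz i (by simp)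
    rwa [Finset.sum_pair hij, hii, zero_mul, zero_add, ← hu, Units.mul_right_eq_zero] at this
  refine ⟨fun _ => ↑u⁻¹ * z i, fun l hl => ?_⟩
  rw [Finset.sum_pair hij]
  obtain rfl | rfl : l = i ∨ l = j := by simpa using hl
  · rw [hii, zero_mul, zero_add, ← hu, Units.mul_inv_cancel_left]
  · rw [hji, hjj, zero_mul, zero_add, hzj]

theorem IsAcyclicOn.exists_sum_univ_eq [Fintype α] {T : Finset α} (h : IsAcyclicOn D T)
    (hT : ∀ j ∈ T, ∀ i ∉ T, D i j = 0) {z : α → k} (hz : ∀ i ∉ T, z i = 0)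
    (hDz : ∀ i, ∑ j, D i j * z j = 0) :
    ∃ y : α → k, (∀ i ∉ T, y i = 0) ∧ ∀ i, ∑ j, D i j * y j = z i := by
  classical
  have hsum {y : α → k} (hy : ∀ i ∉ T, y i = 0) (i : α) :
      ∑ j, D i j * y j = ∑ j ∈ T, D i j * y j :=
    (Finset.sum_subset (Finset.subset_univ T) fun j _ hj => by rw [hy j hj, mul_zero]).symm
  obtain ⟨y, hy⟩ := h z fun i _ => by rw [← hsum hz, hDz]
  have hy₀ : ∀ i ∉ T, T.piecewise y 0 i = 0 := fun i hi => Finset.piecewise_eq_of_notMem _ _ _ hi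
  refine ⟨T.piecewise y 0, hy₀, fun i => ?_⟩
  rw [hsum hy₀]
  by_cases hi : i ∈ T
  · rw [← hy i hi]
    exact Finset.sum_congr rfl fun j hj => by rw [Finset.piecewise_eq_of_mem _ _ _ hj]
  · rw [hz i hi]
    exact Finset.sum_eq_zero fun j hj => by rw [hT j hj i hi, zero_mul]

end AcyclicMatrices

section Visibility

variable {V ι : Type*} [AddCommGroup V] [Module ℝ V] (a : ι → V →ₗ[ℝ] ℝ) (b : ι → ℝ)

/-- The point `q` lies on the hyperplanes `a i = b i` for `i ∈ E`, beyond those for `i ∈ F`, and in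
the open strips of all the others. The faces of the cell labelled by `E` which are visible from `q`
are then those whose labels lie between `E` and `E ∪ F`. -/
structure IsBeyond (E F : Finset ι) (q : V) : Prop where
  eq : ∀ i ∈ E, a i q = b i
  lt : ∀ i ∈ F, b i < a i q
  strip : ∀ i ∉ E, i ∉ F → b i - 1 < a i q ∧ a i q < b i

/-- The parameter at which the line from `p` to `q` meets the hyperplane `a i = b i`. -/
def crossing (p q : V) (i : ι) : ℝ := (b i - a i p) / (a i q - a i p)

open Classical in
/-- The labels between `E` and `E'` of non-empty cells. -/
def cellInterval (E E' : Finset ι) : Finset (Finset ι) := (Finset.Icc E E').filter (IsCell a b)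

variable {a b} {E F G F' T : Finset ι} {p q x u : V} {i j : ι}

theorem mem_cellInterval :
    T ∈ cellInterval a b E F ↔ IsCell a b T ∧ E ⊆ T ∧ T ⊆ F := by
  classical
  rw [cellInterval, Finset.mem_filter, Finset.mem_Icc, and_comm]

theorem cellInterval_self (hE : IsCell a b E) : cellInterval a b E E = {E} := by
  ext T
  rw [mem_cellInterval, Finset.mem_singleton]
  exact ⟨fun h => h.2.2.antisymm h.2.1, fun h => by rw [h]; exact ⟨hE, subset_rfl, subset_rfl⟩⟩

theorem IsBeyond.notMem (hq : IsBeyond a b E F q) (hi : i ∈ F) : i ∉ E := fun hiE =>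
  (hq.lt i hi).ne' (hq.eq i hiE)

theorem IsBeyond.isCell_of_mem [Finite ι] [DecidableEq ι] (hq : IsBeyond a b E F q)
    (hT : T ∈ cellInterval a b E (E ∪ F)) : IsCell a b E := by
  obtain ⟨⟨x, hx⟩, hET, hTF⟩ := mem_cellInterval.1 hT
  refine IsCell.of_pointsInto ⟨x, hx⟩ (u := x - q) ⟨fun i hi => ?_, fun i hi hi' => ?_⟩ hET
  · rw [map_sub, hx.1 i (hET hi), hq.eq i hi, sub_self]
  · rw [map_sub, hx.1 i hi, sub_neg]
    exact hq.lt i ((Finset.mem_union.1 (hTF hi)).resolve_left hi')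

theorem apply_lineMap_eq (t : ℝ) :
    a i (AffineMap.lineMap p q t) = (1 - t) * a i p + t * a i q := by
  rw [AffineMap.lineMap_apply_module, map_add, map_smul, map_smul, smul_eq_mul, smul_eq_mul]

theorem apply_lineMap_sub_eq (h : a i p ≠ a i q) (t : ℝ) :
    a i (AffineMap.lineMap p q t) - b i = (t - crossing a b p q i) * (a i q - a i p) := by
  have hne := sub_ne_zero.2 h.symm
  rw [apply_lineMap_eq, crossing]
  field_simp
  ring

theorem InCell.lt_of_isBeyond (hp : InCell a b E p) (hq : IsBeyond a b E F q) (hi : i ∈ F) :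
    a i p < a i q :=
  (hp.2 i (hq.notMem hi)).2.trans (hq.lt i hi)

theorem InCell.crossing_mem_Ioo (hp : InCell a b E p) (hq : IsBeyond a b E F q) (hi : i ∈ F) :
    crossing a b p q i ∈ Set.Ioo 0 1 := by
  have hpq := sub_pos.2 (hp.lt_of_isBeyond hq hi)
  exact ⟨div_pos (sub_pos.2 (hp.2 i (hq.notMem hi)).2) hpq,
    (div_lt_one hpq).2 (sub_lt_sub_right (hq.lt i hi) _)⟩

theorem InCell.sub_mul_sub_eq_of_crossing_eq (hp : InCell a b E p) (hq : IsBeyond a b E F q)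
    (hi : i ∈ F) (hj : j ∈ F) (h : crossing a b p q i = crossing a b p q j) :
    (b i - a i p) * (a j q - b j) = (b j - a j p) * (a i q - b i) := by
  rw [crossing, crossing, div_eq_div_iff (sub_pos.2 (hp.lt_of_isBeyond hq hi)).ne'
    (sub_pos.2 (hp.lt_of_isBeyond hq hj)).ne'] at h
  linarith

theorem InCell.isBeyond_lineMap [DecidableEq ι] (hp : InCell a b E p) (hq : IsBeyond a b E F q)
    {t : ℝ} (ht : t ∈ Set.Ioo 0 1) :
    IsBeyond a b (E ∪ F.filter fun i => crossing a b p q i = t)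
      (F.filter fun i => crossing a b p q i < t) (AffineMap.lineMap p q t) := by
  have hF {i : ι} (hi : i ∈ F) := apply_lineMap_sub_eq (b := b) (hp.lt_of_isBeyond hq hi).ne t
  have hpos {i : ι} (hi : i ∈ F) := sub_pos.2 (hp.lt_of_isBeyond hq hi)
  obtain ⟨ht₀, ht₁⟩ := ht
  refine ⟨fun i hi => ?_, fun i hi => ?_, fun i hi hi' => ?_⟩
  · rcases Finset.mem_union.1 hi with hi | hi
    · rw [apply_lineMap_eq, hp.1 i hi, hq.eq i hi]
      ring
    · obtain ⟨hi, hit⟩ := Finset.mem_filter.1 hi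
      rw [← sub_eq_zero, hF hi, hit, sub_self, zero_mul]
  · obtain ⟨hi, hit⟩ := Finset.mem_filter.1 hi
    rw [← sub_pos, hF hi]
    exact mul_pos (sub_pos.2 hit) (hpos hi)
  · rw [Finset.mem_union, not_or] at hi
    obtain ⟨hlow, hup⟩ := hp.2 i hi.1
    by_cases hiF : i ∈ F
    · have hti : t < crossing a b p q i :=
        (not_lt.1 fun h => hi' (Finset.mem_filter.2 ⟨hiF, h⟩)).lt_of_ne fun h =>
          hi.2 (Finset.mem_filter.2 ⟨hiF, h.symm⟩)
      refine ⟨?_, sub_neg.1 (hF hiF ▸ mul_neg_of_neg_of_pos (sub_neg.2 hti) (hpos hiF))⟩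
      rw [apply_lineMap_eq]
      nlinarith [hq.lt i hiF]
    · obtain ⟨hlow', hup'⟩ := hq.strip i hi.1 hiF
      rw [apply_lineMap_eq]
      constructor <;> nlinarith

theorem exists_apply_ne_zero_of_notMem_labelSpan {z : V →ₗ[ℝ] ℝ} (hz : z ∉ labelSpan a E) :
    ∃ u ∈ (labelSpan a E).dualCoannihilator, z u ≠ 0 := by
  contrapose! hz
  rw [labelSpan, Set.image_eq_range]
  refine mem_span_of_iInf_ker_le_ker fun u hu => hz u (mem_dualCoannihilator_labelSpan.2 ?_)
  simpa using hu

theorem InCell.infinite_setOf_add_smul [Finite ι] (hx : InCell a b E x)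
    (hu : ∀ i ∈ E, a i u = 0) : {ε : ℝ | InCell a b E (x + ε • u)}.Infinite := by
  refine infinite_of_mem_nhds 0 ?_
  have hcont (i : ι) : Filter.Tendsto (fun ε : ℝ => a i (x + ε • u)) (nhds 0) (nhds (a i x)) := by
    simp only [map_add, map_smul, smul_eq_mul]
    exact Continuous.tendsto' (by fun_prop) _ _ (by simp)
  have hstrip : ∀ᶠ ε in nhds (0 : ℝ), ∀ i, i ∉ E →
      b i - 1 < a i (x + ε • u) ∧ a i (x + ε • u) < b i :=
    Filter.eventually_all.2 fun i => Filter.eventually_imp_distrib_left.2 fun hi =>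
      ((hcont i).eventually_const_lt (hx.2 i hi).1).and
        ((hcont i).eventually_lt_const (hx.2 i hi).2)
  filter_upwards [hstrip] with ε hε
  exact ⟨fun i hi => by rw [map_add, map_smul, hu i hi, smul_zero, add_zero, hx.1 i hi], hε⟩

/-- For a generic point `p` of a cell, hyperplanes which the segment from `p` to `q` crosses
simultaneously meet the affine span of the cell in the same subspace. -/
theorem IsCell.exists_generic [Finite ι] (hE : IsCell a b E) (q : V) :
    ∃ p, InCell a b E p ∧ ∀ i j,
      (b i - a i p) * (a j q - b j) = (b j - a j p) * (a i q - b i) →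
        (a j q - b j) • a i - (a i q - b i) • a j ∈ labelSpan a E := by
  obtain ⟨x, hx⟩ := hE
  let f (i j : ι) : V →ₗ[ℝ] ℝ := (a j q - b j) • a i - (a i q - b i) • a j
  obtain ⟨u, hu, hne⟩ := Module.Dual.exists_forall_mem_ne_zero_of_forall_exists
    (labelSpan a E).dualCoannihilator (fun l : {l : ι × ι // f l.1 l.2 ∉ labelSpan a E} =>
      f l.1.1 l.1.2) fun l => exists_apply_ne_zero_of_notMem_labelSpan l.2
  obtain ⟨ε, hε, havoid⟩ := (hx.infinite_setOf_add_smul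
    (mem_dualCoannihilator_labelSpan.1 hu)).exists_notMem_finite
    (Set.finite_range fun l : ι × ι =>
      ((b l.1 - a l.1 x) * (a l.2 q - b l.2) - (b l.2 - a l.2 x) * (a l.1 q - b l.1)) /
        f l.1 l.2 u)
  refine ⟨x + ε • u, hε, fun i j hij => ?_⟩
  by_contra hmem
  refine havoid ⟨(i, j), ?_⟩
  rw [div_eq_iff (hne ⟨(i, j), hmem⟩)]
  simp only [f, map_add, map_smul, smul_eq_mul, LinearMap.sub_apply, LinearMap.smul_apply] at hij ⊢
  linarith

theorem InCell.mem_of_mem (hx : InCell a b T x) (hp : InCell a b E p) (hET : E ⊆ T)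
    (hi : i ∈ T) (hiq : a i q ≠ b i)
    (hij : (b i - a i p) * (a j q - b j) = (b j - a j p) * (a i q - b i))
    (hmem : (a j q - b j) • a i - (a i q - b i) • a j ∈ labelSpan a E) : j ∈ T := by
  have h₀ : (a j q - b j) * (a i x - a i p) - (a i q - b i) * (a j x - a j p) = 0 := by
    have := apply_eq_zero_of_mem_labelSpan (u := x - p)
      (fun l hl => by rw [map_sub, hx.1 l (hET hl), hp.1 l hl, sub_self]) hmem
    simpa using this
  rw [hx.1 i hi] at h₀
  have hjx : (a i q - b i) * (b j - a j x) = 0 := by linarith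
  by_contra hj
  exact (hx.2 j hj).2.ne
    (sub_eq_zero.1 ((mul_eq_zero.1 hjx).resolve_left (sub_ne_zero.2 hiq))).symm

theorem rk_union_le_add_one [DecidableEq ι] (hiq : a i q ≠ b i)
    (h : ∀ j ∈ G, (a i q - b i) • a j - (a j q - b j) • a i ∈ labelSpan a E) :
    rk a (E ∪ G) ≤ rk a E + 1 := by
  have hle : labelSpan a (E ∪ G) ≤ labelSpan a E ⊔ ℝ ∙ a i := by
    rw [labelSpan, Submodule.span_le]
    rintro _ ⟨j, hj, rfl⟩
    rcases Finset.mem_union.1 hj with hj | hj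
    · exact Submodule.mem_sup_left (mem_labelSpan hj)
    · refine (Submodule.smul_mem_iff _ (sub_ne_zero.2 hiq)).1 ?_
      rw [← sub_add_cancel ((a i q - b i) • a j) ((a j q - b j) • a i)]
      exact Submodule.add_mem_sup (h j hj)
        (Submodule.smul_mem _ _ (Submodule.mem_span_singleton_self _))
  calc rk a (E ∪ G) ≤ Module.finrank ℝ ↥(labelSpan a E ⊔ ℝ ∙ a i) := Submodule.finrank_mono hle
    _ ≤ rk a E + Module.finrank ℝ (ℝ ∙ a i) :=
      Submodule.finrank_add_le_finrank_add_finrank _ _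
    _ ≤ rk a E + 1 := by
      have := finrank_span_le_card (R := ℝ) {a i}
      simpa using this

theorem exists_mem_Ioo_forall_lt_of_lt {r : ι → ℝ} {t : ℝ} (ht : 0 < t) (F : Finset ι) :
    ∃ t' ∈ Set.Ioo 0 t, ∀ i ∈ F, r i < t → r i < t' := by
  have hlt : ∀ᶠ t' in nhdsWithin t (Set.Iio t), ∀ i ∈ F, r i < t → r i < t' :=
    (Finset.eventually_all F).2 fun i _ => Filter.eventually_imp_distrib_left.2 fun hi =>
      nhdsWithin_le_nhds (eventually_gt_nhds hi)
  obtain ⟨t', hF, ht'⟩ := (hlt.and (Ioo_mem_nhdsLT ht)).exists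
  exact ⟨t', ht', hF⟩

/-- Among the hyperplanes which separate `q` from a generic point `p` of the cell, let `G` be those
met last on the way from `p` to `q`. The witnesses lie on the segment from `p` to `q`: one at the
last crossing and one just before it. -/
theorem IsBeyond.exists_last_crossing [Finite ι] [DecidableEq ι] (hq : IsBeyond a b E F q)
    (hE : IsCell a b E) (hF : F.Nonempty) :
    ∃ G F', G.Nonempty ∧ Disjoint F' G ∧ F' ∪ G = F ∧ rk a (E ∪ G) ≤ rk a E + 1 ∧
      (∃ q', IsBeyond a b E F' q') ∧ (∃ q', IsBeyond a b (E ∪ G) F' q') ∧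
      ∀ T, IsCell a b T → E ⊆ T → ∀ i ∈ T, i ∈ G → G ⊆ T := by
  obtain ⟨p, hp, hgen⟩ := hE.exists_generic q
  obtain ⟨i₀, hi₀, hmax⟩ := F.exists_max_image (crossing a b p q) hF
  set t := crossing a b p q i₀
  have ht₀₁ : t ∈ Set.Ioo 0 1 := hp.crossing_mem_Ioo hq hi₀
  have hne {i : ι} (hi : i ∈ F) : a i q ≠ b i := (hq.lt i hi).ne'
  obtain ⟨t', ht', hFt'⟩ := exists_mem_Ioo_forall_lt_of_lt (r := crossing a b p q) ht₀₁.1 F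
  refine ⟨F.filter fun i => crossing a b p q i = t, F.filter fun i => crossing a b p q i < t,
    ⟨i₀, Finset.mem_filter.2 ⟨hi₀, rfl⟩⟩, Finset.disjoint_filter.2 fun i _ h => h.ne, ?_, ?_,
    ⟨AffineMap.lineMap p q t', ?_⟩, ⟨_, hp.isBeyond_lineMap hq ht₀₁⟩, ?_⟩
  · rw [← Finset.filter_or, Finset.filter_true_of_mem fun i hi => (hmax i hi).lt_or_eq]
  · refine rk_union_le_add_one (hne hi₀) fun j hj => ?_
    obtain ⟨hj, hjt⟩ := Finset.mem_filter.1 hj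
    exact hgen j i₀ (hp.sub_mul_sub_eq_of_crossing_eq hq hj hi₀ hjt)
  · have hbefore := hp.isBeyond_lineMap hq ⟨ht'.1, ht'.2.trans ht₀₁.2⟩
    rw [Finset.filter_eq_empty_iff.2 fun i hi hit => ?_, Finset.union_empty,
      Finset.filter_congr fun i hi => ⟨fun h => h.trans ht'.2, hFt' i hi⟩] at hbefore
    · exact hbefore
    · exact (hFt' i hi (hit.trans_lt ht'.2)).ne hit
  · rintro T ⟨x, hx⟩ hET i hiT hi j hj
    obtain ⟨hi, hit⟩ := Finset.mem_filter.1 hi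
    obtain ⟨hj, hjt⟩ := Finset.mem_filter.1 hj
    have hij := hp.sub_mul_sub_eq_of_crossing_eq hq hi hj (hit.trans hjt.symm)
    exact hx.mem_of_mem hp hET hiT (hne hi) hij (hgen i j hij)

theorem cellInterval_union [DecidableEq ι]
    (h : ∀ T, IsCell a b T → E ⊆ T → ∀ i ∈ T, i ∈ G → G ⊆ T) :
    cellInterval a b E (E ∪ (F' ∪ G)) =
      cellInterval a b E (E ∪ F') ∪ cellInterval a b (E ∪ G) (E ∪ G ∪ F') := by
  ext T
  simp only [Finset.mem_union, mem_cellInterval]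
  constructor
  · rintro ⟨hT, hET, hTF⟩
    by_cases hTG : Disjoint T G
    · exact Or.inl ⟨hT, hET, fun j hj => by grind [Finset.disjoint_left.1 hTG hj]⟩
    · obtain ⟨i, hi, hiG⟩ := Finset.not_disjoint_iff.1 hTG
      refine Or.inr ⟨hT, Finset.union_subset hET (h T hT hET i hi hiG), hTF.trans ?_⟩
      grind
  · rintro (⟨hT, hET, hTF⟩ | ⟨hT, hET, hTF⟩)
    · exact ⟨hT, hET, by grind⟩
    · exact ⟨hT, by grind, by grind⟩

end Visibility

section VisibleCells

variable {V ι : Type*} [AddCommGroup V] [Module ℝ V] {a : ι → V →ₗ[ℝ] ℝ} {b : ι → ℝ}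
  {E F G T : Finset ι} {q : V}

theorem sum_cellInterval_inc_mul_inc [Finite ι] (k : Type*) [CommRing k] {T₁ T₂ : Finset ι}
    (h₁ : T₁ ∈ cellInterval a b E F) (h₂ : T₂ ∈ cellInterval a b E F) :
    ∑ T ∈ cellInterval a b E F, (inc a b T T₁ : k) * inc a b T₂ T = 0 := by
  have := Fintype.ofFinite ι
  have hsum : ∑ T ∈ cellInterval a b E F, inc a b T₂ T * inc a b T T₁ = 0 := by
    rw [Finset.sum_subset (Finset.subset_univ _), sum_inc_mul_inc]
    intro T _ hT
    by_contra hne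
    have hcov₁ : IsCover a b T T₁ := by
      by_contra h
      exact hne (by rw [inc_of_not_isCover h, mul_zero])
    have hcov₂ : IsCover a b T₂ T := by
      by_contra h
      exact hne (by rw [inc_of_not_isCover h, zero_mul])
    exact hT (mem_cellInterval.2 ⟨hcov₁.isCell_left,
      (mem_cellInterval.1 h₁).2.1.trans hcov₁.subset,
      hcov₂.subset.trans (mem_cellInterval.1 h₂).2.2⟩)
  have := congrArg (Int.cast : ℤ → k) hsum
  push_cast at this
  simpa only [mul_comm] using this

theorem IsCover.isAcyclicOn_pair [DecidableEq ι] (k : Type*) [CommRing k]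
    (h : IsCover a b G E) : IsAcyclicOn (fun T T' => (inc a b T' T : k)) {E, G} := by
  have hinc {T T' : Finset ι} (h : ¬T ⊂ T') : (inc a b T' T : k) = 0 := by
    rw [inc_of_not_isCover fun hcov => h hcov.ssubset, Int.cast_zero]
  exact ConicModules.isAcyclicOn_pair h.ssubset.ne (hinc (ssubset_irrefl _))
    (hinc h.ssubset.asymm) (hinc (ssubset_irrefl _)) (h.isUnit_inc.map (Int.castRingHom k))

theorem IsBeyond.isAcyclicOn [Finite ι] [DecidableEq ι] (k : Type*) [CommRing k]
    (hq : IsBeyond a b E F q) (hF : F.Nonempty) :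
    IsAcyclicOn (fun T T' => (inc a b T' T : k)) (cellInterval a b E (E ∪ F)) := by
  induction hn : F.card using Nat.strong_induction_on generalizing E F q with | _ n ih
  by_cases hE : IsCell a b E
  swap
  · exact fun z _ => ⟨0, fun T hT => absurd (hq.isCell_of_mem hT) hE⟩
  obtain ⟨G, F', ⟨i, hi⟩, hdisj, rfl, hrk, ⟨q₁, hq₁⟩, ⟨q₂, hq₂⟩, hG⟩ :=
    hq.exists_last_crossing hE hF
  have hcard : F'.card < n := by
    rw [← hn, Finset.card_union_of_disjoint hdisj]
    exact Nat.lt_add_of_pos_right (Finset.card_pos.2 ⟨i, hi⟩)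
  have hiE : i ∉ E := hq.notMem (Finset.mem_union_right _ hi)
  have hi₁ {T : Finset ι} (hT : T ∈ cellInterval a b E (E ∪ F')) : i ∉ T := fun hiT =>
    (Finset.mem_union.1 ((mem_cellInterval.1 hT).2.2 hiT)).elim hiE
      (Finset.disjoint_right.1 hdisj hi)
  have hi₂ {T : Finset ι} (hT : T ∈ cellInterval a b (E ∪ G) (E ∪ G ∪ F')) : i ∈ T :=
    (mem_cellInterval.1 hT).2.1 (Finset.mem_union_right _ hi)
  have hunion := cellInterval_union (F' := F') hG
  obtain rfl | hF' := F'.eq_empty_or_nonempty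
  · have hEG : IsCell a b (E ∪ G) := ⟨q₂, hq₂.eq, fun j hj => hq₂.strip j hj (by simp)⟩
    have hssub : E ⊂ E ∪ G :=
      Finset.ssubset_iff_of_subset Finset.subset_union_left |>.2
        ⟨i, Finset.mem_union_right _ hi, hiE⟩
    have hcov : IsCover a b (E ∪ G) E :=
      ⟨hEG, hE, hssub.subset, le_antisymm hrk (hEG.rk_lt hE hssub)⟩
    rw [hunion, Finset.union_empty, Finset.union_empty, cellInterval_self hE, cellInterval_self hEG,
      ← Finset.insert_eq]
    exact hcov.isAcyclicOn_pair k
  · rw [hunion]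
    refine (ih _ hcard hq₁ hF' rfl).union (ih _ hcard hq₂ hF' rfl)
      (Finset.disjoint_left.2 fun T h₁ h₂ => hi₁ h₁ (hi₂ h₂)) (fun T hT T' hT' => ?_)
      fun T hT T' hT' => ?_
    · rw [inc_of_not_isCover fun hcov => hi₁ hT' (hcov.subset (hi₂ hT)), Int.cast_zero]
    · rw [← hunion]
      exact sum_cellInterval_inc_mul_inc k (by rw [hunion]; exact Finset.mem_union_left _ hT)
        (by rw [hunion]; exact Finset.mem_union_right _ hT')

end VisibleCells

/-! ### Homomorphisms of conic modules -/

section Levels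

theorem exists_forall_le_mul {α : Type*} {T : Set α} (hT : T.Finite) (f : α → ℤ) {g : α → ℤ}
    (hg : ∀ i ∈ T, 0 < g i) : ∃ N : ℤ, ∀ i ∈ T, f i ≤ N * g i := by
  obtain ⟨N, hN⟩ := (hT.image fun i => |f i|).bddAbove
  refine ⟨N, fun i hi => ?_⟩
  have hfN : |f i| ≤ N := hN ⟨i, hi, rfl⟩
  exact (le_abs_self _).trans
    (hfN.trans (le_mul_of_one_le_right ((abs_nonneg _).trans hfN) (hg i hi)))

variable {M : Type*} [AddCommGroup M] {C : PointedCone ℝ (RealSpace M)} {v w y : RealSpace M}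
  {m m' : M} {n : Module.Dual ℤ M}

/-- The number `d_n = ⌈⟨x, n⟩⌉`; at the facet normals, these numbers determine the chamber of
`x`. -/
def level (x : RealSpace M) (n : Module.Dual ℤ M) : ℤ := ⌈realFunctional n x⌉

@[simp] theorem level_zero : level (0 : RealSpace M) n = 0 := by
  rw [level, map_zero, Int.ceil_zero]

variable (C v y) in
/-- The exponents `m` such that multiplication by the monomial `x^m` maps `A_v` to `A_y`. -/
def shifts : Set M := {m | ∀ t ∈ translatePoints C v, m + t ∈ translatePoints C y}

variable (C v y) in
/-- The exponents `m` such that multiplication by `x^m` is an isomorphism from `A_v` to `A_y`. -/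
def isoShifts : Set M := {m | ∀ n ∈ primitiveNormals C, level y n = n m + level v n}

theorem zero_mem_isoShifts : (0 : M) ∈ isoShifts C v v := fun n _ => by rw [map_zero, zero_add]

theorem neg_mem_isoShifts (hm : m ∈ isoShifts C v y) : -m ∈ isoShifts C y v := fun n hn => by
  rw [map_neg, hm n hn, neg_add_cancel_left]

namespace IsFullRational

theorem exists_ge (hC : IsFullRational C) (f : Module.Dual ℤ M → ℤ) :
    ∃ u : M, ∀ n ∈ primitiveNormals C, f n ≤ n u := by
  obtain ⟨u, hu⟩ := hC.exists_interior_point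
  obtain ⟨N, hN⟩ := exists_forall_le_mul hC.finite_primitiveNormals f hu
  exact ⟨N • u, by simpa only [map_smul, smul_eq_mul] using hN⟩

variable [Module.Finite ℤ M]

theorem mem_translatePoints_iff (hC : IsFullRational C) :
    m ∈ translatePoints C v ↔ ∀ n ∈ primitiveNormals C, level v n ≤ n m := by
  change latticePoint m - v ∈ C ↔ _
  rw [hC.mem_iff]
  refine forall₂_congr fun n _ => ?_
  rw [map_sub, realFunctional_latticePoint, sub_nonneg, level, Int.ceil_le]

theorem translatePoints_nonempty (hC : IsFullRational C) (v : RealSpace M) :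
    (translatePoints C v).Nonempty := by
  obtain ⟨u, hu⟩ := hC.exists_ge (level v)
  exact ⟨u, hC.mem_translatePoints_iff.2 hu⟩

theorem exists_mem_translatePoints_apply_eq (hC : IsFullRational C) (v : RealSpace M)
    (hn : n ∈ primitiveNormals C) : ∃ t ∈ translatePoints C v, n t = level v n := by
  obtain ⟨m, hm⟩ := exists_eq_one_of_mem_primitiveNormals hn
  obtain ⟨u, hu₀, hu⟩ := hC.exists_facet_point hn
  obtain ⟨N, hN⟩ := exists_forall_le_mul (hC.finite_primitiveNormals.sdiff (t := {n}))
    (fun n' => level v n' - level v n * n' m) (g := fun n' => n' u) fun n' hn' => hu n' hn'.1 hn'.2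
  have happly (n' : Module.Dual ℤ M) :
      n' (level v n • m + N • u) = level v n * n' m + N * n' u := by
    simp only [map_add, map_smul, smul_eq_mul]
  have happly_self : n (level v n • m + N • u) = level v n := by
    rw [happly, hm, hu₀, mul_one, mul_zero, add_zero]
  refine ⟨_, hC.mem_translatePoints_iff.2 fun n' hn' => ?_, happly_self⟩
  by_cases hne : n' = n
  · rw [hne, happly_self]
  · rw [happly]
    linarith [hN n' ⟨hn', hne⟩]

theorem mem_shifts_iff (hC : IsFullRational C) :
    m ∈ shifts C v y ↔ ∀ n ∈ primitiveNormals C, level y n ≤ n m + level v n := by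
  constructor
  · intro h n hn
    obtain ⟨t, ht, hnt⟩ := hC.exists_mem_translatePoints_apply_eq v hn
    simpa only [map_add, hnt] using hC.mem_translatePoints_iff.1 (h t ht) n hn
  · intro h t ht
    rw [hC.mem_translatePoints_iff] at ht ⊢
    intro n hn
    rw [map_add]
    linarith [h n hn, ht n hn]

theorem zero_mem_shifts_iff (hC : IsFullRational C) :
    (0 : M) ∈ shifts C v y ↔ ∀ n ∈ primitiveNormals C, level y n ≤ level v n := by
  simp only [hC.mem_shifts_iff, map_zero, zero_add]

theorem translatePoints_subset_iff (hC : IsFullRational C) :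
    translatePoints C v ⊆ translatePoints C y ↔
      ∀ n ∈ primitiveNormals C, level y n ≤ level v n := by
  rw [← hC.zero_mem_shifts_iff]
  simp only [shifts, zero_add, Set.mem_ofPred_eq, Set.subset_def]

theorem mem_shifts_of_mem_isoShifts (hC : IsFullRational C) (hm : m ∈ isoShifts C v y) :
    m ∈ shifts C v y :=
  hC.mem_shifts_iff.2 fun n hn => (hm n hn).le

theorem mem_isoShifts_of_add_mem (hC : IsFullRational C) (hm : m ∈ shifts C v y)
    (hm' : m' ∈ shifts C w v) (h : m + m' ∈ isoShifts C w y) :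
    m ∈ isoShifts C v y := fun n hn => by
  have hsum := h n hn
  rw [map_add] at hsum
  linarith [hC.mem_shifts_iff.1 hm n hn, hC.mem_shifts_iff.1 hm' n hn]

end IsFullRational

end Levels

section Symbols

section Laurent

variable {k M : Type*} [Semiring k]

theorem eq_of_coeff_single_ne_zero {m m' : M} {r : k}
    (h : (AddMonoidAlgebra.single m r).coeff m' ≠ 0) : m' = m := by
  rw [AddMonoidAlgebra.coeff_single] at h
  exact (Finsupp.single_apply_ne_zero.1 h).1

theorem exists_coeff_ne_zero_of_mul [Add M] {f g : AddMonoidAlgebra k M} {m : M}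
    (h : (f * g).coeff m ≠ 0) : ∃ m₁ m₂, f.coeff m₁ ≠ 0 ∧ g.coeff m₂ ≠ 0 ∧ m₁ + m₂ = m := by
  classical
  have := AddMonoidAlgebra.support_coeff_mul_subset f g (Finsupp.mem_support_iff.2 h)
  obtain ⟨m₁, h₁, m₂, h₂, rfl⟩ := Finset.mem_add.1 this
  exact ⟨m₁, m₂, Finsupp.mem_support_iff.1 h₁, Finsupp.mem_support_iff.1 h₂, rfl⟩

theorem isUnit_single_one [AddGroup M] (m : M) :
    IsUnit (AddMonoidAlgebra.single m 1 : AddMonoidAlgebra k M) :=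
  (Group.isUnit (Multiplicative.ofAdd m)).map (AddMonoidAlgebra.of k M)

end Laurent

variable {k : Type*} [Field k] {M : Type*} [AddCommGroup M] {C : PointedCone ℝ (RealSpace M)}
  {v w y : RealSpace M} {m : M}

theorem toLaurent_mem (g : ConicModule k C v) (hm : (toLaurent k g).coeff m ≠ 0) :
    m ∈ translatePoints C v :=
  not_imp_comm.1 (AddMonoidAlgebra.mem_supported'.1 g.2 m) hm

theorem toLaurent_injective :
    Function.Injective (toLaurent k : ConicModule k C v → AddMonoidAlgebra k M) :=
  Subtype.val_injective

@[simp] theorem toLaurent_smul (r : toricAlgebra k C) (g : ConicModule k C v) :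
    toLaurent k (r • g) = r.1 * toLaurent k g := rfl

@[simp] theorem toLaurent_add (g g' : ConicModule k C v) :
    toLaurent k (g + g') = toLaurent k g + toLaurent k g' := rfl

@[simp] theorem toLaurent_zero : toLaurent k (0 : ConicModule k C v) = 0 := rfl

theorem toLaurent_sum {ι : Type*} (s : Finset ι) (g : ι → ConicModule k C v) :
    toLaurent k (∑ i ∈ s, g i) = ∑ i ∈ s, toLaurent k (g i) :=
  map_sum (AddMonoidHom.mk' (toLaurent k) toLaurent_add) g s

/-- A Laurent polynomial supported on the lattice points of `C + v`, as an element of `A_v`. -/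
def ofLaurent (f : AddMonoidAlgebra k M) (hf : ∀ m, f.coeff m ≠ 0 → m ∈ translatePoints C v) :
    ConicModule k C v :=
  ⟨f, AddMonoidAlgebra.mem_supported'.2 fun m => not_imp_comm.1 (hf m)⟩

variable (k) in
/-- The monomial `x^m`, as an element of `A_v`. -/
def monomial (hm : m ∈ translatePoints C v) : ConicModule k C v :=
  ofLaurent (AddMonoidAlgebra.single m 1) fun _ h => eq_of_coeff_single_ne_zero h ▸ hm

@[simp] theorem toLaurent_monomial (hm : m ∈ translatePoints C v) :
    toLaurent k (monomial k hm) = AddMonoidAlgebra.single m 1 := rfl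

variable (C v y) in
/-- Multiplication by a Laurent polynomial, as a homomorphism from `A_v` to `A_y`. -/
def ofSymbol (f : AddMonoidAlgebra k M) (hf : ∀ m, f.coeff m ≠ 0 → m ∈ shifts C v y) :
    ConicModule k C v →ₗ[toricAlgebra k C] ConicModule k C y where
  toFun g := ofLaurent (f * toLaurent k g) fun m hm => by
    obtain ⟨m₁, m₂, h₁, h₂, rfl⟩ := exists_coeff_ne_zero_of_mul hm
    exact hf m₁ h₁ m₂ (toLaurent_mem g h₂)
  map_add' g g' := toLaurent_injective (mul_add _ _ _)
  map_smul' r g := toLaurent_injective (mul_left_comm _ _ _)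

@[simp] theorem toLaurent_ofSymbol {f : AddMonoidAlgebra k M}
    (hf : ∀ m, f.coeff m ≠ 0 → m ∈ shifts C v y) (g : ConicModule k C v) :
    toLaurent k (ofSymbol C v y f hf g) = f * toLaurent k g := rfl

variable (k) in
/-- Multiplication by `r x^m`, as a homomorphism from `A_v` to `A_y`. -/
def monomialHom (r : k) (hm : m ∈ shifts C v y) :
    ConicModule k C v →ₗ[toricAlgebra k C] ConicModule k C y :=
  ofSymbol C v y (AddMonoidAlgebra.single m r) fun _ h => eq_of_coeff_single_ne_zero h ▸ hm

/-- The Laurent polynomial `f` such that the homomorphism `φ` from `A_v` to `A_y` is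
multiplication by `f`. Such an `f` exists and is unique for a full dimensional rational cone; the
value is `0` if there is none. -/
def symbol (φ : ConicModule k C v →ₗ[toricAlgebra k C] ConicModule k C y) :
    AddMonoidAlgebra k M :=
  open Classical in
  if h : ∃ f, ∀ g, toLaurent k (φ g) = f * toLaurent k g then h.choose else 0

namespace IsFullRational

variable [Module.Finite ℤ M] (hC : IsFullRational C)
include hC

theorem exists_single_mul_mem (k : Type*) [Field k] (v : RealSpace M) :
    ∃ u : M, ∀ g : ConicModule k C v,
      AddMonoidAlgebra.single u 1 * toLaurent k g ∈ toricAlgebra k C := by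
  obtain ⟨u, hu⟩ := hC.exists_ge fun n => -level v n
  have hshift : u ∈ shifts C v 0 := hC.mem_shifts_iff.2 fun n hn => by
    rw [level_zero]
    linarith [hu n hn]
  exact ⟨u, fun g => (monomialHom k 1 hshift g).2⟩

/-- For `x^{m₀} ∈ A_v` and a monomial `x^u` with `x^u A_v ⊆ R`, the map `φ` commutes with
multiplication by the elements `x^u g` and `x^u x^{m₀}` of `R`, which turns the identity
`(x^u g) x^{m₀} = (x^u x^{m₀}) g` into `φ g = x^{-m₀} φ(x^{m₀}) g`. -/
theorem toLaurent_apply (φ : ConicModule k C v →ₗ[toricAlgebra k C] ConicModule k C y)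
    (g : ConicModule k C v) : toLaurent k (φ g) = symbol φ * toLaurent k g := by
  have hex : ∃ f, ∀ g, toLaurent k (φ g) = f * toLaurent k g := by
    obtain ⟨m₀, hm₀⟩ := hC.translatePoints_nonempty v
    obtain ⟨u, hu⟩ := hC.exists_single_mul_mem k v
    obtain ⟨f, hf⟩ := (isUnit_single_one (k := k) m₀).dvd (a := toLaurent k (φ (monomial k hm₀)))
    refine ⟨f, fun g => ?_⟩
    have hsmul : (⟨_, hu g⟩ : toricAlgebra k C) • monomial k hm₀ =
        (⟨_, hu (monomial k hm₀)⟩ : toricAlgebra k C) • g := toLaurent_injective <| by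
      simp only [toLaurent_smul]
      ring
    have hφ := congrArg (fun g => toLaurent k (φ g)) hsmul
    simp only [map_smul, toLaurent_smul, toLaurent_monomial, hf] at hφ
    refine ((isUnit_single_one u).mul (isUnit_single_one m₀)).mul_left_cancel ?_
    rw [← hφ]
    ring
  rw [symbol, dif_pos hex]
  exact hex.choose_spec g

theorem symbol_eq {φ : ConicModule k C v →ₗ[toricAlgebra k C] ConicModule k C y}
    {f : AddMonoidAlgebra k M} (h : ∀ g, toLaurent k (φ g) = f * toLaurent k g) :
    symbol φ = f := by
  obtain ⟨m₀, hm₀⟩ := hC.translatePoints_nonempty v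
  have hmono := hC.toLaurent_apply φ (monomial k hm₀)
  rw [h, toLaurent_monomial] at hmono
  exact ((isUnit_single_one m₀).mul_right_cancel hmono).symm

theorem symbol_ofSymbol {f : AddMonoidAlgebra k M}
    (hf : ∀ m, f.coeff m ≠ 0 → m ∈ shifts C v y) : symbol (ofSymbol C v y f hf) = f :=
  hC.symbol_eq fun _ => rfl

theorem symbol_monomialHom (r : k) (hm : m ∈ shifts C v y) :
    symbol (monomialHom k r hm) = AddMonoidAlgebra.single m r :=
  hC.symbol_ofSymbol _

theorem symbol_id :
    symbol (LinearMap.id : ConicModule k C v →ₗ[toricAlgebra k C] ConicModule k C v) = 1 :=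
  hC.symbol_eq fun _ => (one_mul _).symm

theorem symbol_comp (ψ : ConicModule k C y →ₗ[toricAlgebra k C] ConicModule k C w)
    (φ : ConicModule k C v →ₗ[toricAlgebra k C] ConicModule k C y) :
    symbol (ψ.comp φ) = symbol ψ * symbol φ :=
  hC.symbol_eq fun g => by
    rw [LinearMap.comp_apply, hC.toLaurent_apply ψ, hC.toLaurent_apply φ, mul_assoc]

theorem symbol_add (φ ψ : ConicModule k C v →ₗ[toricAlgebra k C] ConicModule k C y) :
    symbol (φ + ψ) = symbol φ + symbol ψ :=
  hC.symbol_eq fun g => by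
    rw [LinearMap.add_apply, toLaurent_add, hC.toLaurent_apply φ, hC.toLaurent_apply ψ, add_mul]

theorem symbol_zero :
    symbol (0 : ConicModule k C v →ₗ[toricAlgebra k C] ConicModule k C y) = 0 :=
  hC.symbol_eq fun g => by rw [LinearMap.zero_apply, toLaurent_zero, zero_mul]

theorem mem_shifts_of_coeff_symbol
    (φ : ConicModule k C v →ₗ[toricAlgebra k C] ConicModule k C y)
    (hm : (symbol φ).coeff m ≠ 0) : m ∈ shifts C v y := fun t ht => by
  refine toLaurent_mem (k := k) (φ (monomial k ht)) ?_
  rw [hC.toLaurent_apply, toLaurent_monomial, AddMonoidAlgebra.coeff_mul_single_apply]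
  simpa using hm

theorem isoShifts_nonempty_of_linearEquiv
    (e : ConicModule k C v ≃ₗ[toricAlgebra k C] ConicModule k C y) :
    (isoShifts C v y).Nonempty := by
  have hone : symbol e.toLinearMap * symbol e.symm.toLinearMap = 1 := by
    rw [← hC.symbol_comp, ← hC.symbol_id, LinearEquiv.comp_symm]
  obtain ⟨m₁, m₂, h₁, h₂, hsum⟩ :=
    exists_coeff_ne_zero_of_mul (f := symbol e.toLinearMap) (m := 0) (by
      rw [hone, AddMonoidAlgebra.one_def, AddMonoidAlgebra.coeff_single, Finsupp.single_eq_same]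
      exact one_ne_zero)
  exact ⟨m₁, hC.mem_isoShifts_of_add_mem (hC.mem_shifts_of_coeff_symbol _ h₁)
    (hC.mem_shifts_of_coeff_symbol _ h₂) (hsum ▸ zero_mem_isoShifts)⟩

end IsFullRational

end Symbols

/-! ### The projective modules and their graded radicals -/

section ProjectiveModules

variable {k : Type*} [Field k] {M : Type*} [AddCommGroup M] {C : PointedCone ℝ (RealSpace M)}
  {s : ℕ} {c : Fin s → RealSpace M} {d : Fin s → ℕ} {x y y' : RealSpace M}

variable (k C c d) in
/-- The inclusion of a summand in the complete sum. -/
def incl (p : Σ i : Fin s, Fin (d i)) :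
    ConicModule k C (c p.1) →ₗ[toricAlgebra k C] ConicSum k C c d :=
  LinearMap.single (toricAlgebra k C)
    (fun p : Σ i : Fin s, Fin (d i) => ConicModule k C (c p.1)) p

variable (k C c d) in
/-- The projection of the complete sum to a summand, as an element of `P_Δ` for that summand. -/
def proj (p : Σ i : Fin s, Fin (d i)) : ProjectiveOf k C c d (c p.1) :=
  LinearMap.proj (R := toricAlgebra k C)
    (φ := fun p : Σ i : Fin s, Fin (d i) => ConicModule k C (c p.1)) p

/-- The restriction of a homomorphism `𝔸 → A_y` to a summand of `𝔸`. -/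
def restrict (g : ProjectiveOf k C c d y) (p : Σ i : Fin s, Fin (d i)) :
    ConicModule k C (c p.1) →ₗ[toricAlgebra k C] ConicModule k C y :=
  (toHom k C c d g).comp (incl k C c d p)

theorem toHom_apply (g : ProjectiveOf k C c d y) (z : ConicSum k C c d) :
    toHom k C c d g z = ∑ p, restrict g p (z p) := by
  conv_lhs => rw [← LinearMap.sum_single_apply
    (φ := fun p : Σ i : Fin s, Fin (d i) => ConicModule k C (c p.1)) z]
  rw [map_sum]
  rfl

theorem exists_restrict_eq (φ : (p : Σ i : Fin s, Fin (d i)) →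
      ConicModule k C (c p.1) →ₗ[toricAlgebra k C] ConicModule k C y) :
    ∃ g : ProjectiveOf k C c d y, ∀ p, restrict g p = φ p :=
  ⟨LinearMap.lsum (toricAlgebra k C)
    (fun p : Σ i : Fin s, Fin (d i) => ConicModule k C (c p.1)) ℕ φ, fun p =>
    LinearMap.ext fun z => LinearMap.lsum_piSingle (toricAlgebra k C) _ ℕ φ p z⟩

/-- Composition with a homomorphism of conic modules, as a map of right modules. -/
def postcomp (ψ : ConicModule k C y →ₗ[toricAlgebra k C] ConicModule k C y') :
    ProjectiveOf k C c d y →ₗ[(EndRing k C c d)ᵐᵒᵖ] ProjectiveOf k C c d y' where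
  toFun g := LinearMap.comp ψ (toHom k C c d g)
  map_add' _ _ := LinearMap.comp_add _ _ _
  map_smul' _ _ := rfl

theorem op_comp_smul_eq {π : ProjectiveOf k C c d y}
    {j : ConicModule k C y →ₗ[toricAlgebra k C] ConicSum k C c d}
    (hj : (toHom k C c d π).comp j = LinearMap.id) (f : ProjectiveOf k C c d y) :
    (MulOpposite.op (j.comp (toHom k C c d f)) : (EndRing k C c d)ᵐᵒᵖ) • π = f := by
  change (toHom k C c d π).comp (j.comp (toHom k C c d f)) = toHom k C c d f
  rw [← LinearMap.comp_assoc, hj, LinearMap.id_comp]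

namespace IsCompleteSum

theorem exists_linearEquiv (hc : IsCompleteSum k C c d) (y : RealSpace M) :
    ∃ p : Σ i : Fin s, Fin (d i),
      Nonempty (ConicModule k C (c p.1) ≃ₗ[toricAlgebra k C] ConicModule k C y) := by
  obtain ⟨i, ⟨e⟩, -⟩ := hc.2 y
  exact ⟨⟨i, ⟨0, hc.1 i⟩⟩, ⟨e.symm⟩⟩

theorem exists_comp_eq_id (hc : IsCompleteSum k C c d) (y : RealSpace M) :
    ∃ (π : ProjectiveOf k C c d y)
      (j : ConicModule k C y →ₗ[toricAlgebra k C] ConicSum k C c d),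
      (toHom k C c d π).comp j = LinearMap.id := by
  obtain ⟨p, ⟨e⟩⟩ := hc.exists_linearEquiv y
  refine ⟨postcomp e.toLinearMap (proj k C c d p),
    (incl k C c d p).comp e.symm.toLinearMap, LinearMap.ext fun g => ?_⟩
  change e ((Pi.single p (e.symm g) : ConicSum k C c d) p) = g
  rw [Pi.single_eq_same, LinearEquiv.apply_symm_apply]

theorem projective (hc : IsCompleteSum k C c d) (y : RealSpace M) :
    Module.Projective (EndRing k C c d)ᵐᵒᵖ (ProjectiveOf k C c d y) := by
  obtain ⟨π, j, hj⟩ := hc.exists_comp_eq_id y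
  let i : ProjectiveOf k C c d y →ₗ[(EndRing k C c d)ᵐᵒᵖ] (EndRing k C c d)ᵐᵒᵖ :=
    { toFun := fun f => MulOpposite.op (j.comp (toHom k C c d f))
      map_add' := fun f g => congrArg MulOpposite.op (LinearMap.comp_add _ _ _)
      map_smul' := fun _ _ => rfl }
  exact Module.Projective.of_split i (LinearMap.toSpanSingleton _ _ π)
    (LinearMap.ext (op_comp_smul_eq hj))

theorem exists_eq_postcomp (hc : IsCompleteSum k C c d)
    (ρ : ProjectiveOf k C c d y →ₗ[(EndRing k C c d)ᵐᵒᵖ] ProjectiveOf k C c d y') :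
    ∃ ψ, ρ = postcomp ψ := by
  obtain ⟨π, j, hj⟩ := hc.exists_comp_eq_id y
  refine ⟨(toHom k C c d (ρ π)).comp j, LinearMap.ext fun f => ?_⟩
  conv_lhs => rw [← op_comp_smul_eq hj f, map_smul]
  rfl

end IsCompleteSum

variable [Module.Finite ℤ M] (hC : IsFullRational C)

/-- The symbol of the restriction of a homomorphism `𝔸 → A_y` to a summand of `𝔸`. -/
def symbolAt (p : Σ i : Fin s, Fin (d i)) : ProjectiveOf k C c d y →+ AddMonoidAlgebra k M where
  toFun g := symbol (restrict g p)
  map_zero' := hC.symbol_zero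
  map_add' g g' := hC.symbol_add (restrict g p) (restrict g' p)

theorem toLaurent_toHom (g : ProjectiveOf k C c d y) (z : ConicSum k C c d) :
    toLaurent k (toHom k C c d g z) = ∑ p, symbolAt hC p g * toLaurent k (z p) := by
  rw [toHom_apply, toLaurent_sum]
  exact Finset.sum_congr rfl fun p _ => hC.toLaurent_apply _ _

theorem toLaurent_toHom_incl (g : ProjectiveOf k C c d y) (p : Σ i : Fin s, Fin (d i))
    (z : ConicModule k C (c p.1)) :
    toLaurent k (toHom k C c d g (incl k C c d p z)) = symbolAt hC p g * toLaurent k z :=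
  hC.toLaurent_apply (restrict g p) z

variable {hC} in
theorem symbolAt_injective {g g' : ProjectiveOf k C c d y}
    (h : ∀ p, symbolAt hC p g = symbolAt hC p g') : g = g' := by
  refine LinearMap.ext (f := toHom k C c d g) (g := toHom k C c d g') fun z =>
    toLaurent_injective ?_
  simp only [toLaurent_toHom hC, h]

variable {hC} in
theorem mem_shifts_of_coeff_symbolAt {g : ProjectiveOf k C c d y}
    {p : Σ i : Fin s, Fin (d i)} {m : M} (h : (symbolAt hC p g).coeff m ≠ 0) :
    m ∈ shifts C (c p.1) y :=
  hC.mem_shifts_of_coeff_symbol (restrict g p) h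

theorem symbolAt_postcomp (ψ : ConicModule k C y →ₗ[toricAlgebra k C] ConicModule k C y')
    (g : ProjectiveOf k C c d y) (p : Σ i : Fin s, Fin (d i)) :
    symbolAt hC p (postcomp ψ g) = symbol ψ * symbolAt hC p g :=
  hC.symbol_comp ψ (restrict g p)

theorem exists_symbolAt_eq {f : (Σ i : Fin s, Fin (d i)) → AddMonoidAlgebra k M}
    (hf : ∀ p m, (f p).coeff m ≠ 0 → m ∈ shifts C (c p.1) y) :
    ∃ g : ProjectiveOf k C c d y, ∀ p, symbolAt hC p g = f p := by
  obtain ⟨g, hg⟩ := exists_restrict_eq fun p => ofSymbol C (c p.1) y (f p) (hf p)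
  exact ⟨g, fun p => (congrArg symbol (hg p)).trans (hC.symbol_ofSymbol _)⟩

theorem symbolAt_smul (α : EndRing k C c d) (g : ProjectiveOf k C c d y)
    (p : Σ i : Fin s, Fin (d i)) :
    symbolAt hC p (MulOpposite.op α • g) =
      ∑ q, symbolAt hC q g * symbolAt hC p (MulOpposite.op α • proj k C c d q) := by
  refine hC.symbol_eq fun z => ?_
  change toLaurent k (toHom k C c d g (α (incl k C c d p z))) = _
  rw [toLaurent_toHom hC, Finset.sum_mul]
  refine Finset.sum_congr rfl fun q _ => ?_
  rw [mul_assoc]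
  exact congrArg (symbolAt hC q g * ·)
    (toLaurent_toHom_incl hC (MulOpposite.op α • proj k C c d q) p z)

section Radical

variable (k c d x) in
/-- The homomorphisms `𝔸 → A_x` none of whose homogeneous components restricts to an isomorphism
from a summand of `𝔸` to `A_x`. -/
def noIsoSubmodule : Submodule (EndRing k C c d)ᵐᵒᵖ (ProjectiveOf k C c d x) where
  carrier := {g | ∀ p, ∀ m ∈ isoShifts C (c p.1) x, (symbolAt hC p g).coeff m = 0}
  add_mem' {g g'} hg hg' p m h := by
    rw [map_add, AddMonoidAlgebra.coeff_add, Finsupp.add_apply, hg p m h, hg' p m h, add_zero]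
  zero_mem' p m _ := by rw [map_zero]; rfl
  smul_mem' α g hg p m h := by
    obtain ⟨α, rfl⟩ := MulOpposite.op_surjective α
    by_contra hne
    rw [symbolAt_smul, AddMonoidAlgebra.coeff_sum, Finsupp.finsetSum_apply] at hne
    obtain ⟨q, -, hq⟩ := Finset.exists_ne_zero_of_sum_ne_zero hne
    obtain ⟨m₁, m₂, h₁, h₂, rfl⟩ := exists_coeff_ne_zero_of_mul hq
    exact h₁ (hg q m₁ (hC.mem_isoShifts_of_add_mem (mem_shifts_of_coeff_symbolAt h₁)
      (mem_shifts_of_coeff_symbolAt h₂) h))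

variable {hC} in
theorem mem_noIsoSubmodule {g : ProjectiveOf k C c d x} :
    g ∈ noIsoSubmodule k c d x hC ↔
      ∀ p, ∀ m ∈ isoShifts C (c p.1) x, (symbolAt hC p g).coeff m = 0 := Iff.rfl

variable {hC} in
theorem isHomogeneousHom_of_symbolAt {m : M} {g : ProjectiveOf k C c d x}
    (h : ∀ p m', (symbolAt hC p g).coeff m' ≠ 0 → m' = m) : IsHomogeneousHom k C c d m g := by
  intro a z hz
  rw [toLaurent_toHom hC]
  refine Submodule.sum_mem _ fun p _ => ?_
  rw [AddMonoidAlgebra.mem_grade_iff]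
  intro m' hm'
  obtain ⟨m₁, m₂, h₁, h₂, rfl⟩ := exists_coeff_ne_zero_of_mul (Finsupp.mem_support_iff.1 hm')
  have hm₂ : m₂ = a := Finset.mem_singleton.1
    ((AddMonoidAlgebra.mem_grade_iff k _ _).1 (hz p) (Finsupp.mem_support_iff.2 h₂))
  rw [h p m₁ h₁, hm₂, add_comm, Finset.mem_singleton]

omit [Module.Finite ℤ M] in
theorem toLaurent_incl_monomial_mem_grade {p : Σ i : Fin s, Fin (d i)} {m : M}
    (hm : m ∈ translatePoints C (c p.1)) (q : Σ i : Fin s, Fin (d i)) :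
    toLaurent k (incl k C c d p (monomial k hm) q) ∈ AddMonoidAlgebra.grade k m := by
  change toLaurent k ((Pi.single p (monomial k hm) : ConicSum k C c d) q) ∈ _
  obtain rfl | hq := eq_or_ne q p
  · rw [Pi.single_eq_same, toLaurent_monomial]
    exact AddMonoidAlgebra.single_mem_grade _ _
  · rw [Pi.single_eq_of_ne hq, toLaurent_zero]
    exact Submodule.zero_mem _

theorem IsHomogeneousHom.eq_of_coeff_symbolAt_ne_zero {m : M} {g : ProjectiveOf k C c d x}
    (h : IsHomogeneousHom k C c d m g) {p : Σ i : Fin s, Fin (d i)} {m' : M}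
    (hm' : (symbolAt hC p g).coeff m' ≠ 0) : m' = m := by
  obtain ⟨m₀, hm₀⟩ := hC.translatePoints_nonempty (c p.1)
  have hgrade := h m₀ _ (toLaurent_incl_monomial_mem_grade hm₀)
  rw [toLaurent_toHom_incl hC, toLaurent_monomial, AddMonoidAlgebra.mem_grade_iff] at hgrade
  have hmem : m' + m₀ ∈ (symbolAt hC p g * AddMonoidAlgebra.single m₀ 1).coeff.support := by
    rw [Finsupp.mem_support_iff, AddMonoidAlgebra.coeff_mul_single_apply]
    simpa using hm'
  have hadd := Finset.mem_singleton.1 (hgrade hmem)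
  rw [add_comm m₀ m] at hadd
  exact add_right_cancel hadd

theorem exists_homogeneousComponents (g : ProjectiveOf k C c d x) :
    ∃ (S : Finset M) (G : M → ProjectiveOf k C c d x), g = ∑ m ∈ S, G m ∧
      ∀ m p, symbolAt hC p (G m) = AddMonoidAlgebra.single m ((symbolAt hC p g).coeff m) := by
  classical
  choose G hG using fun m : M => exists_symbolAt_eq hC (y := x)
    (f := fun p => AddMonoidAlgebra.single m ((symbolAt hC p g).coeff m)) fun p m' hm' => by
      obtain rfl := eq_of_coeff_single_ne_zero hm'
      rw [AddMonoidAlgebra.coeff_single, Finsupp.single_eq_same] at hm'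
      exact mem_shifts_of_coeff_symbolAt hm'
  refine ⟨Finset.univ.biUnion fun p => (symbolAt hC p g).coeff.support, G,
    symbolAt_injective (hC := hC) fun p => ?_, hG⟩
  rw [map_sum, Finset.sum_congr rfl fun m _ => hG m p]
  ext m'
  simp only [AddMonoidAlgebra.coeff_sum, Finsupp.finsetSum_apply, AddMonoidAlgebra.coeff_single,
    Finsupp.single_apply, Finset.sum_ite_eq', Finset.mem_biUnion, Finset.mem_univ, true_and,
    Finsupp.mem_support_iff]
  split_ifs with hm'
  · rfl
  · exact not_not.1 fun hne => hm' ⟨p, hne⟩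

theorem isGradedSubmodule_noIsoSubmodule :
    IsGradedSubmodule k C c d (noIsoSubmodule k c d x hC) := by
  intro g hg
  obtain ⟨S, G, hsum, hG⟩ := exists_homogeneousComponents hC g
  rw [hsum]
  refine AddSubmonoid.sum_mem _ fun m _ => AddSubmonoid.subset_closure ⟨fun p m' hm' => ?_, m,
    isHomogeneousHom_of_symbolAt (hC := hC) fun p m' hm' => ?_⟩
  · by_contra hne
    rw [hG] at hne
    obtain rfl := eq_of_coeff_single_ne_zero hne
    rw [AddMonoidAlgebra.coeff_single, Finsupp.single_eq_same] at hne
    exact hne (hg p _ hm')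
  · rw [hG] at hm'
    exact eq_of_coeff_single_ne_zero hm'

theorem IsCompleteSum.exists_symbolAt_eq_single (hc : IsCompleteSum k C c d) (y : RealSpace M) :
    ∃ (p : Σ i : Fin s, Fin (d i)), ∃ m ∈ isoShifts C (c p.1) y, ∃ g : ProjectiveOf k C c d y,
      symbolAt hC p g = AddMonoidAlgebra.single m 1 := by
  obtain ⟨p, ⟨e⟩⟩ := hc.exists_linearEquiv y
  obtain ⟨m, hm⟩ := hC.isoShifts_nonempty_of_linearEquiv e
  refine ⟨p, m, hm,
    postcomp (monomialHom k 1 (hC.mem_shifts_of_mem_isoShifts hm)) (proj k C c d p), ?_⟩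
  have hproj : symbolAt hC p (proj k C c d p) = 1 := hC.symbol_eq fun z => by
    rw [one_mul]
    exact congrArg (toLaurent k)
      (Pi.single_eq_same (M := fun p : Σ i : Fin s, Fin (d i) => ConicModule k C (c p.1)) p z)
  rw [symbolAt_postcomp, hproj, hC.symbol_monomialHom, mul_one]

theorem IsCompleteSum.noIsoSubmodule_ne_top (hc : IsCompleteSum k C c d) :
    noIsoSubmodule k c d x hC ≠ ⊤ := by
  intro htop
  obtain ⟨p, m, hm, g, hg⟩ := hc.exists_symbolAt_eq_single hC x
  have hgm := (Submodule.eq_top_iff'.1 htop g) p m hm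
  rw [hg, AddMonoidAlgebra.coeff_single, Finsupp.single_eq_same] at hgm
  exact one_ne_zero hgm

/-- The restriction of `h` to the summand is a non-zero multiple of the isomorphism `x^m`, so that
every homomorphism to `A_x` factors through it. -/
theorem eq_top_of_isHomogeneousHom_mem
    {Q : Submodule (EndRing k C c d)ᵐᵒᵖ (ProjectiveOf k C c d x)} {h : ProjectiveOf k C c d x}
    (hQ : h ∈ Q) {m₀ : M} (hm₀ : IsHomogeneousHom k C c d m₀ h) {p : Σ i : Fin s, Fin (d i)}
    {m : M} (hm : m ∈ isoShifts C (c p.1) x) (hne : (symbolAt hC p h).coeff m ≠ 0) : Q = ⊤ := by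
  have hsymbol : symbolAt hC p h = AddMonoidAlgebra.single m ((symbolAt hC p h).coeff m) := by
    ext m'
    by_cases hm' : m' = m
    · rw [hm', AddMonoidAlgebra.coeff_single, Finsupp.single_eq_same]
    · rw [AddMonoidAlgebra.coeff_single, Finsupp.single_eq_of_ne hm']
      by_contra hne'
      exact hm' ((hm₀.eq_of_coeff_symbolAt_ne_zero hC hne').trans
        (hm₀.eq_of_coeff_symbolAt_ne_zero hC hne).symm)
  have hcomp : (toHom k C c d h).comp ((incl k C c d p).comp
      (monomialHom k ((symbolAt hC p h).coeff m)⁻¹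
        (hC.mem_shifts_of_mem_isoShifts (neg_mem_isoShifts hm)))) = LinearMap.id := by
    refine LinearMap.ext fun g => toLaurent_injective ?_
    rw [LinearMap.comp_apply, LinearMap.comp_apply, toLaurent_toHom_incl hC, hsymbol,
      monomialHom, toLaurent_ofSymbol, ← mul_assoc, AddMonoidAlgebra.single_mul_single,
      add_neg_cancel, ← hsymbol, mul_inv_cancel₀ hne, ← AddMonoidAlgebra.one_def, one_mul,
      LinearMap.id_apply]
  exact Submodule.eq_top_iff'.2 fun f => op_comp_smul_eq hcomp f ▸ Q.smul_mem _ hQ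

theorem le_noIsoSubmodule {Q : Submodule (EndRing k C c d)ᵐᵒᵖ (ProjectiveOf k C c d x)}
    (hQ : IsGradedSubmodule k C c d Q) (hQt : Q ≠ ⊤) : Q ≤ noIsoSubmodule k c d x hC := by
  intro g hg
  have hle : AddSubmonoid.closure {g | g ∈ Q ∧ ∃ m : M, IsHomogeneousHom k C c d m g} ≤
      (noIsoSubmodule k c d x hC).toAddSubmonoid := by
    refine AddSubmonoid.closure_le.2 ?_
    rintro h ⟨hh, m₀, hm₀⟩ p m hm
    exact not_not.1 fun hne => hQt (eq_top_of_isHomogeneousHom_mem hC hh hm₀ hm hne)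
  exact hle (hQ g hg)

theorem IsCompleteSum.gradedRadical_eq (hc : IsCompleteSum k C c d) :
    gradedRadical k C c d x = noIsoSubmodule k c d x hC :=
  le_antisymm (sSup_le fun _ hQ => le_noIsoSubmodule hC hQ.1 hQ.2)
    (le_sSup ⟨isGradedSubmodule_noIsoSubmodule hC, hc.noIsoSubmodule_ne_top hC⟩)

end Radical

end ProjectiveModules

/-! ### Minimal resolutions and projective dimension -/

section Resolutions

universe w

open CategoryTheory

variable {Λ : Type w} [Ring Λ] {S : Type w} [AddCommGroup S] [Module Λ S] {K : ℕ → Type w}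
  [∀ n, AddCommGroup (K n)] [∀ n, Module Λ (K n)]

/-- The modules `K n` with the maps `δ n : K (n + 1) → K n` and the augmentation `ε : K 0 → S`
form a projective resolution of `S`. -/
structure IsProjectiveResolution (δ : ∀ n, K (n + 1) →ₗ[Λ] K n) (ε : K 0 →ₗ[Λ] S) : Prop where
  projective : ∀ n, Module.Projective Λ (K n)
  surjective : Function.Surjective ε
  range_zero : LinearMap.range (δ 0) = LinearMap.ker ε
  range_succ : ∀ n, LinearMap.range (δ (n + 1)) = LinearMap.ker (δ n)

namespace IsProjectiveResolution

variable {δ : ∀ n, K (n + 1) →ₗ[Λ] K n} {ε : K 0 →ₗ[Λ] S}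

theorem apply_mem_ker (h : IsProjectiveResolution δ ε) (z : K 1) :
    δ 0 z ∈ LinearMap.ker ε :=
  h.range_zero ▸ LinearMap.mem_range_self (δ 0) z

theorem tail (h : IsProjectiveResolution δ ε) :
    IsProjectiveResolution (K := fun n => K (n + 1)) (fun n => δ (n + 1))
      ((δ 0).codRestrict (LinearMap.ker ε) h.apply_mem_ker) where
  projective n := h.projective (n + 1)
  surjective := by
    rw [← LinearMap.range_eq_top, LinearMap.range_codRestrict, h.range_zero,
      Submodule.comap_subtype_self]
  range_zero := by rw [LinearMap.ker_codRestrict, h.range_succ]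
  range_succ n := h.range_succ (n + 1)

theorem hasProjectiveDimensionLT_succ_iff (h : IsProjectiveResolution δ ε) (e : ℕ) :
    HasProjectiveDimensionLT (ModuleCat.of Λ S) (e + 2) ↔
      HasProjectiveDimensionLT (ModuleCat.of Λ (LinearMap.ker ε)) (e + 1) :=
  (LinearMap.shortExact_shortComplexKer h.surjective).hasProjectiveDimensionLT_X₃_iff e
    ((IsProjective.iff_projective (K 0)).1 (h.projective 0))

theorem hasProjectiveDimensionLT {e : ℕ} (h : IsProjectiveResolution δ ε)
    (hzero : Subsingleton (K (e + 1))) : HasProjectiveDimensionLT (ModuleCat.of Λ S) (e + 1) := by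
  induction e generalizing S K with
  | zero =>
    have hker : LinearMap.ker ε = ⊥ := by
      rw [← h.range_zero, Subsingleton.elim (δ 0) 0, LinearMap.range_zero]
    have := h.projective 0
    rw [zero_add, ← projective_iff_hasProjectiveDimensionLT_one]
    exact (IsProjective.iff_projective S).1 (Module.Projective.of_equiv
      (LinearEquiv.ofBijective ε ⟨LinearMap.ker_eq_bot.1 hker, h.surjective⟩))
  | succ e ih => exact (h.hasProjectiveDimensionLT_succ_iff e).2 (ih h.tail hzero)

theorem exists_retraction {e : ℕ} (h : IsProjectiveResolution δ ε)
    (hzero : Subsingleton (K (e + 2)))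
    (hS : HasProjectiveDimensionLT (ModuleCat.of Λ S) (e + 1)) :
    ∃ r : K e →ₗ[Λ] K (e + 1), r.comp (δ e) = LinearMap.id := by
  induction e generalizing S K with
  | zero =>
    rw [zero_add, ← projective_iff_hasProjectiveDimensionLT_one] at hS
    have : Module.Projective Λ S := (IsProjective.iff_projective S).2 hS
    have hinj : LinearMap.ker (δ 0) = ⊥ := by
      rw [← h.range_succ 0, Subsingleton.elim (δ (0 + 1)) 0, LinearMap.range_zero]
    have hexact : Function.Exact (δ 0) ε := LinearMap.exact_iff.2 h.range_zero.symm
    exact ((hexact.split_tfae (LinearMap.ker_eq_bot.1 hinj) h.surjective).out 0 1).1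
      (Module.projective_lifting_property ε LinearMap.id h.surjective)
  | succ e ih => exact ih h.tail hzero ((h.hasProjectiveDimensionLT_succ_iff e).1 hS)

end IsProjectiveResolution

end Resolutions

/-! ### The cells of a chamber -/

section CellPoints

variable {M : Type*} [AddCommGroup M]

/-- The functionals whose strips cut out the chambers: the facet normals. -/
def normalMap (C : PointedCone ℝ (RealSpace M)) (n : primitiveNormals C) : RealSpace M →ₗ[ℝ] ℝ :=
  realFunctional n.1

/-- The upper bounds `d_n` of the facet normals on the chamber of `x`. -/
def wall (C : PointedCone ℝ (RealSpace M)) (x : RealSpace M) (n : primitiveNormals C) : ℝ :=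
  level x n.1

/-- The labels of the cells of codimension `i` of the chamber of `x`. A cell `τ_Ω` is labelled by
the complement of `Ω`, the set of those normals `n` which attain the value `d_n` on it. -/
abbrev CellIndex (C : PointedCone ℝ (RealSpace M)) (x : RealSpace M) (i : ℕ) : Type _ :=
  {E : Finset (primitiveNormals C) //
    IsCell (normalMap C) (wall C x) E ∧ rk (normalMap C) E = i}

/-- A point just beyond the walls which contain the cell labelled by `E`. It is arbitrary if there
is no such point; there is one if the cell is non-empty. -/
def cellPoint (C : PointedCone ℝ (RealSpace M)) (x : RealSpace M)
    (E : Finset (primitiveNormals C)) : RealSpace M :=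
  open Classical in
  Classical.epsilon fun y => ∀ n : primitiveNormals C,
    level y n.1 = level x n.1 + if n ∈ E then 1 else 0

variable {C : PointedCone ℝ (RealSpace M)} {v w x : RealSpace M} {m : M}
  {E E' : Finset (primitiveNormals C)}

theorem level_add_latticePoint (w : RealSpace M) (m : M) (n : Module.Dual ℤ M) :
    level (w + latticePoint m) n = n m + level w n := by
  rw [level, map_add, realFunctional_latticePoint, Int.ceil_add_intCast, add_comm, level]

namespace IsFullRational

theorem exists_forall_mem_Ioo (hC : IsFullRational C) (w : RealSpace M) :
    ∃ y : RealSpace M, ∀ n ∈ primitiveNormals C,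
      (level w n : ℝ) - 1 < realFunctional n y ∧ realFunctional n y < level w n := by
  have := hC.finite_primitiveNormals.to_subtype
  obtain ⟨u, hu⟩ := hC.exists_interior_point
  obtain ⟨ε, hε, hlt⟩ := exists_pos_forall_add_mul_lt
    (p := fun n : primitiveNormals C => -realFunctional n.1 w)
    (r := fun n => 1 - (level w n.1 : ℝ)) (fun n => (n.1 u : ℝ))
    fun n => by
      have hlt : (level w n.1 : ℝ) < realFunctional n.1 w + 1 := Int.ceil_lt_add_one _
      linarith
  refine ⟨w - ε • latticePoint u, fun n hn => ?_⟩
  have hpos : (0 : ℝ) < ε * n u := mul_pos hε (Int.cast_pos.2 (hu n hn))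
  have hle : realFunctional n w ≤ level w n := Int.le_ceil _
  rw [map_sub, map_smul, realFunctional_latticePoint, smul_eq_mul]
  constructor <;> linarith [hlt ⟨n, hn⟩]

theorem isCell_empty (hC : IsFullRational C) (x : RealSpace M) :
    IsCell (normalMap C) (wall C x) ∅ := by
  obtain ⟨y, hy⟩ := hC.exists_forall_mem_Ioo x
  exact ⟨y, fun n hn => absurd hn (Finset.notMem_empty n), fun n _ => hy n.1 n.2⟩

theorem exists_isBeyond [Fintype (primitiveNormals C)] (hC : IsFullRational C)
    (hw : ∀ n ∈ primitiveNormals C, level x n ≤ level w n) :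
    ∃ q, IsBeyond (normalMap C) (wall C x) ∅
      (Finset.univ.filter fun n : primitiveNormals C => level x n.1 < level w n.1) q := by
  obtain ⟨y, hy⟩ := hC.exists_forall_mem_Ioo w
  refine ⟨y, fun n hn => absurd hn (Finset.notMem_empty n), fun n hn => ?_, fun n _ hn => ?_⟩
  · have hlt : (level x n.1 : ℝ) + 1 ≤ level w n.1 := by
      exact_mod_cast Int.add_one_le_iff.2 (Finset.mem_filter.1 hn).2
    change (level x n.1 : ℝ) < realFunctional n.1 y
    linarith [(hy n.1 n.2).1]
  · have heq : level w n.1 = level x n.1 :=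
      (not_lt.1 fun h => hn (Finset.mem_filter.2 ⟨Finset.mem_univ _, h⟩)).antisymm (hw n.1 n.2)
    have hyn := hy n.1 n.2
    rwa [heq] at hyn

open Classical in
theorem level_cellPoint (hC : IsFullRational C) (hE : IsCell (normalMap C) (wall C x) E)
    (n : primitiveNormals C) :
    level (cellPoint C x E) n.1 = level x n.1 + if n ∈ E then 1 else 0 := by
  obtain ⟨z, hz⟩ := hE
  obtain ⟨y, hy⟩ := hC.exists_forall_mem_Ioo (-z)
  refine Classical.epsilon_spec (p := fun y => ∀ n : primitiveNormals C,
    level y n.1 = level x n.1 + if n ∈ E then 1 else 0) ⟨-y, fun n => ?_⟩ n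
  have hyn := hy n.1 n.2
  have hlevel : level (-z) n.1 = -⌊realFunctional n.1 z⌋ := by rw [level, map_neg, Int.ceil_neg]
  have hfloor : ⌊realFunctional n.1 z⌋ + 1 = level x n.1 + if n ∈ E then 1 else 0 := by
    by_cases hn : n ∈ E
    · have hzn : realFunctional n.1 z = level x n.1 := hz.1 n hn
      rw [hzn, Int.floor_intCast, if_pos hn]
    · have hzn : (level x n.1 : ℝ) - 1 < realFunctional n.1 z ∧
        realFunctional n.1 z < level x n.1 := hz.2 n hn
      rw [if_neg hn, add_zero, ← eq_sub_iff_add_eq, Int.floor_eq_iff]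
      push_cast
      constructor <;> linarith
  rw [hlevel] at hyn
  rw [level, map_neg, Int.ceil_eq_iff, ← hfloor]
  push_cast at hyn ⊢
  constructor <;> linarith

theorem zero_mem_isoShifts_cellPoint_empty (hC : IsFullRational C) :
    (0 : M) ∈ isoShifts C x (cellPoint C x ∅) := fun n hn => by
  rw [hC.level_cellPoint (hC.isCell_empty x) ⟨n, hn⟩, if_neg (Finset.notMem_empty _), map_zero,
    add_comm]

theorem rk_eq_zero_iff (hC : IsFullRational C) (hE : IsCell (normalMap C) (wall C x) E) :
    rk (normalMap C) E = 0 ↔ E = ∅ := by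
  refine ⟨fun h => ?_, fun h => h ▸ rk_empty _⟩
  by_contra hne
  have hlt := hE.rk_lt (hC.isCell_empty x) (Finset.nonempty_iff_ne_empty.2 hne).empty_ssubset
  omega

variable [Module.Finite ℤ M]

theorem mem_shifts_cellPoint_iff (hC : IsFullRational C)
    (hE : IsCell (normalMap C) (wall C x) E) :
    m ∈ shifts C v (cellPoint C x E) ↔
      m ∈ shifts C v x ∧ ∀ n ∈ E, level x n.1 < n.1 m + level v n.1 := by
  classical
  rw [hC.mem_shifts_iff, hC.mem_shifts_iff]
  constructor
  · intro h
    refine ⟨fun n hn => ?_, fun n hn => ?_⟩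
    · have hle : level x n ≤ level (cellPoint C x E) n := by
        rw [hC.level_cellPoint hE ⟨n, hn⟩, le_add_iff_nonneg_right]
        split_ifs <;> norm_num
      exact hle.trans (h n hn)
    · have hle := h n.1 n.2
      rwa [hC.level_cellPoint hE, if_pos hn, Int.add_one_le_iff] at hle
  · rintro ⟨hx, hlt⟩ n hn
    rw [hC.level_cellPoint hE ⟨n, hn⟩]
    split_ifs with hnE
    · exact Int.add_one_le_iff.2 (hlt ⟨n, hn⟩ hnE)
    · simpa only [add_zero] using hx n hn

theorem zero_mem_shifts_cellPoint (hC : IsFullRational C)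
    (h : IsCover (normalMap C) (wall C x) E E') :
    (0 : M) ∈ shifts C (cellPoint C x E) (cellPoint C x E') := by
  classical
  refine hC.zero_mem_shifts_iff.2 fun n hn => ?_
  rw [hC.level_cellPoint h.isCell_left ⟨n, hn⟩, hC.level_cellPoint h.isCell_right ⟨n, hn⟩]
  split_ifs with hE' hE hE
  · exact le_rfl
  · exact absurd (h.subset hE') hE
  · omega
  · exact le_rfl

theorem zero_notMem_shifts_cellPoint (hC : IsFullRational C)
    (h : IsCover (normalMap C) (wall C x) E E') :
    (0 : M) ∉ shifts C (cellPoint C x E') (cellPoint C x E) := fun h0 => by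
  obtain ⟨n, hn, hn'⟩ := Finset.exists_of_ssubset h.ssubset
  have hle := hC.zero_mem_shifts_iff.1 h0 n.1 n.2
  rw [hC.level_cellPoint h.isCell_left, hC.level_cellPoint h.isCell_right, if_pos hn,
    if_neg hn'] at hle
  omega

/-- The cells whose modules receive `x^m A_v` are those visible from a point `q` close to `v + m`,
and there is a wall between `q` and the chamber unless `x^m A_v` is the module of the chamber. -/
theorem isAcyclicOn_visible (k : Type*) [CommRing k] (hC : IsFullRational C)
    (hm : m ∈ shifts C v x) (hiso : m ∉ isoShifts C v x) :
    ∃ T : Finset (Finset (primitiveNormals C)),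
      IsAcyclicOn (fun E E' => (inc (normalMap C) (wall C x) E' E : k)) T ∧
      ∀ E, E ∈ T ↔ IsCell (normalMap C) (wall C x) E ∧ m ∈ shifts C v (cellPoint C x E) := by
  classical
  have := hC.finite_primitiveNormals.fintype
  have hle := hC.mem_shifts_iff.1 hm
  simp only [← level_add_latticePoint] at hle
  obtain ⟨q, hq⟩ := hC.exists_isBeyond hle
  refine ⟨_, hq.isAcyclicOn k ?_, fun E => ?_⟩
  · by_contra hemp
    refine hiso fun n hn => ?_
    rw [← level_add_latticePoint]
    refine (hle n hn).antisymm (not_lt.1 fun h => hemp ⟨⟨n, hn⟩, ?_⟩)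
    exact Finset.mem_filter.2 ⟨Finset.mem_univ _, h⟩
  · rw [mem_cellInterval, Finset.empty_union]
    refine and_congr_right fun hE => ?_
    rw [hC.mem_shifts_cellPoint_iff hE, and_iff_right (Finset.empty_subset E), and_iff_right hm]
    simp only [Finset.subset_iff, Finset.mem_filter, Finset.mem_univ, true_and,
      level_add_latticePoint]

end IsFullRational

section Exactness

variable {k : Type*} [Field k] [Fintype (primitiveNormals C)]

variable (C x) in
/-- The differential of the cellular complex of the chamber of `x`, on chains indexed by all
labels. -/
def cellDiff (z : Finset (primitiveNormals C) → k) (E : Finset (primitiveNormals C)) : k :=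
  ∑ G, (inc (normalMap C) (wall C x) G E : k) * z G

theorem cellDiff_zero : cellDiff C x (0 : Finset (primitiveNormals C) → k) = 0 :=
  funext fun _ => Finset.sum_eq_zero fun _ _ => mul_zero _

theorem cellDiff_cellDiff (z : Finset (primitiveNormals C) → k) :
    cellDiff C x (cellDiff C x z) = 0 := by
  funext E
  simp only [cellDiff, Finset.mul_sum]
  rw [Finset.sum_comm]
  refine Finset.sum_eq_zero fun G _ => ?_
  have hsq := congrArg (Int.cast : ℤ → k) (sum_inc_mul_inc (a := normalMap C) (b := wall C x) G E)
  push_cast at hsq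
  refine Eq.trans ?_ ((congrArg (· * z G) hsq).trans (zero_mul _))
  rw [Finset.sum_mul]
  exact Finset.sum_congr rfl fun G' _ => by ring

theorem exists_cover_of_cellDiff_ne_zero {z : Finset (primitiveNormals C) → k}
    (h : cellDiff C x z E ≠ 0) : ∃ G, IsCover (normalMap C) (wall C x) G E ∧ z G ≠ 0 := by
  obtain ⟨G, -, hG⟩ := Finset.exists_ne_zero_of_sum_ne_zero h
  refine ⟨G, ?_, right_ne_zero_of_mul hG⟩
  by_contra hcov
  exact left_ne_zero_of_mul hG (by rw [inc_of_not_isCover hcov, Int.cast_zero])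

variable [Module.Finite ℤ M]

theorem IsFullRational.exists_cellDiff_eq (hC : IsFullRational C)
    {z : Finset (primitiveNormals C) → k}
    (hz : ∀ E, z E ≠ 0 → IsCell (normalMap C) (wall C x) E ∧ m ∈ shifts C v (cellPoint C x E))
    (hdz : cellDiff C x z = 0) (hiso : m ∈ isoShifts C v x → z = 0) :
    ∃ y : Finset (primitiveNormals C) → k, (∀ E, y E ≠ 0 → m ∈ shifts C v (cellPoint C x E)) ∧
      cellDiff C x y = z ∧ (z = 0 → y = 0) := by
  classical
  by_cases hz₀ : z = 0
  · exact ⟨0, fun E hE => absurd rfl hE, by rw [hz₀, cellDiff_zero], fun _ => rfl⟩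
  obtain ⟨E₀, hE₀⟩ := Function.ne_iff.1 hz₀
  have hm : m ∈ shifts C v x :=
    ((hC.mem_shifts_cellPoint_iff (hz E₀ hE₀).1).1 (hz E₀ hE₀).2).1
  obtain ⟨T, hT, hmem⟩ := hC.isAcyclicOn_visible k hm (mt hiso hz₀)
  have hclosed : ∀ E' ∈ T, ∀ E ∉ T, (inc (normalMap C) (wall C x) E' E : k) = 0 := by
    intro E' hE' E hE
    rw [inc_of_not_isCover, Int.cast_zero]
    refine fun hcov => hE ((hmem E).2 ⟨hcov.isCell_right, ?_⟩)
    have h := (hC.mem_shifts_cellPoint_iff hcov.isCell_left).1 ((hmem E').1 hE').2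
    exact (hC.mem_shifts_cellPoint_iff hcov.isCell_right).2
      ⟨h.1, fun n hn => h.2 n (hcov.subset hn)⟩
  obtain ⟨y, hy, hdy⟩ := hT.exists_sum_univ_eq hclosed
    (fun E hE => not_imp_comm.1 (fun h => (hmem E).2 (hz E h)) hE) (congrFun hdz)
  exact ⟨y, fun E hE => ((hmem E).1 (not_imp_comm.1 (hy E) hE)).2, funext hdy,
    fun h => absurd h hz₀⟩

end Exactness

end CellPoints

/-! ### The cellular resolution -/

section Resolution

variable {k : Type*} [Field k] {M : Type*} [AddCommGroup M] {C : PointedCone ℝ (RealSpace M)}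
  {s : ℕ} {c : Fin s → RealSpace M} {d : Fin s → ℕ} {v x y y' : RealSpace M} {r : k}

variable (C y y') in
/-- Multiplication by the scalar `r` as a homomorphism from `A_y` to `A_{y'}` if `A_y` is contained
in `A_{y'}`, and zero otherwise. -/
def scalarHom (r : k) : ConicModule k C y →ₗ[toricAlgebra k C] ConicModule k C y' :=
  open Classical in if h : (0 : M) ∈ shifts C y y' then monomialHom k r h else 0

variable (k C c d x) in
/-- The terms of the resolution of the graded simple module of the chamber of `x`: one projective
module for each cell of codimension `n`. -/
abbrev ResolutionTerm (n : ℕ) : Type _ :=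
  (E : CellIndex C x n) → ProjectiveOf k C c d (cellPoint C x E.1)

/-- The label of the open cell of full dimension. -/
def emptyIndex (hC : IsFullRational C) (x : RealSpace M) : CellIndex C x 0 :=
  ⟨∅, hC.isCell_empty x, rk_empty _⟩

variable (k c d x) in
/-- The augmentation of the resolution: the inclusion `P_Δ → P_Δ` for the open cell of full
dimension, followed by the projection to `S_Δ`. -/
def augmentation (hC : IsFullRational C) :
    ResolutionTerm k C c d x 0 →ₗ[(EndRing k C c d)ᵐᵒᵖ] GradedSimple k C c d x :=
  (gradedRadical k C c d x).mkQ.comp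
    ((postcomp (scalarHom C (cellPoint C x (emptyIndex hC x).1) x (1 : k))).comp
      (LinearMap.proj (emptyIndex hC x)))

instance [Fintype (primitiveNormals C)] (n : ℕ) : Fintype (CellIndex C x n) := Fintype.ofFinite _

variable (k C c d x) in
/-- The differential of the resolution: inclusions of conic modules with the incidence numbers of
the cells as coefficients. -/
def resolutionMap [Fintype (primitiveNormals C)] (n : ℕ) :
    ResolutionTerm k C c d x (n + 1) →ₗ[(EndRing k C c d)ᵐᵒᵖ] ResolutionTerm k C c d x n :=
  LinearMap.pi fun E' => ∑ E : CellIndex C x (n + 1),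
    (postcomp (scalarHom C (cellPoint C x E.1) (cellPoint C x E'.1)
      (inc (normalMap C) (wall C x) E.1 E'.1 : k))).comp (LinearMap.proj E)

theorem resolutionMap_apply [Fintype (primitiveNormals C)] {n : ℕ}
    (g : ResolutionTerm k C c d x (n + 1)) (E' : CellIndex C x n) :
    resolutionMap k C c d x n g E' = ∑ E : CellIndex C x (n + 1),
      postcomp (scalarHom C (cellPoint C x E.1) (cellPoint C x E'.1)
        (inc (normalMap C) (wall C x) E.1 E'.1 : k)) (g E) := by
  rw [resolutionMap, LinearMap.pi_apply, LinearMap.sum_apply]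
  rfl

theorem IsCompleteSum.projective_resolutionTerm [Finite (primitiveNormals C)]
    (hc : IsCompleteSum k C c d) (n : ℕ) :
    Module.Projective (EndRing k C c d)ᵐᵒᵖ (ResolutionTerm k C c d x n) := by
  classical
  have := Fintype.ofFinite (CellIndex C x n)
  have := fun E : CellIndex C x n => hc.projective (cellPoint C x E.1)
  exact Module.Projective.of_equiv (DirectSum.linearEquivFunOnFintype (EndRing k C c d)ᵐᵒᵖ
    (CellIndex C x n) fun E => ProjectiveOf k C c d (cellPoint C x E.1))

theorem IsCompleteSum.exists_apply_eq_sum_postcomp [Fintype (primitiveNormals C)]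
    (hc : IsCompleteSum k C c d) {n n' : ℕ}
    (ρ : ResolutionTerm k C c d x n →ₗ[(EndRing k C c d)ᵐᵒᵖ] ResolutionTerm k C c d x n')
    (E : CellIndex C x n') :
    ∃ ψ : (E' : CellIndex C x n) → ConicModule k C (cellPoint C x E'.1) →ₗ[toricAlgebra k C]
      ConicModule k C (cellPoint C x E.1), ∀ g, ρ g E = ∑ E', postcomp (ψ E') (g E') := by
  classical
  choose ψ hψ using fun E' => hc.exists_eq_postcomp ((LinearMap.proj E).comp
    (ρ.comp (LinearMap.single (EndRing k C c d)ᵐᵒᵖ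
      (fun E : CellIndex C x n => ProjectiveOf k C c d (cellPoint C x E.1)) E')))
  refine ⟨ψ, fun g => ?_⟩
  rw [← LinearMap.sum_single_apply
    (φ := fun E : CellIndex C x n => ProjectiveOf k C c d (cellPoint C x E.1)) g, map_sum,
    Finset.sum_apply, LinearMap.sum_single_apply]
  exact Finset.sum_congr rfl fun E' _ => LinearMap.congr_fun (hψ E') (g E')

variable [Module.Finite ℤ M]

theorem IsFullRational.symbol_scalarHom (hC : IsFullRational C)
    (h : r ≠ 0 → (0 : M) ∈ shifts C y y') :
    symbol (scalarHom C y y' r) = AddMonoidAlgebra.single 0 r := by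
  by_cases h₀ : (0 : M) ∈ shifts C y y'
  · rw [scalarHom, dif_pos h₀, hC.symbol_monomialHom]
  · rw [scalarHom, dif_neg h₀, hC.symbol_zero, not_imp_comm.1 h h₀, AddMonoidAlgebra.single_zero]

theorem coeff_symbolAt_postcomp_scalarHom (hC : IsFullRational C)
    (h : r ≠ 0 → (0 : M) ∈ shifts C y y') (g : ProjectiveOf k C c d y)
    (p : Σ i : Fin s, Fin (d i)) (m : M) :
    (symbolAt hC p (postcomp (scalarHom C y y' r) g)).coeff m =
      r * (symbolAt hC p g).coeff m := by
  rw [symbolAt_postcomp, hC.symbol_scalarHom h, AddMonoidAlgebra.coeff_single_zero_mul]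

theorem IsFullRational.zero_mem_shifts_of_inc_ne_zero (hC : IsFullRational C)
    {E E' : Finset (primitiveNormals C)} (h : (inc (normalMap C) (wall C x) E E' : k) ≠ 0) :
    (0 : M) ∈ shifts C (cellPoint C x E) (cellPoint C x E') := by
  refine hC.zero_mem_shifts_cellPoint ?_
  by_contra hcov
  exact h (by rw [inc_of_not_isCover hcov, Int.cast_zero])

section Coefficients

/-- The coefficients of an element of a term of the resolution in the degree given by `p` and `m`,
as a chain of the cellular complex. -/
def cellCoeff (hC : IsFullRational C) {n : ℕ} (g : ResolutionTerm k C c d x n)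
    (p : Σ i : Fin s, Fin (d i)) (m : M) (E : Finset (primitiveNormals C)) : k :=
  open Classical in
  if h : IsCell (normalMap C) (wall C x) E ∧ rk (normalMap C) E = n then
    (symbolAt hC p (g ⟨E, h⟩)).coeff m else 0

variable {n : ℕ} {p : Σ i : Fin s, Fin (d i)} {m : M} (hC : IsFullRational C)

theorem cellCoeff_apply (g : ResolutionTerm k C c d x n) (p : Σ i : Fin s, Fin (d i)) (m : M)
    (E : CellIndex C x n) : cellCoeff hC g p m E.1 = (symbolAt hC p (g E)).coeff m := by
  rw [cellCoeff, dif_pos E.2]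

theorem exists_index_of_cellCoeff_ne_zero {hC : IsFullRational C}
    {g : ResolutionTerm k C c d x n} {E : Finset (primitiveNormals C)}
    (h : cellCoeff hC g p m E ≠ 0) :
    ∃ G : CellIndex C x n, G.1 = E ∧ (symbolAt hC p (g G)).coeff m ≠ 0 := by
  by_cases hE : IsCell (normalMap C) (wall C x) E ∧ rk (normalMap C) E = n
  · rw [cellCoeff, dif_pos hE] at h
    exact ⟨⟨E, hE⟩, rfl, h⟩
  · rw [cellCoeff, dif_neg hE] at h
    exact absurd rfl h

theorem mem_shifts_of_cellCoeff_ne_zero {hC : IsFullRational C}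
    {g : ResolutionTerm k C c d x n} {E : Finset (primitiveNormals C)}
    (h : cellCoeff hC g p m E ≠ 0) : m ∈ shifts C (c p.1) (cellPoint C x E) := by
  obtain ⟨G, rfl, hG⟩ := exists_index_of_cellCoeff_ne_zero h
  exact mem_shifts_of_coeff_symbolAt hG

variable {hC} in
theorem cellCoeff_injective {g g' : ResolutionTerm k C c d x n}
    (h : ∀ p m, cellCoeff hC g p m = cellCoeff hC g' p m) : g = g' := by
  refine funext fun E => symbolAt_injective (hC := hC) fun p => ?_
  ext m
  rw [← cellCoeff_apply, h, cellCoeff_apply]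

theorem cellCoeff_zero : cellCoeff hC (0 : ResolutionTerm k C c d x n) p m = 0 := by
  funext E
  by_contra h
  obtain ⟨G, -, hG⟩ := exists_index_of_cellCoeff_ne_zero h
  rw [Pi.zero_apply, map_zero] at hG
  exact hG rfl

theorem finite_setOf_cellCoeff_ne_zero [Finite (primitiveNormals C)]
    (g : ResolutionTerm k C c d x n) (p : Σ i : Fin s, Fin (d i)) :
    {m | cellCoeff hC g p m ≠ 0}.Finite := by
  refine (Set.finite_iUnion fun E : CellIndex C x n =>
    (symbolAt hC p (g E)).coeff.support.finite_toSet).subset fun m hm => ?_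
  obtain ⟨E, hE⟩ := Function.ne_iff.1 hm
  obtain ⟨G, -, hG⟩ := exists_index_of_cellCoeff_ne_zero hE
  exact Set.mem_iUnion.2 ⟨G, Finsupp.mem_support_iff.2 hG⟩

theorem exists_cellCoeff_eq
    {z : (Σ i : Fin s, Fin (d i)) → M → Finset (primitiveNormals C) → k}
    (hfin : ∀ p, {m | z p m ≠ 0}.Finite)
    (hz : ∀ p m E, z p m E ≠ 0 → m ∈ shifts C (c p.1) (cellPoint C x E)) :
    ∃ g : ResolutionTerm k C c d x n, ∀ p m (E : CellIndex C x n),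
      cellCoeff hC g p m E.1 = z p m E.1 := by
  let f (E : Finset (primitiveNormals C)) (p) : AddMonoidAlgebra k M :=
    AddMonoidAlgebra.ofCoeff (Finsupp.onFinset (hfin p).toFinset (fun m => z p m E) fun m hm =>
      (hfin p).mem_toFinset.2 fun h => hm (congrFun h E))
  choose g hg using fun E : CellIndex C x n =>
    exists_symbolAt_eq hC (f := f E.1) fun p m hm => hz p m E.1 hm
  exact ⟨g, fun p m E => by rw [cellCoeff_apply, hg]; rfl⟩

theorem cellCoeff_succ_eq_zero (g : ResolutionTerm k C c d x (n + 1))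
    (hm : m ∈ isoShifts C (c p.1) x) : cellCoeff hC g p m = 0 := by
  funext E
  by_contra hE
  have hshift := mem_shifts_of_cellCoeff_ne_zero hE
  obtain ⟨G, rfl, -⟩ := exists_index_of_cellCoeff_ne_zero hE
  have hne : G.1 ≠ ∅ := by
    rw [Ne, ← hC.rk_eq_zero_iff G.2.1, G.2.2]
    exact n.succ_ne_zero
  obtain ⟨i, hi⟩ := Finset.nonempty_iff_ne_empty.2 hne
  exact (((hC.mem_shifts_cellPoint_iff G.2.1).1 hshift).2 i hi).ne (hm i.1 i.2)

theorem cellCoeff_resolutionMap [Fintype (primitiveNormals C)]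
    (g : ResolutionTerm k C c d x (n + 1)) (p : Σ i : Fin s, Fin (d i)) (m : M) :
    cellCoeff hC (resolutionMap k C c d x n g) p m = cellDiff C x (cellCoeff hC g p m) := by
  funext E'
  by_cases hE' : IsCell (normalMap C) (wall C x) E' ∧ rk (normalMap C) E' = n
  · rw [cellCoeff, dif_pos hE', resolutionMap_apply, map_sum, AddMonoidAlgebra.coeff_sum,
      Finsupp.finsetSum_apply]
    refine Fintype.sum_of_injective (fun E : CellIndex C x (n + 1) => E.1) Subtype.val_injective
      _ _ (fun E hE => ?_) fun E => ?_
    · by_contra h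
      obtain ⟨G, hG, -⟩ := exists_index_of_cellCoeff_ne_zero (right_ne_zero_of_mul h)
      exact hE ⟨G, hG⟩
    · rw [coeff_symbolAt_postcomp_scalarHom hC hC.zero_mem_shifts_of_inc_ne_zero, cellCoeff_apply]
  · rw [cellCoeff, dif_neg hE']
    by_contra h
    obtain ⟨E, hcov, hE⟩ := exists_cover_of_cellDiff_ne_zero (Ne.symm h)
    obtain ⟨G, rfl, -⟩ := exists_index_of_cellCoeff_ne_zero hE
    exact hE' ⟨hcov.isCell_right, Nat.succ_injective (hcov.rk_eq.symm.trans G.2.2)⟩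

theorem cellDiff_cellCoeff_zero [Fintype (primitiveNormals C)]
    (g : ResolutionTerm k C c d x 0) (p : Σ i : Fin s, Fin (d i)) (m : M) :
    cellDiff C x (cellCoeff hC g p m) = 0 := by
  funext E
  by_contra h
  obtain ⟨G, hcov, hG⟩ := exists_cover_of_cellDiff_ne_zero h
  obtain ⟨G, rfl, -⟩ := exists_index_of_cellCoeff_ne_zero hG
  exact (Nat.succ_ne_zero _) (hcov.rk_eq.symm.trans G.2.2)

end Coefficients

section Exactness

variable {n : ℕ} (hC : IsFullRational C)

theorem zero_mem_shifts_emptyIndex :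
    (0 : M) ∈ shifts C x (cellPoint C x (emptyIndex hC x).1) ∧
      (0 : M) ∈ shifts C (cellPoint C x (emptyIndex hC x).1) x := by
  have hmem := hC.zero_mem_isoShifts_cellPoint_empty (x := x)
  have hneg := neg_mem_isoShifts hmem
  rw [neg_zero] at hneg
  exact ⟨hC.mem_shifts_of_mem_isoShifts hmem, hC.mem_shifts_of_mem_isoShifts hneg⟩

theorem augmentation_eq_zero_iff (hc : IsCompleteSum k C c d) (g : ResolutionTerm k C c d x 0) :
    augmentation k c d x hC g = 0 ↔
      ∀ p, ∀ m ∈ isoShifts C (c p.1) x, cellCoeff hC g p m ∅ = 0 := by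
  change Submodule.Quotient.mk _ = _ ↔ _
  rw [Submodule.Quotient.mk_eq_zero, hc.gradedRadical_eq hC, mem_noIsoSubmodule]
  refine forall₃_congr fun p m _ => ?_
  rw [LinearMap.comp_apply,
    coeff_symbolAt_postcomp_scalarHom hC fun _ => (zero_mem_shifts_emptyIndex hC).2, one_mul,
    LinearMap.proj_apply, ← cellCoeff_apply]
  rfl

theorem augmentation_surjective : Function.Surjective (augmentation k c d x hC) := by
  classical
  obtain ⟨hmem, hmem'⟩ := zero_mem_shifts_emptyIndex (x := x) hC
  have hsurj : Function.Surjective (postcomp (c := c) (d := d)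
      (scalarHom C (cellPoint C x (emptyIndex hC x).1) x (1 : k))) := fun f => by
    refine ⟨postcomp (scalarHom C x (cellPoint C x (emptyIndex hC x).1) (1 : k)) f,
      symbolAt_injective (hC := hC) fun p => ?_⟩
    ext m
    rw [coeff_symbolAt_postcomp_scalarHom hC fun _ => hmem',
      coeff_symbolAt_postcomp_scalarHom hC fun _ => hmem, one_mul, one_mul]
  exact (Submodule.mkQ_surjective _).comp (hsurj.comp (LinearMap.proj_surjective (emptyIndex hC x)))

variable [Fintype (primitiveNormals C)]

theorem exists_resolutionMap_eq {g : ResolutionTerm k C c d x n}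
    (hg : ∀ p m, cellDiff C x (cellCoeff hC g p m) = 0)
    (hiso : ∀ p, ∀ m ∈ isoShifts C (c p.1) x, cellCoeff hC g p m = 0) :
    ∃ h, resolutionMap k C c d x n h = g := by
  have hcell (p m E) (hE : cellCoeff hC g p m E ≠ 0) :
      IsCell (normalMap C) (wall C x) E ∧ m ∈ shifts C (c p.1) (cellPoint C x E) := by
    refine ⟨?_, mem_shifts_of_cellCoeff_ne_zero hE⟩
    obtain ⟨G, rfl, -⟩ := exists_index_of_cellCoeff_ne_zero hE
    exact G.2.1
  choose z hz hdz hz₀ using fun p m => hC.exists_cellDiff_eq (hcell p m) (hg p m) (hiso p m)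
  obtain ⟨h, hh⟩ := exists_cellCoeff_eq hC (n := n + 1)
    (fun p => (finite_setOf_cellCoeff_ne_zero hC g p).subset fun m => mt (hz₀ p m)) hz
  refine ⟨h, funext fun E => symbolAt_injective (hC := hC) fun p => ?_⟩
  ext m
  rw [← cellCoeff_apply, ← cellCoeff_apply, cellCoeff_resolutionMap, ← hdz]
  refine Finset.sum_congr rfl fun G _ => ?_
  by_cases hcov : IsCover (normalMap C) (wall C x) G E.1
  · rw [hh p m ⟨G, hcov.isCell_left, by rw [hcov.rk_eq, E.2.2]⟩]
  · rw [inc_of_not_isCover hcov, Int.cast_zero, zero_mul, zero_mul]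

include hC in
theorem range_resolutionMap_succ (n : ℕ) :
    LinearMap.range (resolutionMap k C c d x (n + 1)) =
      LinearMap.ker (resolutionMap k C c d x n) := by
  refine le_antisymm ?_ fun g hg => ?_
  · rintro _ ⟨h, rfl⟩
    refine LinearMap.mem_ker.2 (cellCoeff_injective (hC := hC) fun p m => ?_)
    rw [cellCoeff_resolutionMap, cellCoeff_resolutionMap, cellDiff_cellDiff, cellCoeff_zero]
  · refine exists_resolutionMap_eq hC (fun p m => ?_) fun p m => cellCoeff_succ_eq_zero hC g
    rw [← cellCoeff_resolutionMap, LinearMap.mem_ker.1 hg, cellCoeff_zero]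

theorem range_resolutionMap_zero (hc : IsCompleteSum k C c d) :
    LinearMap.range (resolutionMap k C c d x 0) = LinearMap.ker (augmentation k c d x hC) := by
  refine le_antisymm ?_ fun g hg => ?_
  · rintro _ ⟨h, rfl⟩
    refine LinearMap.mem_ker.2 ((augmentation_eq_zero_iff hC hc _).2 fun p m hm => ?_)
    rw [cellCoeff_resolutionMap, cellCoeff_succ_eq_zero hC h hm, cellDiff_zero, Pi.zero_apply]
  · refine exists_resolutionMap_eq hC (cellDiff_cellCoeff_zero hC g) fun p m hm => ?_
    funext E
    by_contra hE
    obtain ⟨G, rfl, -⟩ := exists_index_of_cellCoeff_ne_zero hE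
    rw [(hC.rk_eq_zero_iff G.2.1).1 G.2.2] at hE
    exact hE ((augmentation_eq_zero_iff hC hc g).1 hg p m hm)

theorem isProjectiveResolution (hc : IsCompleteSum k C c d) :
    IsProjectiveResolution (resolutionMap k C c d x) (augmentation k c d x hC) where
  projective := hc.projective_resolutionTerm
  surjective := augmentation_surjective hC
  range_zero := range_resolutionMap_zero hC hc
  range_succ := range_resolutionMap_succ hC

end Exactness

omit [Module.Finite ℤ M] in
theorem resolutionMap_single [Fintype (primitiveNormals C)] [DecidableEq (CellIndex C x (n + 1))]
    (E : CellIndex C x (n + 1)) (f : ProjectiveOf k C c d (cellPoint C x E.1))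
    (E' : CellIndex C x n) :
    resolutionMap k C c d x n (Pi.single E f) E' = postcomp (scalarHom C (cellPoint C x E.1)
      (cellPoint C x E'.1) (inc (normalMap C) (wall C x) E.1 E'.1 : k)) f := by
  let P (E : CellIndex C x (n + 1)) := ProjectiveOf k C c d (cellPoint C x E.1)
  rw [resolutionMap_apply, Finset.sum_eq_single E]
  · exact congrArg _ (Pi.single_eq_same (M := P) E f)
  · exact fun G _ hG => (congrArg _ (Pi.single_eq_of_ne (M := P) hG f)).trans (map_zero _)
  · exact fun h => absurd (Finset.mem_univ E) h

/-- The resolution is minimal: a non-zero entry of the differential is an inclusion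
`A_y ⊂ A_{y'}` which is proper, so that every homomorphism `A_{y'} → A_y` has zero constant
coefficient, and no combination of such entries restricts to the identity of `A_y`. -/
theorem resolutionMap_comp_ne_id [Fintype (primitiveNormals C)] (hC : IsFullRational C)
    (hc : IsCompleteSum k C c d) {n : ℕ} (E : CellIndex C x (n + 1))
    (ρ : ResolutionTerm k C c d x n →ₗ[(EndRing k C c d)ᵐᵒᵖ] ResolutionTerm k C c d x (n + 1)) :
    ρ.comp (resolutionMap k C c d x n) ≠ LinearMap.id := by
  classical
  intro hρ
  obtain ⟨ψ, hψ⟩ := hc.exists_apply_eq_sum_postcomp ρ E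
  obtain ⟨p, m, -, f, hf⟩ := hc.exists_symbolAt_eq_single hC (cellPoint C x E.1)
  let g : ResolutionTerm k C c d x (n + 1) := Pi.single E f
  have hentry (E') : (symbolAt hC p (postcomp (ψ E') (resolutionMap k C c d x n g E'))).coeff m =
      (symbol (ψ E')).coeff 0 * (inc (normalMap C) (wall C x) E.1 E'.1 : k) := by
    rw [resolutionMap_single, symbolAt_postcomp, symbolAt_postcomp,
      hC.symbol_scalarHom hC.zero_mem_shifts_of_inc_ne_zero, hf,
      AddMonoidAlgebra.single_mul_single, zero_add, mul_one,
      AddMonoidAlgebra.coeff_mul_single_apply, add_neg_cancel]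
  have hone : ∑ E', (symbol (ψ E')).coeff 0 * (inc (normalMap C) (wall C x) E.1 E'.1 : k) = 1 := by
    have hgE : ∑ E', postcomp (ψ E') (resolutionMap k C c d x n g E') = f := by
      rw [← hψ, ← LinearMap.comp_apply, hρ]
      exact Pi.single_eq_same
        (M := fun E : CellIndex C x (n + 1) => ProjectiveOf k C c d (cellPoint C x E.1)) E f
    have := congrArg (fun f => (symbolAt hC p f).coeff m) hgE
    simpa [hf, hentry] using this
  obtain ⟨E', -, hE'⟩ := Finset.exists_ne_zero_of_sum_ne_zero (hone ▸ one_ne_zero)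
  refine hC.zero_notMem_shifts_cellPoint ?_
    (hC.mem_shifts_of_coeff_symbol (ψ E') (left_ne_zero_of_mul hE'))
  by_contra hcov
  exact right_ne_zero_of_mul hE' (by rw [inc_of_not_isCover hcov, Int.cast_zero])

open CategoryTheory in
theorem IsCompleteSum.pdimSimple_eq (hc : IsCompleteSum k C c d) (hC : IsFullRational C) {e : ℕ}
    (he : Nonempty (CellIndex C x e)) (he' : IsEmpty (CellIndex C x (e + 1))) :
    pdimSimple k C c d x = e := by
  have := hC.finite_primitiveNormals.fintype
  have hzero : Subsingleton (ResolutionTerm k C c d x (e + 1)) := inferInstance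
  have hres := isProjectiveResolution (x := x) hC hc
  refine le_antisymm ((projectiveDimension_le_iff _ _).2 (hres.hasProjectiveDimensionLT hzero))
    ((projectiveDimension_ge_iff _ _).2 fun hlt => ?_)
  cases e with
  | zero =>
    rw [hasProjectiveDimensionLT_zero_iff_isZero, ModuleCat.isZero_of_iff_subsingleton,
      Submodule.Quotient.subsingleton_iff, hc.gradedRadical_eq hC] at hlt
    exact hc.noIsoSubmodule_ne_top hC hlt
  | succ e =>
    obtain ⟨ρ, hρ⟩ := hres.exists_retraction hzero hlt
    exact resolutionMap_comp_ne_id hC hc he.some ρ hρ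

end Resolution

/-! ### Codimensions and free conic modules -/

section Codimension

section Functionals

variable {V ι : Type*} [AddCommGroup V] [Module ℝ V] [Finite ι] {a : ι → V →ₗ[ℝ] ℝ} {b : ι → ℝ}
  {E : Finset ι} {y u : V}

theorem InCell.exists_pos_add_smul (hy : InCell a b E y) (hu : ∀ i ∈ E, a i u = 0) :
    ∃ ε : ℝ, 0 < ε ∧ InCell a b E (y + ε • u) := by
  obtain ⟨ε, hε, hlt⟩ := exists_pos_forall_add_mul_lt (α := {i // i ∉ E} ⊕ {i // i ∉ E})
    (p := Sum.elim (fun i => a i y) (fun i => -a i y))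
    (r := Sum.elim (fun i => b i) (fun i => 1 - b i))
    (Sum.elim (fun i => a i u) (fun i => -a i u)) (by
      rintro (i | i)
      · exact (hy.2 i i.2).2
      · rw [Sum.elim_inr, Sum.elim_inr]
        linarith [(hy.2 i i.2).1])
  refine ⟨ε, hε, fun i hi => ?_, fun i hi => ?_⟩
  · rw [map_add, map_smul, hu i hi, smul_zero, add_zero, hy.1 i hi]
  · have hupper := hlt (Sum.inl ⟨i, hi⟩)
    have hlower := hlt (Sum.inr ⟨i, hi⟩)
    simp only [Sum.elim_inl, Sum.elim_inr] at hupper hlower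
    rw [map_add, map_smul, smul_eq_mul]
    constructor <;> linarith

theorem direction_affineSpan_setOf_inCell (hE : IsCell a b E) :
    (affineSpan ℝ {y | InCell a b E y}).direction = (labelSpan a E).dualCoannihilator := by
  rw [direction_affineSpan, vectorSpan_def]
  refine le_antisymm (Submodule.span_le.2 ?_) fun u hu => ?_
  · rintro _ ⟨y, hy, z, hz, rfl⟩
    refine mem_dualCoannihilator_labelSpan.2 fun i hi => ?_
    exact (map_sub _ _ _).trans (sub_eq_zero.2 ((hy.1 i hi).trans (hz.1 i hi).symm))
  · obtain ⟨y, hy⟩ := hE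
    obtain ⟨ε, hε, hyu⟩ := hy.exists_pos_add_smul (mem_dualCoannihilator_labelSpan.1 hu)
    exact (Submodule.smul_mem_iff _ hε.ne').1 (Submodule.subset_span ⟨_, hyu, y, hy, by simp⟩)

theorem finrank_quotient_direction_affineSpan (hE : IsCell a b E) :
    Module.finrank ℝ (V ⧸ (affineSpan ℝ {y | InCell a b E y}).direction) = rk a E := by
  rw [direction_affineSpan_setOf_inCell hE, finrank_quotient_dualCoannihilator, rk]

end Functionals

variable {M : Type*} [AddCommGroup M] {C : PointedCone ℝ (RealSpace M)} {x y : RealSpace M}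

theorem translatePoints_subset_of_conicModule_le {k : Type*} [Field k]
    (h : conicModule k C x ≤ conicModule k C y) : translatePoints C x ⊆ translatePoints C y := by
  intro m hm
  refine toLaurent_mem (k := k) ⟨_, h (monomial k hm).2⟩ (m := m) ?_
  change (AddMonoidAlgebra.single m (1 : k)).coeff m ≠ 0
  rw [AddMonoidAlgebra.coeff_single, Finsupp.single_eq_same]
  exact one_ne_zero

theorem openCell_image (E : Finset (primitiveNormals C)) :
    openCell C x (Subtype.val '' {n : primitiveNormals C | n ∉ E}) =
      {y | InCell (normalMap C) (wall C x) E y} := by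
  ext y
  refine ⟨fun h => ⟨fun n hn => h.2 n.1 ⟨n.2, ?_⟩, fun n hn => h.1 n.1 ⟨n, hn, rfl⟩⟩,
    fun h => ⟨?_, ?_⟩⟩
  · rwa [Subtype.val_injective.mem_set_image, Set.mem_ofPred_eq, not_not]
  · rintro _ ⟨n, hn, rfl⟩
    exact h.2 n hn
  · rintro n ⟨hn, hnE⟩
    refine h.1 ⟨n, hn⟩ ?_
    by_contra hcon
    exact hnE ⟨⟨n, hn⟩, hcon, rfl⟩

variable [Module.Finite ℤ M]

theorem IsFullRational.level_eq_of_mem_chamber (hC : IsFullRational C) (k : Type*) [Field k]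
    (hy : y ∈ chamber k C x) {n : Module.Dual ℤ M} (hn : n ∈ primitiveNormals C) :
    level y n = level x n := by
  have hy' : conicModule k C y = conicModule k C x := hy
  exact le_antisymm
    (hC.translatePoints_subset_iff.1 (translatePoints_subset_of_conicModule_le hy'.ge) n hn)
    (hC.translatePoints_subset_iff.1 (translatePoints_subset_of_conicModule_le hy'.le) n hn)

theorem codim_image_cells (k : Type*) [Field k] (hC : IsFullRational C) :
    codim '' cells C (chamber k C x) = {e | Nonempty (CellIndex C x e)} := by
  classical
  have := hC.finite_primitiveNormals.fintype
  ext e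
  constructor
  · rintro ⟨_, ⟨hne, y, hy, Ω, hΩ, rfl⟩, rfl⟩
    have hwall : wall C y = wall C x :=
      funext fun n => congrArg Int.cast (hC.level_eq_of_mem_chamber k hy n.2)
    let E : Finset (primitiveNormals C) := Finset.univ.filter fun n => n.1 ∉ Ω
    have hE : Subtype.val '' {n : primitiveNormals C | n ∉ E} = Ω := by
      ext n
      simpa [E] using @hΩ n
    rw [← hE, openCell_image, hwall] at hne ⊢
    exact ⟨E, hne, (finrank_quotient_direction_affineSpan hne).symm⟩
  · rintro ⟨E, hE, rfl⟩
    refine ⟨_, ⟨hE, x, rfl, _, ?_, (openCell_image E).symm⟩,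
      finrank_quotient_direction_affineSpan hE⟩
    rintro _ ⟨n, -, rfl⟩
    exact n.2

theorem IsFullRational.rk_univ [Fintype (primitiveNormals C)] (hC : IsFullRational C) :
    rk (normalMap C) Finset.univ = Module.finrank ℝ (RealSpace M ⧸ C.lineal) := by
  have hlineal : (labelSpan (normalMap C) Finset.univ).dualCoannihilator = C.lineal := by
    ext u
    rw [mem_dualCoannihilator_labelSpan, ← hC.forall_realFunctional_eq_zero_iff]
    simp only [Finset.mem_univ, true_imp_iff, Subtype.forall]
    rfl
  rw [rk, ← finrank_quotient_dualCoannihilator, hlineal]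

theorem IsFullRational.rk_le (hC : IsFullRational C) (E : Finset (primitiveNormals C)) :
    rk (normalMap C) E ≤ Module.finrank ℝ (RealSpace M ⧸ C.lineal) := by
  have := hC.finite_primitiveNormals.fintype
  rw [← hC.rk_univ]
  exact Submodule.finrank_mono (labelSpan_mono E.subset_univ)

omit [Module.Finite ℤ M] in
theorem IsStronglyConvex.finrank_quotient_lineal [Module.Free ℤ M] (hC : IsStronglyConvex C) :
    Module.finrank ℝ (RealSpace M ⧸ C.lineal) = Module.finrank ℤ M := by
  have hlineal : C.lineal = ⊥ := eq_bot_iff.2 fun u hu =>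
    hC u (PointedCone.mem_lineal.1 hu).1 (PointedCone.mem_lineal.1 hu).2
  rw [hlineal, (Submodule.quotEquivOfEqBot _ rfl).finrank_eq]
  exact Module.finrank_baseChange

end Codimension

section Free

variable {k : Type*} [Field k] {M : Type*} [AddCommGroup M]
  {C : PointedCone ℝ (RealSpace M)} {x : RealSpace M}

variable (k C) in
/-- The conic module of the origin is the toric algebra. -/
def zeroEquiv : ConicModule k C 0 ≃ₗ[toricAlgebra k C] toricAlgebra k C where
  toFun g := ⟨g.1, g.2⟩
  invFun r := ⟨r.1, r.2⟩
  map_add' _ _ := rfl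
  map_smul' _ _ := rfl
  left_inv _ := rfl
  right_inv _ := rfl

variable [Module.Finite ℤ M]

theorem IsFullRational.subsingleton_of_basis (hC : IsFullRational C) {I : Type*}
    (b : Module.Basis I (toricAlgebra k C) (ConicModule k C x)) : Subsingleton I := by
  obtain ⟨u, hu⟩ := hC.exists_single_mul_mem k x
  refine ⟨fun i j => ?_⟩
  by_contra hij
  have hrel : (⟨_, hu (b i)⟩ : toricAlgebra k C) • b j
      = (⟨_, hu (b j)⟩ : toricAlgebra k C) • b i := by
    apply toLaurent_injective
    simp only [toLaurent_smul]
    ring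
  have hcoord := congrArg (fun g => b.repr g j) hrel
  simp only [map_smul, Module.Basis.repr_self, Finsupp.smul_apply, Finsupp.single_eq_same,
    Finsupp.single_eq_of_ne (Ne.symm hij), smul_eq_mul, mul_one, mul_zero] at hcoord
  have hzero : AddMonoidAlgebra.single u 1 * toLaurent k (b i) = 0 := congrArg Subtype.val hcoord
  have hbi := (isUnit_single_one u).mul_right_eq_zero.1 hzero
  exact b.ne_zero i (toLaurent_injective hbi)

theorem IsFullRational.nontrivial_conicModule (hC : IsFullRational C) (x : RealSpace M) :
    Nontrivial (ConicModule k C x) := by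
  obtain ⟨m, hm⟩ := hC.translatePoints_nonempty x
  refine ⟨monomial k hm, 0, fun h => ?_⟩
  have hcoeff := congrArg (fun g => (toLaurent k g).coeff m) h
  simp at hcoeff

theorem IsFullRational.exists_linearEquiv_zero_of_free (hC : IsFullRational C)
    (hfree : Module.Free (toricAlgebra k C) (ConicModule k C x)) :
    Nonempty (ConicModule k C 0 ≃ₗ[toricAlgebra k C] ConicModule k C x) := by
  obtain ⟨I, b⟩ := Module.Free.exists_basis (toricAlgebra k C) (ConicModule k C x)
  have := hC.subsingleton_of_basis b
  have := hC.nontrivial_conicModule (k := k) x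
  exact ⟨(zeroEquiv k C).trans
    (b.repr.trans (Finsupp.uniqueLinearEquiv _ _ b.index_nonempty.some)).symm⟩

theorem IsFullRational.nonempty_cellIndex_of_free (hC : IsFullRational C)
    (hfree : Module.Free (toricAlgebra k C) (ConicModule k C x)) :
    Nonempty (CellIndex C x (Module.finrank ℝ (RealSpace M ⧸ C.lineal))) := by
  have := hC.finite_primitiveNormals.fintype
  obtain ⟨e⟩ := hC.exists_linearEquiv_zero_of_free hfree
  obtain ⟨m, hm⟩ := hC.isoShifts_nonempty_of_linearEquiv e
  refine ⟨Finset.univ, ⟨latticePoint m, fun n _ => ?_,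
    fun n hn => absurd (Finset.mem_univ n) hn⟩, hC.rk_univ⟩
  change realFunctional n.1 (latticePoint m) = (level x n.1 : ℝ)
  rw [realFunctional_latticePoint, hm n.1 n.2, level_zero, add_zero]

end Free

end ConicModules

end

open ConicModules in
theorem corollary6p7_general {k : Type*} [Field k] {M : Type*} [AddCommGroup M]
    [Module.Finite ℤ M] (C : PointedCone ℝ (RealSpace M)) (hrational : IsRationalPolyhedral C)
    (hfull : IsFullDimensional C) {s : ℕ} (c : Fin s → RealSpace M) (d : Fin s → ℕ)
    (hcomplete : IsCompleteSum k C c d) (x : RealSpace M) :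
    (∃ e : ℕ, IsGreatest (codim '' cells C (chamber k C x)) e ∧
      pdimSimple k C c d x = (e : WithBot ℕ∞)) ∧
    pdimSimple k C c d x ≤ (Module.finrank ℝ (RealSpace M ⧸ C.lineal) : WithBot ℕ∞) ∧
    (Module.Free (toricAlgebra k C) (ConicModule k C x) →
      pdimSimple k C c d x = (Module.finrank ℝ (RealSpace M ⧸ C.lineal) : WithBot ℕ∞)) := by
  have hC : IsFullRational C := ⟨hrational, hfull⟩
  have hbound : ∀ e ∈ {e | Nonempty (CellIndex C x e)},
      e ≤ Module.finrank ℝ (RealSpace M ⧸ C.lineal) := by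
    rintro _ ⟨E, -, rfl⟩
    exact hC.rk_le E
  obtain ⟨e, he⟩ : ∃ e, IsGreatest {e | Nonempty (CellIndex C x e)} e :=
    BddAbove.exists_isGreatest_of_nonempty ⟨_, hbound⟩ ⟨0, ⟨emptyIndex hC x⟩⟩
  have hpdim : pdimSimple k C c d x = e := hcomplete.pdimSimple_eq hC he.1
    (not_nonempty_iff.1 fun h => e.lt_succ_self.not_ge (he.2 h))
  rw [hpdim, codim_image_cells k hC]
  exact ⟨⟨e, he, rfl⟩, mod_cast hbound e he.1, fun hfree =>
    mod_cast (hbound e he.1).antisymm (he.2 (hC.nonempty_cellIndex_of_free hfree))⟩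

theorem corollary6p7 {k : Type*} [Field k] {M : Type*} [AddCommGroup M]
    [Module.Free ℤ M] [Module.Finite ℤ M]
    (C : PointedCone ℝ (ConicModules.RealSpace M))
    (hrational : ConicModules.IsRationalPolyhedral C)
    (hfull : ConicModules.IsFullDimensional C)
    (hpointed : ConicModules.IsStronglyConvex C)
    {s : ℕ} (c : Fin s → ConicModules.RealSpace M) (d : Fin s → ℕ)
    (hcomplete : ConicModules.IsCompleteSum k C c d)
    (x : ConicModules.RealSpace M) :
    (∃ e : ℕ,
      IsGreatest (ConicModules.codim '' ConicModules.cells C (ConicModules.chamber k C x)) e ∧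
      ConicModules.pdimSimple k C c d x = (e : WithBot ℕ∞)) ∧
    ConicModules.pdimSimple k C c d x ≤ (Module.finrank ℤ M : WithBot ℕ∞) ∧
    (Module.Free (ConicModules.toricAlgebra k C) (ConicModules.ConicModule k C x) →
      ConicModules.pdimSimple k C c d x = (Module.finrank ℤ M : WithBot ℕ∞)) := by
  rw [← hpointed.finrank_quotient_lineal]
  exact corollary6p7_general C hrational hfull c d hcomplete x
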